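/- **Setting.** Groups act on the right; $x^g=g^{-1}xg$, $[x,y]=x^{-1}y^{-1}xy$, and $g^{c_1h_1+\dots+c_rh_r}=(g^{c_1})^{h_1}\cdots(g^{c_r})^{h_r}$ for $c_i\in\mathbb Z$. Let $X=\{0,1\}$, and write $\langle g_0,g_1\rangle\in\mathrm{Aut}(X^*)$ for the automorphism of the binary rooted tree acting as $g_c$ on the subtree $cX^*$; $\sigma$ exchanges the two letters in the first position. Let $w=y_1\dots y_k$ and $v=x_1\dots x_n$ be non-empty words over $X$ with $y_k\neq x_n$ and $(k,n)\ne(1,1)$. Let $K(w,v)\le\mathrm{Aut}(X^*)$ be generated by the involutions $b_1,\dots,b_k,a_1,\dots,a_n$, where $b_1=\sigma$; $b_{j+1}$ $(1\le j<k)$ acts as $b_j$ on the subtree of the letter $y_j$ and trivially on the other one; $a_1$ acts as $a_n$ on the subtree of $x_n$ and as $b_k$ on that of $y_k$; and $a_{i+1}$ $(1\le i<n)$ acts as $a_i$ on the subtree of $x_i$ and trivially on the other one. Let $d$ be maximal with $v=z^d$ for some word $z$. Put $m=2$ if $k=1$ or $(k,n)=(2,1)$, and $m=1$ otherwise. A *twist*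 is a word $s$ which is trivial if $k=1$, is a word in $b_1$ if $k,n\ge2$ or $(k,n)=(2,1)$, and is a word in $b_1,b_2$ if $k\ge3$, $n=1$, such that $(a_n^sb_k)^{2^m}=1$ in $K(w,v)$. **Theorem.** Twists exist. Let $s$ be any twist. There is a unique endomorphism $\varphi$ of $K(w,v)$ with $$\varphi(b_j)=b_{j+1}^{\,b_1^{y_j}}\ (j<k),\quad \varphi(b_k)=a_1^{\,u b_1^{y_k}},\quad \varphi(a_i)=a_{i+1}^{\,b_1^{x_i}}\ (i<n),\quad \varphi(a_n)=a_1^{\,b_1^{x_n}},$$ where $u=\varphi(s)^{b_1^{1-y_k}}$ (so $u=\langle s,1\rangle$ if $y_k=1$ and $u=\langle1,s\rangle$ if $y_k=0$), and $\varphi$ is injective. Write $p(t)=x_n+x_{n-1}t+\dots+x_1t^{n-1}$ and $q(t)=y_k+y_{k-1}t+\dots+y_1t^{k-1}$, and let $p_r(t)=x_n+\dots+x_{n-r+1}t^{r-1}$ be the part of $p$ of degree less than $r$. Let $G$ be the group with generators $a,b,t$ and the finitely many relators $$a^2,\quad b^2,\quad (ab)^{2^{m+1}},\quad b^{t^k}a^{b^{q(t)}},\quad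 a^{u^{-1}(t^n-b^{p(t)})},$$ $$\big[a^{u^{-1}b^{p_{jn/d}(t)}},\,a^{u^{-1}t^{jn/d}}\big]\quad(1\le j<d),$$ $$\big[b^{t^i},b^{t^jo}\big]\ (1\le i,j<k),\qquad \big[a^{t^i},b^{t^jo}\big]\ (1\le i<n,\ 1\le j<k),\qquad \big[a^{t^i},a^{t^jo}\big]\ (1\le i,j<n),$$ where $o$ runs through the words $a^{\varepsilon}b(ab)^{2\ell}$ with $\varepsilon\in\{0,1\}$, $0\le\ell\le2^m$ (these represent all elements of the dihedral group $\langle a,b\rangle$ with an odd number of $b$'s), and where $u$ is the word $(s^{t})^{b^{1-y_k}}$ in $b,t$, in which $b_1$ stands for $b$ and $b_2$ for $b^{t\,b^{y_1}}$. Then: 1. $G$ is finitely presented and is generated by $b$ and $t$ (the generator $a$ is redundant); 2. there is an isomorphism $\iota$ from $K(w,v)$ onto the subgroup $\langle a,a^t,\dots,a^{t^{n-1}},b,b^t,\dots,b^{t^{k-1}}\rangle$ of $G$ with $\iota(b_1)=b$, $\iota(a_1^u)=a$ and $\iota(\varphi(g))=\iota(g)^t$ for all $g$; 3. $G$ is the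 ascending HNN extension of $K(w,v)$ by $\varphi$: there is an isomorphism from $G$ to $\langle K(w,v),t\mid g^t=\varphi(g)\ (g\in K(w,v))\rangle$ that sends $t$ to $t$ and $\iota(g)$ to $g$ for all $g\in K(w,v)$. -/

import Mathlib

namespace Kneading

/-! ### The binary rooted tree and its automorphism group

The letters `0` and `1` are `false` and `true`, the vertices of the tree are the finite words
`List Bool`, and a tree automorphism is a bijection that preserves the prefix relation in both
directions.  Groups act on the right: in a product `g * h` the factor `g` acts first, whence the
opposite of the group of bijections under composition. -/

/-- `Aut(X*)` for `X = {0,1}`, acting on the right. -/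
abbrev TreeAut : Type :=
  ((List.IsPrefix : List Bool → List Bool → Prop) ≃r
    (List.IsPrefix : List Bool → List Bool → Prop))ᵐᵒᵖ

/-- Action of the states `b`. Everything is indexed from `0`: `bAct w j` is the action of the
generator `b_{j+1}`, and `w.getD j false` is the letter `y_{j+1}` of `w = y_1 … y_k`. So
`b_1 = σ`, and `b_{j+2}` is `b_{j+1}` on the subtree of the letter `y_{j+1}`, trivial on the
other subtree. -/
def bAct (w : List Bool) : ℕ → List Bool → List Bool
  | _, [] => []
  | 0, c :: r => (!c) :: r
  | j + 1, c :: r => c :: (if c = w.getD j false then bAct w j r else r)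

/-- Action of the states `a`, indexed from `0`: `a_1` is `a_n` on the subtree of the letter `x_n`
and `b_k` on the other subtree; `a_{i+2}` is `a_{i+1}` on the subtree of the letter `x_{i+1}` and
trivial on the other subtree. -/
def aAct (w v : List Bool) : ℕ → List Bool → List Bool
  | _, [] => []
  | 0, c :: r => c :: (if c = v.getD (v.length - 1) false then aAct w v (v.length - 1) r
      else bAct w (w.length - 1) r)
  | i + 1, c :: r => c :: (if c = v.getD i false then aAct w v i r else r)

theorem bAct_bAct (w : List Bool) (l : List Bool) : ∀ j, bAct w j (bAct w j l) = l := by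
  induction l with
  | nil => intro j; cases j <;> simp [bAct]
  | cons c r ih =>
    intro j
    cases j with
    | zero => simp [bAct]
    | succ j => simp only [bAct]; split_ifs <;> simp [ih]

theorem aAct_aAct (w v : List Bool) (l : List Bool) :
    ∀ i, aAct w v i (aAct w v i l) = l := by
  induction l with
  | nil => intro i; cases i <;> simp [aAct]
  | cons c r ih =>
    intro i
    cases i with
    | zero => simp only [aAct]; split_ifs <;> simp [ih, bAct_bAct]
    | succ i => simp only [aAct]; split_ifs <;> simp [ih]

theorem bAct_prefix (w : List Bool) {l l' : List Bool} (h : l <+: l') :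
    ∀ j, bAct w j l <+: bAct w j l' := by
  induction l generalizing l' with
  | nil => intro j; cases j <;> simp [bAct]
  | cons c r ih =>
    obtain _ | ⟨c', r'⟩ := l'
    · simp at h
    · obtain ⟨rfl, h'⟩ := List.cons_prefix_cons.1 h
      intro j
      cases j with
      | zero => simpa [bAct] using h'
      | succ j =>
        simp only [bAct, List.cons_prefix_cons, true_and]
        split_ifs
        · exact ih h' j
        · exact h'

theorem aAct_prefix (w v : List Bool) {l l' : List Bool} (h : l <+: l') :
    ∀ i, aAct w v i l <+: aAct w v i l' := by
  induction l generalizing l' with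
  | nil => intro i; cases i <;> simp [aAct]
  | cons c r ih =>
    obtain _ | ⟨c', r'⟩ := l'
    · simp at h
    · obtain ⟨rfl, h'⟩ := List.cons_prefix_cons.1 h
      intro i
      cases i with
      | zero =>
        simp only [aAct, List.cons_prefix_cons, true_and]
        split_ifs
        · exact ih h' _
        · exact bAct_prefix w h' _
      | succ i =>
        simp only [aAct, List.cons_prefix_cons, true_and]
        split_ifs
        · exact ih h' i
        · exact h'

/-- The tree automorphism given by a prefix-preserving involution of the set of words. -/
def ofInvol (f : List Bool → List Bool) (hf : ∀ l, f (f l) = l)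
    (hp : ∀ l l', l <+: l' → f l <+: f l') : TreeAut :=
  MulOpposite.op
    { toFun := f
      invFun := f
      left_inv := hf
      right_inv := hf
      map_rel_iff' := fun {l l'} =>
        ⟨fun h => by simpa only [Equiv.coe_fn_mk, hf] using hp _ _ h, hp l l'⟩ }

/-- The generator `b_{j+1}` as a tree automorphism. -/
def treeB (w : List Bool) (j : ℕ) : TreeAut :=
  ofInvol (bAct w j) (fun l => bAct_bAct w l j) (fun _ _ h => bAct_prefix w h j)

/-- The generator `a_{i+1}` as a tree automorphism. -/
def treeA (w v : List Bool) (i : ℕ) : TreeAut :=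
  ofInvol (aAct w v i) (fun l => aAct_aAct w v l i) (fun _ _ h => aAct_prefix w v h i)

/-- The group `K(w,v) = ⟨b_1, …, b_k, a_1, …, a_n⟩ ≤ Aut(X*)`. -/
def K (w v : List Bool) : Subgroup TreeAut :=
  Subgroup.closure ({g | ∃ j < w.length, g = treeB w j} ∪ {g | ∃ i < v.length, g = treeA w v i})

/-- `b_{j+1}` as an element of `K(w,v)`. -/
def genB (w v : List Bool) (j : ℕ) (hj : j < w.length) : K w v :=
  ⟨treeB w j, Subgroup.subset_closure (Or.inl ⟨j, hj, rfl⟩)⟩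

/-- `a_{i+1}` as an element of `K(w,v)`. -/
def genA (w v : List Bool) (i : ℕ) (hi : i < v.length) : K w v :=
  ⟨treeA w v i, Subgroup.subset_closure (Or.inr ⟨i, hi, rfl⟩)⟩

/-! ### Conjugates, commutators and exponents in `ℤ[t]` -/

section Exponents

variable {G : Type*} [Group G]

/-- `x ^ g = g⁻¹ x g`. -/
def cj (x g : G) : G := g⁻¹ * x * g

/-- `[x, y] = x⁻¹ y⁻¹ x y`. -/
def cm (x y : G) : G := x⁻¹ * y⁻¹ * x * y

/-- `g ^ c` for a digit `c ∈ {0,1}`. -/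
def dpow (g : G) (c : Bool) : G := if c then g else 1

/-- `g ^ (c₀ + c₁ t + c₂ t² + ⋯) = g ^ c₀ * (g ^ c₁) ^ t * (g ^ c₂) ^ (t²) * ⋯`, the polynomial
being given by the list of its coefficients, constant term first. -/
def polyPow (g t : G) : List Bool → G
  | [] => 1
  | c :: l => dpow g c * cj (polyPow g t l) t

end Exponents

/-! ### The auxiliary data `m` and `s` -/

/-- The exponent `m ∈ {1,2}`: it is `2` if `k = 1` or `(k,n) = (2,1)`, and `1` otherwise. -/
def mExp (k n : ℕ) : ℕ := if k = 1 ∨ (k = 2 ∧ n = 1) then 2 else 1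

/-- The generators `b_i` that may be used in the word `s`: none if `k = 1`, only `b_1` if
`k, n ≥ 2` or `(k,n) = (2,1)`, and `b_1, b_2` if `k ≥ 3` and `n = 1`. (The index `i` stands for
`b_{i+1}`.) -/
def twistGens (k n : ℕ) : Set ℕ := if k = 1 then ∅ else if 3 ≤ k ∧ n = 1 then {0, 1} else {0}

/-- Value in `Aut(X*)` of a word in symbols `b_1, b_2, …`. -/
def evalTree (w : List Bool) : FreeGroup ℕ →* TreeAut := FreeGroup.lift (treeB w)

/-- `s` is an admissible twist: it is a word in the permitted `b`'s such that
`(a_n^s b_k)^{2^m} = 1` in `K(w,v)`, i.e. such that the group generated by the two involutions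
`a_n^s` and `b_k` is dihedral of order `2^{m+1}` (for `m = 1`: such that they commute). -/
def IsTwist (w v : List Bool) (s : FreeGroup ℕ) : Prop :=
  s ∈ Subgroup.closure (FreeGroup.of '' twistGens w.length v.length) ∧
    (cj (treeA w v (v.length - 1)) (evalTree w s) * treeB w (w.length - 1)) ^
      2 ^ mExp w.length v.length = 1

/-! ### The endomorphism `φ` -/

/-- Given `φ`, the element `u = φ(s)` if `y_k = 1` and `u = φ(s)^{b_1}` if `y_k = 0`, where `s` is
(the value of) the twist. As `φ(s) = ⟨s,1⟩`, this is the element with coordinate `s` in the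
place where `a_1` has the coordinate `a_n`, and coordinate `1` in the other place. -/
def uElt (w v : List Bool) (hw : 0 < w.length) (s : K w v) (φ : K w v →* K w v) : K w v :=
  cj (φ s) (dpow (genB w v 0 hw) (!(w.getD (w.length - 1) false)))

/-- `φ` takes the prescribed values on the generators:
`φ(b_j) = b_{j+1}^{b_1^{y_j}}` for `j < k`, `φ(b_k) = a_1^{u b_1^{y_k}}`,
`φ(a_i) = a_{i+1}^{b_1^{x_i}}` for `i < n`, `φ(a_n) = a_1^{b_1^{x_n}}`.
The element `u` only involves the values of `φ` on `b_j` with `j < k`. -/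
structure IsShift (w v : List Bool) (hw : 0 < w.length) (hv : 0 < v.length) (s : K w v)
    (φ : K w v →* K w v) : Prop where
  b_succ : ∀ (j : ℕ) (hj : j + 1 < w.length), φ (genB w v j (by omega)) =
    cj (genB w v (j + 1) hj) (dpow (genB w v 0 hw) (w.getD j false))
  b_last : φ (genB w v (w.length - 1) (by omega)) =
    cj (genA w v 0 hv) (uElt w v hw s φ * dpow (genB w v 0 hw) (w.getD (w.length - 1) false))
  a_succ : ∀ (i : ℕ) (hi : i + 1 < v.length), φ (genA w v i (by omega)) =
    cj (genA w v (i + 1) hi) (dpow (genB w v 0 hw) (v.getD i false))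
  a_last : φ (genA w v (v.length - 1) (by omega)) =
    cj (genA w v 0 hv) (dpow (genB w v 0 hw) (v.getD (v.length - 1) false))

/-- The ascending HNN extension `⟨G, t | g^t = φ(g) for g ∈ G⟩` of `G` by an injective
endomorphism `φ`. -/
noncomputable abbrev AscendingHNN {G : Type*} [Group G] (φ : G →* G)
    (hφ : Function.Injective φ) : Type _ :=
  HNNExtension G φ.range ⊤ ((MonoidHom.ofInjective hφ).symm.trans Subgroup.topEquiv.symm)

/-! ### The finitely presented group -/

/-- The three generators. -/
inductive Gen : Type
  | a
  | b
  | t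

/-- The letter `a` of the free group on `a`, `b`, `t`. -/
def fa : FreeGroup Gen := FreeGroup.of Gen.a
/-- The letter `b`. -/
def fb : FreeGroup Gen := FreeGroup.of Gen.b
/-- The letter `t`. -/
def ft : FreeGroup Gen := FreeGroup.of Gen.t

/-- `b_{j+1}` expressed in `b` and `t`: `b_1 = b` and `b_{j+1} = (b_j^t)^{b^{y_j}}`. -/
def bWord (w : List Bool) : ℕ → FreeGroup Gen
  | 0 => fb
  | j + 1 => cj (cj (bWord w j) ft) (dpow fb (w.getD j false))

/-- `u` expressed in `b` and `t`: `u = s^t` if `y_k = 1` and `u = s^{tb}` if `y_k = 0`. -/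
def uWord (w : List Bool) (s : FreeGroup ℕ) : FreeGroup Gen :=
  cj (cj (FreeGroup.lift (bWord w) s) ft) (dpow fb (!(w.getD (w.length - 1) false)))

/-- `b^{q(t)}` with `q(t) = y_k + y_{k-1} t + ⋯ + y_1 t^{k-1}`. -/
def bq (w : List Bool) : FreeGroup Gen := polyPow fb ft w.reverse

/-- `b^{p(t)}` with `p(t) = x_n + x_{n-1} t + ⋯ + x_1 t^{n-1}`. -/
def bp (v : List Bool) : FreeGroup Gen := polyPow fb ft v.reverse

/-- `b^{p_r(t)}`, where `p_r(t) = x_n + x_{n-1} t + ⋯ + x_{n-r+1} t^{r-1}` consists of the terms of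
`p` of degree less than `r`. -/
def bpTrunc (v : List Bool) (r : ℕ) : FreeGroup Gen := polyPow fb ft (v.reverse.take r)

/-- The words `a^ε b (ab)^{2ℓ}` with `ε ∈ {0,1}` and `0 ≤ ℓ ≤ 2^m`. They represent all the elements
of the dihedral group `⟨a, b⟩` that contain an odd number of `b`'s. -/
def oddWords (m : ℕ) : Set (FreeGroup Gen) :=
  {o | ∃ ε ≤ 1, ∃ l ≤ 2 ^ m, o = fa ^ ε * fb * (fa * fb) ^ (2 * l)}

/-- The defining relators. -/
def relators (w v : List Bool) (d : ℕ) (s : FreeGroup ℕ) : Set (FreeGroup Gen) :=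
  let k := w.length
  let n := v.length
  let m := mExp k n
  let u := uWord w s
  {fa ^ 2, fb ^ 2, (fa * fb) ^ 2 ^ (m + 1),
    cj fb (ft ^ k) * cj fa (bq w),
    cj fa (u⁻¹ * ft ^ n) * cj fa⁻¹ (u⁻¹ * bp v)} ∪
  {r | ∃ j, 1 ≤ j ∧ j < d ∧
    r = cm (cj fa (u⁻¹ * bpTrunc v (j * (n / d)))) (cj fa (u⁻¹ * ft ^ (j * (n / d))))} ∪
  {r | ∃ i j, ∃ o ∈ oddWords m, 1 ≤ i ∧ i < k ∧ 1 ≤ j ∧ j < k ∧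
    r = cm (cj fb (ft ^ i)) (cj fb (ft ^ j * o))} ∪
  {r | ∃ i j, ∃ o ∈ oddWords m, 1 ≤ i ∧ i < n ∧ 1 ≤ j ∧ j < k ∧
    r = cm (cj fa (ft ^ i)) (cj fb (ft ^ j * o))} ∪
  {r | ∃ i j, ∃ o ∈ oddWords m, 1 ≤ i ∧ i < n ∧ 1 ≤ j ∧ j < n ∧
    r = cm (cj fa (ft ^ i)) (cj fa (ft ^ j * o))}

/-- The group `⟨a, b, t | relators⟩`. -/
abbrev FPGroup (w v : List Bool) (d : ℕ) (s : FreeGroup ℕ) : Type :=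
  PresentedGroup (relators w v d s)

/-- The element `a` of the presented group. -/
def pa (w v : List Bool) (d : ℕ) (s : FreeGroup ℕ) : FPGroup w v d s := PresentedGroup.of Gen.a
/-- The element `b` of the presented group. -/
def pb (w v : List Bool) (d : ℕ) (s : FreeGroup ℕ) : FPGroup w v d s := PresentedGroup.of Gen.b
/-- The element `t` of the presented group. -/
def pt (w v : List Bool) (d : ℕ) (s : FreeGroup ℕ) : FPGroup w v d s := PresentedGroup.of Gen.t

/-- The subgroup `⟨a, a^t, …, a^{t^{n-1}}, b, b^t, …, b^{t^{k-1}}⟩`. -/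
def H (w v : List Bool) (d : ℕ) (s : FreeGroup ℕ) : Subgroup (FPGroup w v d s) :=
  Subgroup.closure
    ({g | ∃ i < v.length, g = cj (pa w v d s) (pt w v d s ^ i)} ∪
      {g | ∃ j < w.length, g = cj (pb w v d s) (pt w v d s ^ j)})

end Kneading

/-! Write ⟨g₀,g₁⟩ for an element that fixes the first level. The endomorphism is φ(g) = ⟨g, ψ(g)⟩,
where ψ sends a_n to b_k, b_k to a_n^s and the other generators to 1. For each generator the twist u
arranges that this pair is the prescribed element of K(w,v), so φ exists as soon as ψ is a
homomorphism on K(w,v) (`exists_hom_dihedral`). By the choice of s, the group ⟨a_n^s, b_k⟩ is a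
quotient of the dihedral group of order 2^{m+1}. Hence it suffices that, in a word acting trivially
on the tree, a_n and b_k occur an even number of times and, if m = 2, the number of pairs of an a_n
and a later b_k is even. Both follow by counting letters in sections, since every generator is a
section of exactly one generator at exactly one letter. Injectivity of φ is visible in the first
coordinate.

The HNN extension satisfies the relators (`rels_hnn`): if ψ(g) = 1, then φ(g) = ⟨g,1⟩ lives on one
half of the tree, and conjugation by a word with an odd number of b's moves such an element to the
other half.

The core is the converse, `Rels.ev_eq_one`: in any group that satisfies the relators, a word acting
trivially on the tree has value 1. The value of a word splits into a part in a normalized subgroup M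
(`baseGroup`) and a part in the dihedral group ⟨a_n^s, b_k⟩. The commutator relators say that M^t
and M^{tb} commute, so the value of a word can be rebuilt from its two sections
(`Rels.ev_eq_assemble`), and it is 1 if both sections have value 1. Sections are never longer than
the word. By induction on length, only words matter that keep their length along a path of n+k
letters. Such a word contains only letters a_i whose indices differ by periods of v, that is, by
multiples of n/d (`cyc_periodic_of_surv`, `dvd_of_cyc_periodic`). The remaining commutators make
their values commute, and even multiplicities finish the argument.

So K(w,v) maps to G by ι, and the universal properties of the presentation and of the HNN extension
give inverse isomorphisms. Injectivity of ι follows, because K(w,v) embeds in the HNN extension. -/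

namespace Kneading

/-! ### Words in the generators and their sections -/

/-- The generators: `b j` is `b_{j+1}` and `a i` is `a_{i+1}`. -/
inductive Letter : Type
  | b (j : ℕ)
  | a (i : ℕ)
  deriving DecidableEq

/-- The indices in the range that occurs in `K(w,v)`. -/
def Letter.Valid (w v : List Bool) : Letter → Prop
  | .b j => j < w.length
  | .a i => i < v.length

/-- Action of a generator on the tree. -/
def actL (w v : List Bool) : Letter → List Bool → List Bool
  | .b j => bAct w j
  | .a i => aAct w v i

/-- Action of a word on the tree, the first letter acting first. -/
def actW (w v : List Bool) : List Letter → List Bool → List Bool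
  | [], l => l
  | x :: W, l => actW w v W (actL w v x l)

/-- Whether a generator moves the first level. -/
def flips (x : Letter) : Bool := decide (x = .b 0)

/-- The section of a generator at a letter, as a word of length at most one. -/
def secL (w v : List Bool) (c : Bool) : Letter → List Letter
  | .b 0 => []
  | .b (j + 1) => if c = w.getD j false then [.b j] else []
  | .a 0 => if c = v.getD (v.length - 1) false then [.a (v.length - 1)] else [.b (w.length - 1)]
  | .a (i + 1) => if c = v.getD i false then [.a i] else []

/-- The section of a word at a letter. -/
def sec (w v : List Bool) : Bool → List Letter → List Letter
  | _, [] => []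
  | c, x :: W => secL w v c x ++ sec w v (xor c (flips x)) W

/-- The parity of the number of letters of a word that move the first level. -/
def par : List Letter → Bool
  | [] => false
  | x :: W => xor (flips x) (par W)

variable {w v : List Bool}

theorem actW_append (W V : List Letter) (l : List Bool) :
    actW w v (W ++ V) l = actW w v V (actW w v W l) := by
  induction W generalizing l with
  | nil => rfl
  | cons x W ih => simp [actW, ih]

theorem actL_cons (x : Letter) (c : Bool) (l : List Bool) :
    actL w v x (c :: l) = xor c (flips x) :: actW w v (secL w v c x) l := by
  rcases x with (_ | j) | (_ | i)
  · simp [actL, bAct, secL, actW, flips]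
  · simp only [actL, bAct, secL, flips]
    split_ifs <;> simp [actW, actL]
  · simp only [actL, aAct, secL, flips]
    split_ifs <;> simp [actW, actL]
  · simp only [actL, aAct, secL, flips]
    split_ifs <;> simp [actW, actL]

theorem actW_cons (W : List Letter) (c : Bool) (l : List Bool) :
    actW w v W (c :: l) = xor c (par W) :: actW w v (sec w v c W) l := by
  induction W generalizing c l with
  | nil => simp [actW, par, sec]
  | cons x W ih => simp [actW, par, sec, actL_cons, ih, actW_append]

/-- The words in valid generators that act trivially on the tree. -/
structure IsTriv (w v : List Bool) (W : List Letter) : Prop where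
  valid : ∀ x ∈ W, x.Valid w v
  act : ∀ l, actW w v W l = l

theorem valid_secL (hw : 0 < w.length) (hv : 0 < v.length) {x : Letter} (hx : x.Valid w v)
    (c : Bool) : ∀ z ∈ secL w v c x, z.Valid w v := by
  rcases x with (_ | j) | (_ | i)
  · simp [secL]
  · simp only [secL, Letter.Valid] at hx ⊢
    split_ifs <;> simp; omega
  · simp only [secL]
    split_ifs <;> simp [Letter.Valid] <;> omega
  · simp only [secL, Letter.Valid] at hx ⊢
    split_ifs <;> simp; omega

theorem valid_sec (hw : 0 < w.length) (hv : 0 < v.length) {W : List Letter}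
    (hW : ∀ x ∈ W, x.Valid w v) (c : Bool) : ∀ z ∈ sec w v c W, z.Valid w v := by
  induction W generalizing c with
  | nil => simp [sec]
  | cons x W ih =>
    simp only [List.mem_cons, forall_eq_or_imp] at hW
    intro z hz
    simp only [sec, List.mem_append] at hz
    rcases hz with hz | hz
    · exact valid_secL hw hv hW.1 c z hz
    · exact ih hW.2 _ z hz

theorem IsTriv.par_eq {W : List Letter} (h : IsTriv w v W) : par W = false := by
  have := h.act [false]
  rw [actW_cons] at this
  simpa using (List.cons.inj this).1

theorem IsTriv.sec {W : List Letter} (hw : 0 < w.length) (hv : 0 < v.length)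
    (h : IsTriv w v W) (c : Bool) : IsTriv w v (sec w v c W) := by
  refine ⟨valid_sec hw hv h.valid c, fun l => ?_⟩
  have := h.act (c :: l)
  rw [actW_cons] at this
  exact (List.cons.inj this).2

/-! ### Counting letters in sections -/

/-- The generator whose sections contain a given generator. -/
def parent (w v : List Bool) : Letter → Letter
  | .b j => if j + 1 < w.length then .b (j + 1) else .a 0
  | .a i => if i + 1 < v.length then .a (i + 1) else .a 0

/-- The letter at which `parent z` has section `z`. -/
def dig (w v : List Bool) : Letter → Bool
  | .b j => w.getD j false
  | .a i => v.getD i false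

/-- Number of occurrences of `x` that are preceded by `p` letters `b_1` modulo `2`. -/
def oc (x : Letter) : Bool → List Letter → ℕ
  | _, [] => 0
  | p, y :: W => (if y = x ∧ p = false then 1 else 0) + oc x (xor p (flips y)) W

/-- Number of pairs of an occurrence of `x` and a later occurrence of `y`. -/
def pc (x y : Letter) : List Letter → ℕ
  | [] => 0
  | z :: W => (if z = x then W.count y else 0) + pc x y W

/-- Each generator is a section of exactly one generator, at exactly one letter. That y_k and x_n
differ is what makes `dig` correct for b_k, the section of a_1 opposite to a_n. -/
theorem count_secL (hlast : w.getD (w.length - 1) false ≠ v.getD (v.length - 1) false)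
    {z y : Letter} (hz : z.Valid w v) (hy : y.Valid w v) (c : Bool) :
    (secL w v c y).count z = if y = parent w v z ∧ c = dig w v z then 1 else 0 := by
  have key : ∀ b₁ b₂ : Bool, b₁ ≠ b₂ → (c = b₁ ↔ ¬ c = b₂) := by cases c <;> decide
  by_cases h : y = parent w v z ∧ c = dig w v z
  · rw [if_pos h]
    obtain ⟨rfl, h⟩ := h
    rcases z with j | i <;> simp only [parent, dig, Letter.Valid] at hz h ⊢
    · by_cases hj : j + 1 < w.length
      · rw [if_pos hj, secL, if_pos h]; simp
      · obtain rfl : j = w.length - 1 := by omega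
        rw [if_neg hj, secL, if_neg ((key _ _ hlast).1 h)]; simp
    · by_cases hi : i + 1 < v.length
      · rw [if_pos hi, secL, if_pos h]; simp
      · obtain rfl : i = v.length - 1 := by omega
        rw [if_neg hi, secL, if_pos h]; simp
  · rw [if_neg h, List.count_eq_zero]
    intro hm
    apply h
    rcases y with (_ | j) | (_ | i) <;> simp only [secL, Letter.Valid] at hy hm
    · simp at hm
    · by_cases hc : c = w.getD j false
      · rw [if_pos hc, List.mem_singleton] at hm
        subst hm
        exact ⟨by simp [parent, hy], hc⟩
      · rw [if_neg hc] at hm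
        simp at hm
    · by_cases hc : c = v.getD (v.length - 1) false
      · rw [if_pos hc, List.mem_singleton] at hm
        subst hm
        exact ⟨by rw [parent, if_neg (by omega)], hc⟩
      · rw [if_neg hc, List.mem_singleton] at hm
        subst hm
        exact ⟨by rw [parent, if_neg (by omega)], (key _ _ hlast).2 hc⟩
    · by_cases hc : c = v.getD i false
      · rw [if_pos hc, List.mem_singleton] at hm
        subst hm
        exact ⟨by simp [parent, hy], hc⟩
      · rw [if_neg hc] at hm
        simp at hm

theorem count_sec (hlast : w.getD (w.length - 1) false ≠ v.getD (v.length - 1) false)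
    {z : Letter} (hz : z.Valid w v) {W : List Letter} (hW : ∀ x ∈ W, x.Valid w v) (c : Bool) :
    (sec w v c W).count z = oc (parent w v z) (xor c (dig w v z)) W := by
  induction W generalizing c with
  | nil => simp [sec, oc]
  | cons y W ih =>
    simp only [List.mem_cons, forall_eq_or_imp] at hW
    have h1 : xor (xor c (dig w v z)) (flips y) = xor (xor c (flips y)) (dig w v z) := by
      cases c <;> cases dig w v z <;> cases flips y <;> rfl
    have h2 : (xor c (dig w v z) = false) ↔ c = dig w v z := by
      cases c <;> cases dig w v z <;> simp
    simp only [sec, List.count_append, count_secL hlast hz hW.1, ih hW.2, oc, h1, h2]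

theorem oc_add_oc (x : Letter) (W : List Letter) :
    oc x false W + oc x true W = W.count x := by
  induction W with
  | nil => rfl
  | cons y W ih =>
    by_cases hy : y = x
    · subst hy
      cases hf : flips y <;> simp [oc, hf] <;> omega
    · cases hf : flips y <;> simp [oc, hf, hy] <;> omega

theorem count_sec_add_count_sec
    (hlast : w.getD (w.length - 1) false ≠ v.getD (v.length - 1) false)
    {z : Letter} (hz : z.Valid w v) {W : List Letter} (hW : ∀ x ∈ W, x.Valid w v) :
    (sec w v false W).count z + (sec w v true W).count z = W.count (parent w v z) := by
  rw [count_sec hlast hz hW, count_sec hlast hz hW, ← oc_add_oc]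
  cases dig w v z
  · rfl
  · exact Nat.add_comm _ _

theorem par_eq_decide (W : List Letter) : par W = decide (W.count (.b 0) % 2 = 1) := by
  induction W with
  | nil => rfl
  | cons x W ih =>
    by_cases hx : x = .b 0
    · subst hx
      simp only [par, flips, ih, List.count_cons_self]
      rcases Nat.mod_two_eq_zero_or_one (W.count (.b 0)) with h | h <;> simp [h, Nat.add_mod]
    · simp [par, flips, ih, hx, List.count_cons_of_ne]

section Trivial

variable (hw : 0 < w.length) (hv : 0 < v.length)
  (hlast : w.getD (w.length - 1) false ≠ v.getD (v.length - 1) false)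
include hw hv hlast

/-- Every generator occurs an even number of times in a trivial word. -/
theorem IsTriv.even_count {W : List Letter} (h : IsTriv w v W) {x : Letter} (hx : x.Valid w v) :
    Even (W.count x) := by
  -- Sections of trivial words are trivial, so evenness passes from a generator to its parent.
  -- Starting from b_1, where it is triviality on the first level, it climbs through b_2, …, b_k,
  -- a_1, …, a_n.
  have step : ∀ z : Letter, z.Valid w v → (∀ W, IsTriv w v W → Even (W.count z)) →
      ∀ W, IsTriv w v W → Even (W.count (parent w v z)) := fun z hz ih W hW => by
    rw [← count_sec_add_count_sec hlast hz hW.valid]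
    exact (ih _ (hW.sec hw hv _)).add (ih _ (hW.sec hw hv _))
  have hb : ∀ j, j < w.length → ∀ W, IsTriv w v W → Even (W.count (.b j)) := by
    intro j
    induction j with
    | zero =>
      intro _ W hW
      have := hW.par_eq
      rw [par_eq_decide] at this
      rw [Nat.even_iff]
      simpa using this
    | succ j ih =>
      intro hj W hW
      simpa [parent, hj] using step (.b j) (Nat.lt_of_succ_lt hj) (ih (Nat.lt_of_succ_lt hj)) W hW
  have ha : ∀ i, i < v.length → ∀ W, IsTriv w v W → Even (W.count (.a i)) := by
    intro i
    induction i with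
    | zero =>
      intro _ W hW
      have h1 : w.length - 1 < w.length := by omega
      have h2 : ¬ (w.length - 1 + 1 < w.length) := by omega
      simpa [parent, h2] using step (.b (w.length - 1)) h1 (hb _ h1) W hW
    | succ i ih =>
      intro hi W hW
      simpa [parent, hi] using step (.a i) (Nat.lt_of_succ_lt hi) (ih (Nat.lt_of_succ_lt hi)) W hW
  cases x with
  | b j => exact hb j hx W h
  | a i => exact ha i hx W h

/-- The two sections count the occurrences of the parent separately, according to the parity of the
preceding b_1's, and each section is itself a trivial word. -/
theorem IsTriv.even_oc {W : List Letter} (h : IsTriv w v W) {z : Letter} (hz : z.Valid w v)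
    (p : Bool) : Even (oc (parent w v z) p W) := by
  have : p = xor (xor p (dig w v z)) (dig w v z) := by cases p <;> cases dig w v z <;> rfl
  rw [this, ← count_sec hlast hz h.valid]
  exact (h.sec hw hv _).even_count hw hv hlast hz

end Trivial

/-- The product counts all pairs of an `x` and a b_1. The pairs with b_1 first are counted modulo 2
by `oc x true`, those with `x` first by `pc`. -/
theorem even_pc_add_oc {x : Letter} (hx : x ≠ .b 0) (W : List Letter) :
    Even (pc x (.b 0) W + oc x true W + W.count x * W.count (.b 0)) := by
  induction W with
  | nil => simp [pc, oc]
  | cons y W ih =>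
    have h := oc_add_oc x W
    by_cases hyx : y = x
    · subst hyx
      simp only [pc, oc, flips, hx, List.count_cons_self, List.count_cons_of_ne, ne_eq,
        not_false_eq_true, if_true, decide_false, Bool.xor_false]
      simp only [Nat.even_iff, Nat.add_mul] at ih ⊢
      simp
      omega
    · by_cases hy : y = .b 0
      · subst hy
        simp only [pc, oc, flips, hyx, List.count_cons_self, List.count_cons_of_ne, ne_eq,
          not_false_eq_true, if_false, decide_true, false_and, Bool.xor_true, Bool.not_true]
        rw [← h] at ih ⊢
        simp only [Nat.even_iff] at ih ⊢
        ring_nf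
        ring_nf at ih
        omega
      · simpa [pc, oc, flips, hyx, hy, List.count_cons_of_ne] using ih

theorem IsTriv.even_pc (hw : 0 < w.length) (hv : 0 < v.length)
    (hlast : w.getD (w.length - 1) false ≠ v.getD (v.length - 1) false)
    {W : List Letter} (h : IsTriv w v W) {z : Letter} (hz : z.Valid w v)
    (hz' : parent w v z ≠ .b 0) : Even (pc (parent w v z) (.b 0) W) := by
  have h1 := even_pc_add_oc hz' W
  have h2 := h.even_oc hw hv hlast hz true
  have h3 : Even (W.count (.b 0)) := h.even_count hw hv hlast (x := .b 0) hw
  have h4 := h3.mul_left (W.count (parent w v z))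
  rw [Nat.even_iff] at *
  omega

/-- The pairs of `a_1` and a later `b_2` if `(k,n) = (2,1)`. -/
theorem pc_eq_sum_sec (hlast : w.getD (w.length - 1) false ≠ v.getD (v.length - 1) false)
    (hk : w.length = 2) (hn : v.length = 1) {W : List Letter} (hW : ∀ x ∈ W, x.Valid w v) :
    pc (.a 0) (.b 1) W =
      (pc (.a 0) (.b 0) (sec w v false W) + pc (.b 1) (.b 0) (sec w v false W)) +
      (pc (.a 0) (.b 0) (sec w v true W) + pc (.b 1) (.b 0) (sec w v true W)) := by
  -- A b_2 shows as b_1 in exactly one of the two sections, and there every earlier a_1 shows as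
  -- either a_1 or b_2. So each pair reappears exactly once.
  induction W with
  | nil => simp [sec, pc]
  | cons y W ih =>
    simp only [List.mem_cons, forall_eq_or_imp] at hW
    have hc := count_sec_add_count_sec hlast (z := .b 0) (show 0 < w.length by omega) hW.2
    have ih := ih hW.2
    simp only [parent, hk, show 0 + 1 < 2 by omega, if_true] at hc
    rcases y with (_ | _ | j) | (_ | i)
    · simp only [sec, secL, pc, flips, List.nil_append]
      simp at hc ih ⊢
      omega
    · cases hd : w.getD 0 false <;> simp only [sec, secL, pc, flips, hd] <;>
        simp [pc] at hc ih ⊢ <;> omega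
    · have := hW.1
      simp only [Letter.Valid] at this
      omega
    · cases hd : v.getD 0 false <;> simp only [sec, secL, pc, flips, hk, hn, hd] <;>
        simp [pc] at hc ih ⊢ <;> omega
    · have := hW.1
      simp only [Letter.Valid] at this
      omega


/-! ### Homomorphisms from `K(w,v)` -/

/-- A generator as a tree automorphism. -/
def treeL (w v : List Bool) : Letter → TreeAut
  | .b j => treeB w j
  | .a i => treeA w v i

theorem TreeAut.ext {g h : TreeAut} (H : ∀ l, g.unop l = h.unop l) : g = h :=
  MulOpposite.unop_injective (RelIso.ext H)

theorem unop_mul_apply (g h : TreeAut) (l : List Bool) :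
    (g * h).unop l = h.unop (g.unop l) := rfl

theorem treeL_apply (x : Letter) (l : List Bool) : (treeL w v x).unop l = actL w v x l := by
  cases x <;> rfl

theorem treeL_mul_self (x : Letter) : treeL w v x * treeL w v x = 1 := by
  refine TreeAut.ext fun l => ?_
  rw [unop_mul_apply]
  cases x
  · exact bAct_bAct w l _
  · exact aAct_aAct w v l _

theorem prod_treeL_apply (W : List Letter) (l : List Bool) :
    (W.map (treeL w v)).prod.unop l = actW w v W l := by
  induction W generalizing l with
  | nil => rfl
  | cons x W ih => rw [List.map_cons, List.prod_cons, unop_mul_apply, ih, treeL_apply, actW]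

theorem treeL_mem {x : Letter} (hx : x.Valid w v) : treeL w v x ∈ K w v := by
  cases x with
  | b j => exact (genB w v j hx).2
  | a i => exact (genA w v i hx).2

/-- A generator as an element of `K(w,v)`. -/
def genK {x : Letter} (hx : x.Valid w v) : K w v := ⟨treeL w v x, treeL_mem hx⟩

theorem genK_mul_self {x : Letter} (hx : x.Valid w v) : genK hx * genK hx = 1 :=
  Subtype.ext (treeL_mul_self x)

theorem closure_genK :
    Subgroup.closure {g : K w v | ∃ x : Letter, ∃ hx : x.Valid w v, g = genK hx} = ⊤ := by
  rw [eq_top_iff]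
  refine le_trans (Subgroup.closure_closure_coe_preimage (k :=
    {g | ∃ j < w.length, g = treeB w j} ∪ {g | ∃ i < v.length, g = treeA w v i})).ge ?_
  refine Subgroup.closure_mono ?_
  rintro ⟨g, hg⟩ (⟨j, hj, h⟩ | ⟨i, hi, h⟩)
  · exact ⟨.b j, hj, Subtype.ext h⟩
  · exact ⟨.a i, hi, Subtype.ext h⟩

/-- Two homomorphisms from `K(w,v)` that agree on the generators are equal. -/
theorem hom_ext_genK {D : Type*} [Group D] {f g : K w v →* D}
    (h : ∀ x (hx : Letter.Valid w v x), f (genK hx) = g (genK hx)) : f = g :=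
  MonoidHom.eq_of_eqOn_dense closure_genK (by rintro _ ⟨x, hx, rfl⟩; exact h x hx)

theorem prod_map_reverse_of_involutive {D : Type*} [Group D] {f : Letter → D} {W : List Letter}
    (hf : ∀ x ∈ W, f x * f x = 1) : (W.reverse.map f).prod = ((W.map f).prod)⁻¹ := by
  induction W with
  | nil => simp
  | cons x W ih =>
    simp only [List.mem_cons, forall_eq_or_imp] at hf
    rw [List.reverse_cons, List.map_append, List.prod_append, ih hf.2, List.map_singleton,
      List.prod_singleton, List.map_cons, List.prod_cons, mul_inv_rev,
      inv_eq_of_mul_eq_one_left hf.1]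

theorem exists_word (g : K w v) :
    ∃ W : List Letter, (∀ x ∈ W, x.Valid w v) ∧ (W.map (treeL w v)).prod = g := by
  have hg : g ∈ Subgroup.closure {g : K w v | ∃ x : Letter, ∃ hx : x.Valid w v, g = genK hx} := by
    rw [closure_genK]; trivial
  induction hg using Subgroup.closure_induction with
  | mem g hg =>
    obtain ⟨x, hx, rfl⟩ := hg
    exact ⟨[x], by simpa using hx, by simp [genK]⟩
  | one => exact ⟨[], by simp, rfl⟩
  | mul g h _ _ hg hh =>
    obtain ⟨W, hW, hWg⟩ := hg
    obtain ⟨V, hV, hVh⟩ := hh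
    refine ⟨W ++ V, fun x hx => ?_, by simp [hWg, hVh]⟩
    rcases List.mem_append.1 hx with hx | hx
    exacts [hW x hx, hV x hx]
  | inv g _ hg =>
    obtain ⟨W, hW, hWg⟩ := hg
    refine ⟨W.reverse, fun x hx => hW x (by simpa using hx), ?_⟩
    rw [prod_map_reverse_of_involutive fun x _ => treeL_mul_self x, hWg]
    rfl

/-- A map from the generators to a group extends to `K(w,v)` if it sends trivial words to `1`. -/
theorem exists_hom {D : Type*} [Group D] (f : Letter → D)
    (hf : ∀ x, Letter.Valid w v x → f x * f x = 1)
    (h : ∀ W, IsTriv w v W → (W.map f).prod = 1) :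
    ∃ ψ : K w v →* D, ∀ x (hx : Letter.Valid w v x), ψ (genK hx) = f x := by
  choose word hword hprod using exists_word (w := w) (v := v)
  -- Well-definedness: the letters are involutions, so if W and V act alike, then W followed by V
  -- reversed is a trivial word.
  have key : ∀ W V : List Letter, (∀ x ∈ W, x.Valid w v) → (∀ x ∈ V, x.Valid w v) →
      (W.map (treeL w v)).prod = (V.map (treeL w v)).prod → (W.map f).prod = (V.map f).prod := by
    intro W V hW hV hWV
    have ht : IsTriv w v (W ++ V.reverse) := by
      refine ⟨fun x hx => ?_, fun l => ?_⟩
      · rcases List.mem_append.1 hx with hx | hx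
        exacts [hW x hx, hV x (by simpa using hx)]
      · rw [← prod_treeL_apply, List.map_append, List.prod_append,
          prod_map_reverse_of_involutive fun x _ => treeL_mul_self x, hWV, mul_inv_cancel]
        rfl
    have := h _ ht
    rwa [List.map_append, List.prod_append,
      prod_map_reverse_of_involutive fun x hx => hf x (hV x hx), mul_inv_eq_one] at this
  refine ⟨MonoidHom.mk' (fun g => ((word g).map f).prod) fun g g' => ?_, fun x hx => ?_⟩
  · rw [← List.prod_append, ← List.map_append]
    refine key _ _ (hword _) (fun x hx => ?_) ?_
    · rcases List.mem_append.1 hx with hx | hx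
      exacts [hword _ x hx, hword _ x hx]
    · simp [hprod]
  · have := key (word (genK hx)) [x] (hword _) (by simpa using hx) (by rw [hprod]; simp [genK])
    simpa using this

/-! ### Homomorphisms onto dihedral groups -/

/-- Here (AB)² is central in ⟨A,B⟩ with trivial square, and AB = BA(AB)². Moving every B to the left
costs one factor (AB)² for each A that stands before it. -/
theorem prod_eq_of_involutions {D : Type*} [Group D] {A B : D} (hA : A * A = 1) (hB : B * B = 1)
    (hAB : (A * B) ^ 4 = 1) {x y : Letter} (hxy : x ≠ y) (W : List Letter) :
    (W.map fun z => if z = x then A else if z = y then B else 1).prod =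
      B ^ W.count y * A ^ W.count x * ((A * B) ^ 2) ^ pc x y W := by
  have hA' : A⁻¹ = A := inv_eq_of_mul_eq_one_left hA
  have hB' : B⁻¹ = B := inv_eq_of_mul_eq_one_left hB
  set z := (A * B) ^ 2 with hz
  have hzz : z * z = 1 := by rw [hz, ← pow_add, hAB]
  have hz' : z⁻¹ = z := inv_eq_of_mul_eq_one_left hzz
  have hAz : Commute A z := by
    have : A * z * A⁻¹ = z := by
      nth_rw 2 [← hz']
      rw [hz, sq]
      simp only [mul_inv_rev, hA', hB']
      rw [← mul_assoc, ← mul_assoc, ← mul_assoc, hA, one_mul]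
      simp only [mul_assoc]
    exact mul_inv_eq_iff_eq_mul.1 this
  have hBA : A * B = B * A * z := by
    rw [hz, sq]
    calc A * B = B * (A * A) * B * (A * B) := by rw [hA, mul_one, hB, one_mul]
      _ = _ := by simp only [mul_assoc]
  have hBz : Commute B z := by
    have h1 : Commute (A * B) z := by rw [hz]; exact (Commute.refl _).pow_right 2
    have h2 := (hAz.inv_left).mul_left h1
    rwa [inv_mul_cancel_left] at h2
  have hpow : ∀ c : ℕ, A * B ^ c = B ^ c * A * z ^ c := by
    intro c
    induction c with
    | zero => simp
    | succ c ih =>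
      calc A * B ^ (c + 1) = (A * B ^ c) * B := by rw [pow_succ, mul_assoc]
        _ = B ^ c * A * (z ^ c * B) := by rw [ih, mul_assoc]
        _ = B ^ c * A * (B * z ^ c) := by rw [(hBz.pow_right c).eq]
        _ = B ^ c * (A * B) * z ^ c := by simp only [mul_assoc]
        _ = B ^ c * (B * A * z) * z ^ c := by rw [hBA]
        _ = B ^ (c + 1) * A * z ^ (c + 1) := by rw [pow_succ, pow_succ']; simp only [mul_assoc]
  induction W with
  | nil => simp [pc]
  | cons u W ih =>
    rw [List.map_cons, List.prod_cons, ih]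
    by_cases hux : u = x
    · subst hux
      rw [if_pos rfl, List.count_cons_self, List.count_cons_of_ne hxy, pc, if_pos rfl]
      calc A * (B ^ W.count y * A ^ W.count u * z ^ pc u y W)
          = (A * B ^ W.count y) * A ^ W.count u * z ^ pc u y W := by simp only [mul_assoc]
        _ = B ^ W.count y * A * (z ^ W.count y * A ^ W.count u) * z ^ pc u y W := by
            rw [hpow]; simp only [mul_assoc]
        _ = B ^ W.count y * A * (A ^ W.count u * z ^ W.count y) * z ^ pc u y W := by
            rw [((hAz.pow_left (W.count u)).pow_right (W.count y)).eq]
        _ = _ := by rw [pow_succ', pow_add]; simp only [mul_assoc]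
    · by_cases huy : u = y
      · subst huy
        rw [if_neg hux, if_pos rfl, List.count_cons_self, List.count_cons_of_ne hux, pc,
          if_neg hux, pow_succ', zero_add]
        simp only [mul_assoc]
      · rw [if_neg hux, if_neg huy, List.count_cons_of_ne hux, List.count_cons_of_ne huy, pc,
          if_neg hux, one_mul, zero_add]

section Dihedral

variable (hw : 0 < w.length) (hv : 0 < v.length)
  (hlast : w.getD (w.length - 1) false ≠ v.getD (v.length - 1) false)
  (hkn : ¬ (w.length = 1 ∧ v.length = 1))
include hw hv hlast hkn

/-- For k = 1 the letter b_k is b_1, and a_n is the parent of a_{n-1}, which exists because (k,n) ≠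
(1,1). For (k,n) = (2,1) the pairs are traced one level down. -/
theorem IsTriv.even_pc_last (hm : mExp w.length v.length = 2) {W : List Letter}
    (h : IsTriv w v W) : Even (pc (.a (v.length - 1)) (.b (w.length - 1)) W) := by
  by_cases hk : w.length = 1
  · have hz : (Letter.a (v.length - 2)).Valid w v := show v.length - 2 < v.length by omega
    have hp : parent w v (.a (v.length - 2)) = .a (v.length - 1) := by
      rw [parent, if_pos (by omega)]
      congr 1; omega
    have := h.even_pc hw hv hlast hz (by simp [hp])
    simpa [hp, hk] using this
  · have h21 : w.length = 2 ∧ v.length = 1 := by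
      by_contra hcon
      simp [mExp, hk, hcon] at hm
    have hpa : parent w v (.a 0) = .a 0 := by rw [parent, if_neg (by omega)]
    have hpb : parent w v (.b 0) = .b 1 := by rw [parent, if_pos (by omega)]
    have ha : ∀ V, IsTriv w v V → Even (pc (.a 0) (.b 0) V) := fun V hV => by
      simpa [hpa] using hV.even_pc hw hv hlast (z := .a 0) hv (by simp [hpa])
    have hb : ∀ V, IsTriv w v V → Even (pc (.b 1) (.b 0) V) := fun V hV => by
      simpa [hpb] using hV.even_pc hw hv hlast (z := .b 0) hw (by simp [hpb])
    have e : ∀ c, IsTriv w v (Kneading.sec w v c W) := h.sec hw hv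
    rw [h21.1, h21.2]
    refine Eq.subst (motive := Even) (pc_eq_sum_sec hlast h21.1 h21.2 h.valid).symm ?_
    exact ((ha _ (e _)).add (hb _ (e _))).add ((ha _ (e _)).add (hb _ (e _)))

/-- A trivial word becomes trivial if `a_n` and `b_k` are replaced by involutions that generate a
quotient of the dihedral group of order `2^{m+1}`, and the other generators by `1`. -/
theorem IsTriv.prod_eq_one {D : Type*} [Group D] {A B : D} (hA : A * A = 1) (hB : B * B = 1)
    (hAB : (A * B) ^ 2 ^ mExp w.length v.length = 1) {W : List Letter} (h : IsTriv w v W) :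
    (W.map fun z => if z = .a (v.length - 1) then A else
      if z = .b (w.length - 1) then B else 1).prod = 1 := by
  have hm : mExp w.length v.length = 1 ∨ mExp w.length v.length = 2 := by
    unfold mExp; split_ifs <;> simp
  have h4 : (A * B) ^ 4 = 1 := by
    rcases hm with hm | hm <;> rw [hm] at hAB
    · rw [show 4 = 2 ^ 1 * 2 by rfl, pow_mul, hAB, one_pow]
    · exact hAB
  have sqp : ∀ {g : D} {c : ℕ}, g * g = 1 → Even c → g ^ c = 1 := by
    rintro g c hg ⟨r, rfl⟩
    rw [← two_mul, pow_mul, sq, hg, one_pow]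
  rw [prod_eq_of_involutions hA hB h4 (by simp),
    sqp hA (h.even_count hw hv hlast (x := .a _) (show v.length - 1 < v.length by omega)),
    sqp hB (h.even_count hw hv hlast (x := .b _) (show w.length - 1 < w.length by omega)),
    one_mul, one_mul]
  rcases hm with hm | hm
  · rw [hm, pow_one] at hAB
    rw [hAB, one_pow]
  · exact sqp (by rw [← pow_add]; exact h4) (h.even_pc_last hw hv hlast hkn hm)

theorem exists_hom_dihedral {D : Type*} [Group D] {A B : D} (hA : A * A = 1) (hB : B * B = 1)
    (hAB : (A * B) ^ 2 ^ mExp w.length v.length = 1) :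
    ∃ ψ : K w v →* D, ∀ x (hx : Letter.Valid w v x), ψ (genK hx) =
      if x = .a (v.length - 1) then A else if x = .b (w.length - 1) then B else 1 := by
  refine exists_hom _ (fun x _ => ?_) fun W hW => hW.prod_eq_one hw hv hlast hkn hA hB hAB
  split_ifs <;> simp [hA, hB]

end Dihedral


/-! ### Conjugation and digit powers. -/

section Conj

variable {G : Type*} [Group G]

theorem cj_one_right (x : G) : cj x 1 = x := by simp [cj]

theorem cj_one_left (g : G) : cj 1 g = 1 := by simp [cj]

theorem cj_cj (x g h : G) : cj (cj x g) h = cj x (g * h) := by simp [cj, mul_assoc]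

theorem cj_mul (x y g : G) : cj (x * y) g = cj x g * cj y g := by simp [cj, mul_assoc]

theorem cj_inv (x g : G) : cj x⁻¹ g = (cj x g)⁻¹ := by simp [cj, mul_assoc]

theorem map_cj {H F : Type*} [Group H] [FunLike F G H] [MonoidHomClass F G H] (f : F) (x g : G) :
    f (cj x g) = cj (f x) (f g) := by simp [cj]

theorem map_dpow {H F : Type*} [Group H] [FunLike F G H] [MonoidHomClass F G H] (f : F) (g : G)
    (c : Bool) : f (dpow g c) = dpow (f g) c := by cases c <;> simp [dpow]

theorem cj_mul_self {x : G} (hx : x * x = 1) (g : G) : cj x g * cj x g = 1 := by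
  rw [← cj_mul, hx, cj_one_left]

theorem dpow_mul_self {g : G} (hg : g * g = 1) (c : Bool) : dpow g c * dpow g c = 1 := by
  cases c <;> simp [dpow, hg]

theorem dpow_inv {g : G} (hg : g * g = 1) (c : Bool) : (dpow g c)⁻¹ = dpow g c :=
  inv_eq_of_mul_eq_one_left (dpow_mul_self hg c)

end Conj

/-! ### Automorphisms that fix the first level -/

/-- `g` fixes the first level and acts as `p` on the subtree of `c` and as `q` on the other. -/
def IsAt (g : TreeAut) (c : Bool) (p q : TreeAut) : Prop :=
  ∀ l, g.unop (c :: l) = c :: p.unop l ∧ g.unop ((!c) :: l) = (!c) :: q.unop l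

theorem unop_nil (g : TreeAut) : g.unop [] = [] := by
  have h : g.unop [] <+: g.unop (g.unop.symm []) := g.unop.map_rel_iff.2 List.nil_prefix
  rwa [RelIso.apply_symm_apply, List.prefix_nil] at h

namespace IsAt

variable {g h p q p' q' : TreeAut} {c : Bool}

theorem one (c : Bool) : IsAt 1 c 1 1 := fun _ => ⟨rfl, rfl⟩

theorem mul (hg : IsAt g c p q) (hh : IsAt h c p' q') : IsAt (g * h) c (p * p') (q * q') :=
  fun l => by simp only [unop_mul_apply, (hg l).1, (hg l).2, (hh _).1, (hh _).2, and_self]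

theorem flip (hg : IsAt g c p q) : IsAt g (!c) q p :=
  fun l => ⟨(hg l).2, by rw [Bool.not_not]; exact (hg l).1⟩

theorem of_eq {c' : Bool} (hg : IsAt g c p q) (h : c = c') : IsAt g c' p q := h ▸ hg

theorem of_ne {c' : Bool} (hg : IsAt g c p q) (h : c ≠ c') : IsAt g c' q p :=
  hg.flip.of_eq (by revert h; cases c <;> cases c' <;> simp)

theorem eq (hg : IsAt g c p q) (hh : IsAt h c p q) : g = h := by
  refine TreeAut.ext fun l => ?_
  cases l with
  | nil => rw [unop_nil, unop_nil]
  | cons c' l =>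
    by_cases hc : c' = c
    · subst hc; rw [(hg l).1, (hh l).1]
    · obtain rfl : c' = !c := by revert hc; cases c <;> cases c' <;> simp
      rw [(hg l).2, (hh l).2]

theorem eq_one (hg : IsAt g c 1 1) : g = 1 := hg.eq (one c)

theorem left_eq_one (h : IsAt 1 c p q) : p = 1 := by
  refine TreeAut.ext fun l => ?_
  have := (h l).1
  exact (List.cons.inj this).2.symm

theorem inv (hg : IsAt g c p q) : IsAt g⁻¹ c p⁻¹ q⁻¹ := by
  have key : ∀ (f : TreeAut) (l l' : List Bool), f.unop l' = l → f⁻¹.unop l = l' := by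
    rintro f l l' rfl
    exact f.unop.symm_apply_apply l'
  intro l
  refine ⟨key _ _ _ ?_, key _ _ _ ?_⟩
  · rw [(hg _).1]; congr 1; exact p.unop.apply_symm_apply l
  · rw [(hg _).2]; congr 1; exact q.unop.apply_symm_apply l

theorem cj (hg : IsAt g c p q) (hh : IsAt h c p' q') :
    IsAt (cj g h) c (cj p p') (cj q q') := (hh.inv.mul hg).mul hh

theorem pow (hg : IsAt g c p q) (r : ℕ) : IsAt (g ^ r) c (p ^ r) (q ^ r) := by
  induction r with
  | zero => simpa using one c
  | succ r ih => simpa only [pow_succ] using ih.mul hg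

end IsAt

theorem treeB_zero_apply (w : List Bool) (c : Bool) (l : List Bool) :
    (treeB w 0).unop (c :: l) = (!c) :: l := rfl

theorem treeB_mul_self (w : List Bool) (j : ℕ) : treeB w j * treeB w j = 1 :=
  treeL_mul_self (w := w) (v := []) (.b j)

theorem treeA_mul_self (w v : List Bool) (i : ℕ) : treeA w v i * treeA w v i = 1 :=
  treeL_mul_self (.a i)

theorem treeB_inv (w : List Bool) (j : ℕ) : (treeB w j)⁻¹ = treeB w j :=
  inv_eq_of_mul_eq_one_left (treeB_mul_self w j)

theorem IsAt.cj_sigma {g p q : TreeAut} {c : Bool} (hg : IsAt g c p q) :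
    IsAt (Kneading.cj g (treeB w 0)) c q p := by
  intro l
  rw [Kneading.cj, treeB_inv]
  simp only [unop_mul_apply, treeB_zero_apply, (hg l).1, (hg l).2, Bool.not_not, and_self]

theorem IsAt.cj_dpow {g p q : TreeAut} {c : Bool} (hg : IsAt g c p q) (e : Bool) :
    IsAt (Kneading.cj g (dpow (treeB w 0) e)) (xor c e) p q := by
  cases e
  · simpa [dpow, cj_one_right] using hg
  · simpa [dpow] using hg.cj_sigma.flip

theorem isAt_treeB_succ (w : List Bool) (j : ℕ) :
    IsAt (treeB w (j + 1)) (w.getD j false) (treeB w j) 1 := by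
  intro l
  change bAct w (j + 1) _ = _ :: bAct w j l ∧ bAct w (j + 1) _ = _ :: l
  simp [bAct]

theorem isAt_treeA_succ (w v : List Bool) (i : ℕ) :
    IsAt (treeA w v (i + 1)) (v.getD i false) (treeA w v i) 1 := by
  intro l
  change aAct w v (i + 1) _ = _ :: aAct w v i l ∧ aAct w v (i + 1) _ = _ :: l
  simp [aAct]

theorem isAt_treeA_zero (w v : List Bool) :
    IsAt (treeA w v 0) (v.getD (v.length - 1) false) (treeA w v (v.length - 1))
      (treeB w (w.length - 1)) := by
  intro l
  change aAct w v 0 _ = _ :: aAct w v _ l ∧ aAct w v 0 _ = _ :: bAct w _ l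
  simp [aAct]

/-! ### Existence of twists -/

/-- The conjugation puts p on the side opposite to p', so that p meets q' and q meets p'. -/
theorem IsAt.cj_mul_pow {g h p q p' q' : TreeAut} {c c' : Bool} {r : ℕ} (hg : IsAt g c p q)
    (hh : IsAt h c' p' q') (hp : (p * q') ^ r = 1) (hq : (q * p') ^ r = 1) :
    (Kneading.cj g (dpow (treeB w 0) (c == c')) * h) ^ r = 1 := by
  have h1 := (((hg.cj_dpow (w := w) (c == c')).of_eq (c' := !c')
    (by cases c <;> cases c' <;> rfl)).mul hh.flip).pow r
  rw [hp, hq] at h1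
  exact h1.eq_one

/-- With σ = b_1, the square (gσ)² equals g·g^σ, which has the involution q in both coordinates. -/
theorem IsAt.mul_sigma_pow_four {g q : TreeAut} {c : Bool} (hg : IsAt g c q 1) (hq : q * q = 1) :
    (g * treeB w 0) ^ 4 = 1 := by
  have h2 := (hg.mul (hg.cj_sigma (w := w))).pow 2
  rw [mul_one, one_mul, sq q, hq] at h2
  have e : g * treeB w 0 * (g * treeB w 0) = g * Kneading.cj g (treeB w 0) := by
    rw [Kneading.cj, treeB_inv]; simp only [mul_assoc]
  rw [show 4 = 2 * 2 by rfl, pow_mul, sq (g * treeB w 0), e, h2.eq_one]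

theorem evalTree_dpow_of (j : ℕ) (e : Bool) :
    evalTree w (dpow (FreeGroup.of j) e) = dpow (treeB w j) e := by
  rw [map_dpow]; congr 1

/-- The twist separates supports. For k = 1 none is needed. For k, n ≥ 2 both a_n and b_k have a
single non-trivial coordinate, and b_1 moves these apart. For n = 1 the second coordinate b_k of a_1
has to face the coordinate b_{k-1} of b_k. If k = 2, then (b_2b_1)⁴ = 1 suffices. If k ≥ 3, these
two must commute, and b_2 serves to conjugate by b_1 one level down. -/
theorem exists_isTwist (hw : 0 < w.length) (hv : 0 < v.length)
    (hkn : ¬ (w.length = 1 ∧ v.length = 1)) : ∃ s : FreeGroup ℕ, IsTwist w v s := by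
  have hA := treeA_mul_self w v
  have hB := treeB_mul_self w
  have dmem : ∀ {S : Set ℕ} {j : ℕ} (e : Bool), j ∈ S →
      dpow (FreeGroup.of j) e ∈ Subgroup.closure (FreeGroup.of '' S) := by
    intro S j e hj
    cases e
    · exact one_mem _
    · exact Subgroup.subset_closure ⟨j, hj, rfl⟩
  by_cases hk : w.length = 1
  · refine ⟨1, one_mem _, ?_⟩
    have hm : mExp w.length v.length = 2 := by simp [mExp, hk]
    rw [hm, map_one, cj_one_right, hk]
    obtain ⟨i, hi⟩ : ∃ i, v.length - 1 = i + 1 := ⟨v.length - 2, by omega⟩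
    rw [hi, Nat.sub_self]
    exact (isAt_treeA_succ w v i).mul_sigma_pow_four (hA i)
  obtain ⟨j, hj⟩ : ∃ j, w.length - 1 = j + 1 := ⟨w.length - 2, by omega⟩
  by_cases hn : v.length = 1
  · by_cases hk2 : w.length = 2
    · have hm : mExp w.length v.length = 2 := by simp [mExp, hk2, hn]
      obtain rfl : j = 0 := by omega
      have hbb : (treeB w 1 * treeB w 0) ^ 4 = 1 :=
        (isAt_treeB_succ w 0).mul_sigma_pow_four (hB 0)
      refine ⟨dpow (FreeGroup.of 0) (v.getD (1 - 1) false == w.getD 0 false),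
        dmem _ (by simp [twistGens, hk2]), ?_⟩
      rw [evalTree_dpow_of, hm, hj, hn]
      have h0 := isAt_treeA_zero w v
      rw [hj, hn] at h0
      refine h0.cj_mul_pow (isAt_treeB_succ w 0) ?_ hbb
      rw [mul_one, pow_succ 2 1, pow_mul, pow_one, sq (treeA _ _ _), hA, one_pow]
    · have hm : mExp w.length v.length = 1 := by simp [mExp, hk, hk2]
      have hk3 : 3 ≤ w.length := by omega
      obtain ⟨r, rfl⟩ : ∃ r, j = r + 1 := ⟨j - 1, by omega⟩
      have hS : twistGens w.length v.length = {0, 1} := by simp [twistGens, hk, hk3, hn]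
      have h0 := isAt_treeA_zero w v
      rw [hj, hn] at h0
      set x := v.getD (1 - 1) false
      set y := w.getD (r + 1) false with hy
      set e := y == w.getD r false with he
      -- The first factor brings the coordinate b_k of a_1 to the side y = y_{k-1}, where b_k has
      -- the coordinate b_{k-1}. The second factor has coordinate σ^e on that side, and e is chosen
      -- so that the supports of b_k conjugated by σ^e and of b_{k-1} are disjoint.
      refine ⟨dpow (FreeGroup.of 0) (x == y) *
        dpow (cj (FreeGroup.of 1) (dpow (FreeGroup.of 0) (xor (w.getD 0 false) y))) e, ?_, ?_⟩
      · rw [hS]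
        have h01 : ∀ c, dpow (FreeGroup.of 0) c ∈
            Subgroup.closure (FreeGroup.of '' ({0, 1} : Set ℕ)) := fun c => dmem c (by simp)
        refine mul_mem (h01 _) ?_
        cases e
        · exact one_mem _
        · exact mul_mem (mul_mem (inv_mem (h01 _))
            (Subgroup.subset_closure ⟨1, by simp, rfl⟩)) (h01 _)
      · have ev : evalTree w (FreeGroup.of 1) = treeB w 1 := FreeGroup.lift_apply_of
        have hr : IsAt (dpow (cj (treeB w 1) (dpow (treeB w 0) (xor (w.getD 0 false) y))) e) y
            (dpow (treeB w 0) e) 1 := by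
          cases e
          · exact IsAt.one _
          · refine ((isAt_treeB_succ w 0).cj_dpow _).of_eq ?_
            cases w.getD 0 false <;> cases y <;> rfl
        rw [map_mul, evalTree_dpow_of, map_dpow, map_cj, evalTree_dpow_of, ev, hm, hj, hn,
          ← cj_cj, pow_one]
        have h1 := ((((h0.cj_dpow (w := w) (x == y)).of_eq (c' := !y)
          (by cases x <;> cases y <;> rfl)).flip.of_eq (Bool.not_not y)).cj hr).mul
            (isAt_treeB_succ w (r + 1))
        have h2 := (isAt_treeB_succ w (r + 1)).cj_mul_pow (w := w) (r := 2)
          (isAt_treeB_succ w r) (by rw [mul_one, sq, hB]) (by rw [one_mul, sq, hB])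
        have h3 := h1.pow 2
        rw [h2, cj_one_right, mul_one, sq (treeA _ _ _), hA] at h3
        exact h3.eq_one
  · have hm : mExp w.length v.length = 1 := by simp [mExp, hk, hn]
    obtain ⟨i, hi⟩ : ∃ i, v.length - 1 = i + 1 := ⟨v.length - 2, by omega⟩
    refine ⟨dpow (FreeGroup.of 0) (v.getD i false == w.getD j false),
      dmem _ (by simp [twistGens, hk, hn]), ?_⟩
    rw [evalTree_dpow_of, hm, hi, hj, pow_one]
    exact (isAt_treeA_succ w v i).cj_mul_pow (isAt_treeB_succ w j)
      (by rw [mul_one, sq, hA]) (by rw [one_mul, sq, hB])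

/-! ### The endomorphism -/

/-- `b_{j+1}` as an element of `K(w,v)`, and `1` if `j` is out of range. -/
def bK (w v : List Bool) (j : ℕ) : K w v := if h : j < w.length then genB w v j h else 1

theorem bK_of_lt {j : ℕ} (hj : j < w.length) : bK w v j = genB w v j hj := dif_pos hj

/-- The image of `b_{j+1}` under the endomorphism if `j + 1 < k`. -/
def bShift (w v : List Bool) (j : ℕ) : K w v :=
  cj (bK w v (j + 1)) (dpow (bK w v 0) (w.getD j false))

theorem twistGens_lt {k n j : ℕ} (hk : 0 < k) (hj : j ∈ twistGens k n) : j + 1 < k := by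
  unfold twistGens at hj
  split_ifs at hj with h1 h2
  · exact hj.elim
  · rcases hj with rfl | hj
    · omega
    · rw [Set.mem_singleton_iff] at hj; omega
  · rw [Set.mem_singleton_iff] at hj; omega

/-- Two homomorphisms that agree on the permitted generators agree on a twist. -/
theorem eq_on_twist {D : Type*} [Group D] {f g : FreeGroup ℕ →* D} {S : Set ℕ}
    (h : ∀ j ∈ S, f (FreeGroup.of j) = g (FreeGroup.of j)) {s : FreeGroup ℕ}
    (hs : s ∈ Subgroup.closure (FreeGroup.of '' S)) : f s = g s := by
  have : Set.EqOn f g (Subgroup.closure (FreeGroup.of '' S)) :=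
    MonoidHom.eqOn_closure (by rintro _ ⟨j, hj, rfl⟩; exact h j hj)
  exact this hs

theorem coe_cj (x g : K w v) : ((cj x g : K w v) : TreeAut) = cj (x : TreeAut) g := rfl

theorem coe_dpow (x : K w v) (c : Bool) :
    ((dpow x c : K w v) : TreeAut) = dpow (x : TreeAut) c := by
  cases c <;> rfl

theorem isAt_bShift {j : ℕ} (hj : j + 1 < w.length) :
    IsAt (bShift w v j) false (treeB w j) 1 := by
  rw [bShift, bK_of_lt hj, bK_of_lt (by omega), coe_cj, coe_dpow]
  refine ((isAt_treeB_succ w j).cj_dpow _).of_eq ?_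
  simp

theorem isAt_lift_bShift (hw : 0 < w.length) {s : FreeGroup ℕ}
    (hs : s ∈ Subgroup.closure (FreeGroup.of '' twistGens w.length v.length)) :
    IsAt (FreeGroup.lift (bShift w v) s : K w v) false (evalTree w s) 1 := by
  induction hs using Subgroup.closure_induction with
  | mem x hx =>
    obtain ⟨j, hj, rfl⟩ := hx
    rw [evalTree, FreeGroup.lift_apply_of, FreeGroup.lift_apply_of]
    exact isAt_bShift (twistGens_lt hw hj)
  | one => simpa using IsAt.one false
  | mul x y _ _ hx hy => simpa only [map_mul, one_mul, Subgroup.coe_mul] using hx.mul hy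
  | inv x _ hx => simpa only [map_inv, inv_one, Subgroup.coe_inv] using hx.inv

theorem coe_lift_bK (hw : 0 < w.length) {s : FreeGroup ℕ}
    (hs : s ∈ Subgroup.closure (FreeGroup.of '' twistGens w.length v.length)) :
    ((FreeGroup.lift (bK w v) s : K w v) : TreeAut) = evalTree w s := by
  refine eq_on_twist (f := (K w v).subtype.comp (FreeGroup.lift (bK w v))) (fun j hj => ?_) hs
  have := twistGens_lt hw hj
  simp only [MonoidHom.comp_apply, FreeGroup.lift_apply_of, evalTree]
  rw [bK_of_lt (by omega)]
  rfl

/-- Each prescribed image has as coordinates the generator and its value under ψ. Hence a trivial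
word is sent to an element with both coordinates trivial, that is, to 1. -/
theorem exists_shift (hw : 0 < w.length) (hv : 0 < v.length)
    (hlast : w.getD (w.length - 1) false ≠ v.getD (v.length - 1) false)
    (hkn : ¬ (w.length = 1 ∧ v.length = 1)) {s : FreeGroup ℕ} (hs : IsTwist w v s) :
    ∃ (φ : K w v →* K w v) (ψ : K w v →* TreeAut),
      IsShift w v hw hv (FreeGroup.lift (bK w v) s) φ ∧
      (∀ g, IsAt (φ g) false g (ψ g)) ∧
      ∀ x (hx : Letter.Valid w v x), ψ (genK hx) =
        if x = .a (v.length - 1) then treeB w (w.length - 1) else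
        if x = .b (w.length - 1) then cj (treeA w v (v.length - 1)) (evalTree w s) else 1 := by
  have hA := cj_mul_self (treeA_mul_self w v (v.length - 1)) (evalTree w s)
  have hB := treeB_mul_self w (w.length - 1)
  set y := w.getD (w.length - 1) false with hy
  set S : K w v := FreeGroup.lift (bShift w v) s with hS
  set b := genB w v 0 hw with hb
  set u : K w v := cj S (dpow b (!y)) with hu
  have hbb : b * b = 1 := genK_mul_self (x := .b 0) hw
  have hBA : (treeB w (w.length - 1) * cj (treeA w v (v.length - 1)) (evalTree w s)) ^
      2 ^ mExp w.length v.length = 1 := by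
    have h1 := hs.2
    rw [← inv_inj, ← inv_pow, mul_inv_rev, inv_eq_of_mul_eq_one_left hA,
      inv_eq_of_mul_eq_one_left hB, inv_one] at h1
    exact h1
  set ψf : Letter → TreeAut := fun x => if x = .a (v.length - 1) then treeB w (w.length - 1) else
        if x = .b (w.length - 1) then cj (treeA w v (v.length - 1)) (evalTree w s) else 1 with hψf
  obtain ⟨ψ, hψ⟩ := exists_hom_dihedral hw hv hlast hkn hB hA hBA
  let aK : ℕ → K w v := fun i => if h : i < v.length then genA w v i h else 1
  have haK : ∀ {i} (h : i < v.length), aK i = genA w v i h := fun h => dif_pos h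
  let f : Letter → K w v := fun x => match x with
    | .b j => if j + 1 < w.length then bShift w v j else cj (aK 0) (u * dpow b y)
    | .a i => if i + 1 < v.length then cj (aK (i + 1)) (dpow b (v.getD i false))
        else cj (aK 0) (dpow b (v.getD i false))
  have hfat : ∀ x, Letter.Valid w v x → IsAt (f x) false (treeL w v x) (ψf x) := by
    rintro (j | i) hx
    · simp only [f]
      split_ifs with h
      · have h1 : ψf (.b j) = 1 := by
          have : j ≠ w.length - 1 := by omega
          simp [hψf, this]
        rw [h1]
        exact isAt_bShift h
      · obtain rfl : j = w.length - 1 := by simp only [Letter.Valid] at hx; omega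
        have h1 : ψf (.b (w.length - 1)) = cj (treeA w v (v.length - 1)) (evalTree w s) := by
          simp [hψf]
        have h2 : dpow b (!y) * dpow b y = b := by cases y <;> simp [dpow]
        -- Moving b_1^{y_k} to the front turns u into ⟨1,s⟩, so the twist affects only the
        -- coordinate a_n, and the result is ⟨b_k, a_n^s⟩.
        have h3 : cj (aK 0) (u * dpow b y) = cj (cj (aK 0) (dpow b y)) (cj S b) := by
          have h4 : u * dpow b y = dpow b y * cj u (dpow b y) := by simp [cj, mul_assoc]
          rw [h4, hu, cj_cj S, h2, cj_cj]
        rw [h1, h3, haK hv, coe_cj, coe_cj, coe_cj, coe_dpow]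
        have h5 := ((isAt_treeA_zero w v).cj_dpow (w := w) y).of_ne (c' := false) (by
          revert hlast; cases y <;> cases v.getD (v.length - 1) false <;> simp)
        have h6 := h5.cj ((isAt_lift_bShift hw hs.1).cj_sigma (w := w))
        rwa [cj_one_right] at h6
    · simp only [f]
      split_ifs with h
      · have h1 : ψf (.a i) = 1 := by
          have : i ≠ v.length - 1 := by omega
          simp [hψf, this]
        rw [h1, haK h, coe_cj, coe_dpow]
        exact ((isAt_treeA_succ w v i).cj_dpow _).of_eq (by simp)
      · obtain rfl : i = v.length - 1 := by simp only [Letter.Valid] at hx; omega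
        have h1 : ψf (.a (v.length - 1)) = treeB w (w.length - 1) := by simp [hψf]
        rw [h1, haK hv, coe_cj, coe_dpow]
        exact ((isAt_treeA_zero w v).cj_dpow _).of_eq (by simp)
  have hbK : ∀ j, bK w v j * bK w v j = 1 := fun j => by
    unfold bK; split_ifs with h
    · exact genK_mul_self (x := .b j) h
    · simp
  have haK' : ∀ i, aK i * aK i = 1 := fun i => by
    simp only [aK]; split_ifs with h
    · exact genK_mul_self (x := .a i) h
    · simp
  obtain ⟨φ, hφ⟩ := exists_hom (w := w) (v := v) f (by
    rintro (j | i) _ <;> simp only [f] <;> split_ifs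
    · exact cj_mul_self (hbK _) _
    · exact cj_mul_self (haK' _) _
    · exact cj_mul_self (haK' _) _
    · exact cj_mul_self (haK' _) _) (fun W hW => by
    have h1 : ∀ V : List Letter, (∀ x ∈ V, x.Valid w v) → IsAt ((V.map f).prod : K w v) false
        (V.map (treeL w v)).prod (V.map ψf).prod := by
      intro V
      induction V with
      | nil => exact fun _ => IsAt.one _
      | cons x V ih =>
        intro hV
        simp only [List.mem_cons, forall_eq_or_imp] at hV
        simpa using (hfat x hV.1).mul (ih hV.2)
    have h2 := h1 W hW.valid
    rw [hW.prod_eq_one hw hv hlast hkn hB hA hBA, TreeAut.ext (h := 1) (fun l =>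
      (prod_treeL_apply W l).trans (hW.act l))] at h2
    exact Subtype.ext h2.eq_one)
  -- There is no circularity: s involves only b_j with j < k, whose images do not mention u.
  have hφS : φ (FreeGroup.lift (bK w v) s) = S := by
    refine eq_on_twist (f := φ.comp (FreeGroup.lift (bK w v))) (fun j hj => ?_) hs.1
    have hj := twistGens_lt hw hj
    simp only [MonoidHom.comp_apply, FreeGroup.lift_apply_of]
    rw [bK_of_lt (by omega)]
    exact (hφ (.b j) (show j < w.length by omega)).trans (if_pos hj)
  refine ⟨φ, ψ, ⟨fun j hj => ?_, ?_, fun i hi => ?_, ?_⟩, fun g => ?_, hψ⟩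
  · refine (hφ (.b j) (show j < w.length by omega)).trans ((if_pos hj).trans ?_)
    rw [bShift, bK_of_lt hj, bK_of_lt hw]
  · refine (hφ (.b (w.length - 1)) (show w.length - 1 < w.length by omega)).trans
      ((if_neg (by omega)).trans ?_)
    rw [haK hv, uElt, hφS]
  · refine (hφ (.a i) (show i < v.length by omega)).trans ((if_pos hi).trans ?_)
    rw [haK hi]
  · refine (hφ (.a (v.length - 1)) (show v.length - 1 < v.length by omega)).trans
      ((if_neg (by omega)).trans ?_)
    rw [haK hv]
  · have hg : g ∈ Subgroup.closure {g : K w v | ∃ x : Letter, ∃ hx : x.Valid w v, g = genK hx} := by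
      rw [closure_genK]; trivial
    induction hg using Subgroup.closure_induction with
    | mem g hg =>
      obtain ⟨x, hx, rfl⟩ := hg
      rw [hφ, hψ]
      exact hfat x hx
    | one => simpa using IsAt.one false
    | mul g h _ _ hg hh => simpa using hg.mul hh
    | inv g _ hg => simpa using hg.inv


/-! ### The relations -/

section Chain

variable {Γ : Type*} [Group Γ]

theorem cj_left_injective (g : Γ) : Function.Injective fun x : Γ => cj x g := by
  intro x y h
  simpa [cj] using h

theorem cj_eq_iff {x y g : Γ} : cj x g = y ↔ x = cj y g⁻¹ := by
  constructor
  · rintro rfl; simp [cj, mul_assoc]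
  · rintro rfl; simp [cj, mul_assoc]

theorem cm_eq_one_iff {x y : Γ} : cm x y = 1 ↔ Commute x y := by
  rw [cm, mul_assoc, ← mul_inv_rev, inv_mul_eq_one]
  exact ⟨fun h => h.symm, fun h => h.symm⟩

theorem commute_cj {x y g : Γ} : Commute (cj x g) (cj y g) ↔ Commute x y := by
  rw [commute_iff_eq, commute_iff_eq, ← cj_mul, ← cj_mul]
  exact (cj_left_injective g).eq_iff

/-- `g_0 = g` and `g_{j+1} = (g_j^t)^{b^{l_j}}`, where `l_j` is the `j`-th letter of `l`. -/
def chain (l : List Bool) (b t g : Γ) : ℕ → Γ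
  | 0 => g
  | j + 1 => cj (cj (chain l b t g j) t) (dpow b (l.getD j false))

theorem map_chain {Δ : Type*} [Group Δ] (f : Γ →* Δ) (l : List Bool) (b t g : Γ) (j : ℕ) :
    f (chain l b t g j) = chain l (f b) (f t) (f g) j := by
  induction j with
  | zero => rfl
  | succ j ih => rw [chain, chain, map_cj, map_cj, map_dpow, ih]

theorem map_polyPow {Δ : Type*} [Group Δ] (f : Γ →* Δ) (b t : Γ) (l : List Bool) :
    f (polyPow b t l) = polyPow (f b) (f t) l := by
  induction l with
  | nil => simp [polyPow]
  | cons c l ih => rw [polyPow, polyPow, map_mul, map_dpow, map_cj, ih]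

theorem reverse_take_succ (l : List Bool) {j : ℕ} (hj : j < l.length) :
    (l.take (j + 1)).reverse = l.getD j false :: (l.take j).reverse := by
  rw [List.take_succ_eq_append_getElem hj, List.reverse_append, List.getD_eq_getElem _ _ hj]
  rfl

theorem chain_mul_self {l : List Bool} {b t g : Γ} (hg : g * g = 1) (j : ℕ) :
    chain l b t g j * chain l b t g j = 1 := by
  induction j with
  | zero => exact hg
  | succ j ih => exact cj_mul_self (cj_mul_self ih t) _

/-- Conjugation by a power of `t` on the initial term of a chain. -/
theorem cj_pow_eq_chain {b : Γ} (hb : b * b = 1) (t g : Γ) {l : List Bool} {j : ℕ}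
    (hj : j ≤ l.length) :
    cj g (t ^ j) = cj (chain l b t g j) (polyPow b t (l.take j).reverse) := by
  induction j with
  | zero => simp [chain, polyPow]
  | succ j ih =>
    rw [reverse_take_succ l hj, polyPow, pow_succ, ← cj_cj, ih (by omega), chain, cj_cj, cj_cj,
      cj_cj, ← mul_assoc (dpow _ _), dpow_mul_self hb, one_mul]
    congr 1
    simp [cj, mul_assoc]

/-- After telescoping along the chain a single step is left. This turns the relators in t^k and t^n
into relations on the last term of a chain. The list is reversed because the last letter is the
constant coefficient. -/
theorem cj_pow_length_eq_iff {b : Γ} (hb : b * b = 1) (t g h : Γ) {l : List Bool}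
    (hl : 0 < l.length) : cj g (t ^ l.length) = cj h (polyPow b t l.reverse) ↔
      cj (chain l b t g (l.length - 1)) t = cj h (dpow b (l.getD (l.length - 1) false)) := by
  have h1 : l.length - 1 + 1 = l.length := by omega
  have h2 := reverse_take_succ l (j := l.length - 1) (by omega)
  rw [h1, List.take_length] at h2
  rw [h2, polyPow]
  set P := polyPow b t (l.take (l.length - 1)).reverse
  have h3 : cj g (t ^ l.length) = cj (cj (chain l b t g (l.length - 1)) t) (cj P t) := by
    conv_lhs => rw [← h1, pow_succ, ← cj_cj, cj_pow_eq_chain hb t g (l := l) (by omega)]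
    simp [cj, mul_assoc, P]
  rw [h3, ← cj_cj]
  exact (cj_left_injective _).eq_iff

end Chain

/-- The value of a generator of the free group on `a`, `b`, `t`. -/
def genVal {Γ : Type*} (a b t : Γ) : Gen → Γ
  | .a => a
  | .b => b
  | .t => t

section Rels

variable {Γ : Type*} [Group Γ]

/-- The value of the twist. -/
def sVal (w : List Bool) (s : FreeGroup ℕ) (b t : Γ) : Γ := FreeGroup.lift (chain w b t b) s

/-- The value of `u`. -/
def uVal (w : List Bool) (s : FreeGroup ℕ) (b t : Γ) : Γ :=
  cj (cj (sVal w s b t) t) (dpow b (!(w.getD (w.length - 1) false)))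

/-- The value of `a_{i+1}`. -/
def aVal (w v : List Bool) (s : FreeGroup ℕ) (a b t : Γ) (i : ℕ) : Γ :=
  chain v b t (cj a (uVal w s b t)⁻¹) i

/-- The elements of `⟨a, b⟩` with an odd number of `b`'s. -/
def oddSet (m : ℕ) (a b : Γ) : Set Γ :=
  {o | ∃ ε ≤ 1, ∃ l ≤ 2 ^ m, o = a ^ ε * b * (a * b) ^ (2 * l)}

/-- The elements `a`, `b`, `t` satisfy the defining relations, stated by means of the values
of the generators of `K(w,v)`. -/
structure Rels (w v : List Bool) (d : ℕ) (s : FreeGroup ℕ) (a b t : Γ) : Prop where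
  a_sq : a * a = 1
  b_sq : b * b = 1
  ab_pow : (a * b) ^ 2 ^ (mExp w.length v.length + 1) = 1
  b_last : cj (chain w b t b (w.length - 1)) t = cj a (dpow b (w.getD (w.length - 1) false))
  a_last : cj (aVal w v s a b t (v.length - 1)) t =
    cj (aVal w v s a b t 0) (dpow b (v.getD (v.length - 1) false))
  comm : ∀ j, 1 ≤ j → j < d →
    Commute (aVal w v s a b t 0) (aVal w v s a b t (j * (v.length / d)))
  bb : ∀ i j, ∀ o ∈ oddSet (mExp w.length v.length) a b, 1 ≤ i → i < w.length → 1 ≤ j →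
    j < w.length → Commute (cj b (t ^ i)) (cj b (t ^ j * o))
  ab : ∀ i j, ∀ o ∈ oddSet (mExp w.length v.length) a b, 1 ≤ i → i < v.length → 1 ≤ j →
    j < w.length → Commute (cj a (t ^ i)) (cj b (t ^ j * o))
  aa : ∀ i j, ∀ o ∈ oddSet (mExp w.length v.length) a b, 1 ≤ i → i < v.length → 1 ≤ j →
    j < v.length → Commute (cj a (t ^ i)) (cj a (t ^ j * o))

theorem lift_bWord (a b t : Γ) (j : ℕ) :
    FreeGroup.lift (genVal a b t) (bWord w j) = chain w b t b j := by
  induction j with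
  | zero => exact FreeGroup.lift_apply_of
  | succ j ih =>
    rw [bWord, map_cj, map_cj, map_dpow, ih, fb, ft, FreeGroup.lift_apply_of,
      FreeGroup.lift_apply_of]
    rfl

theorem lift_uWord (a b t : Γ) (s : FreeGroup ℕ) :
    FreeGroup.lift (genVal a b t) (uWord w s) = uVal w s b t := by
  have h : (FreeGroup.lift (genVal a b t)).comp (FreeGroup.lift (bWord w)) =
      FreeGroup.lift (chain w b t b) := by
    ext j
    simp [lift_bWord]
  rw [uWord, map_cj, map_cj, map_dpow, uVal, sVal, ← h, fb, ft, FreeGroup.lift_apply_of,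
    FreeGroup.lift_apply_of]
  rfl

/-- A power of z begins and ends with the same power of z. So p_{jn/d}, made from the last letters
of v, is also the exponent belonging to the chain along the first letters. -/
theorem reverse_take_of_eq_flatten {d : ℕ} {z : List Bool}
    (hz : v = (List.replicate d z).flatten) {j : ℕ} (hj : j < d) :
    v.reverse.take (j * z.length) = (v.take (j * z.length)).reverse := by
  obtain ⟨e, rfl⟩ := Nat.exists_eq_add_of_lt hj
  have h1 : v = (List.replicate j z).flatten ++ (List.replicate (e + 1) z).flatten := by
    rw [hz, ← List.flatten_append, List.replicate_append_replicate, add_assoc]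
  have h2 : v = (List.replicate (e + 1) z).flatten ++ (List.replicate j z).flatten := by
    rw [hz, ← List.flatten_append, List.replicate_append_replicate]
    congr 2; omega
  have h3 : ((List.replicate j z).flatten).length = j * z.length := by simp
  conv_rhs => rw [h1, ← h3, List.take_left]
  conv_lhs => rw [h2, List.reverse_append, ← h3, ← List.length_reverse, List.take_left]

theorem rels_iff (hw : 0 < w.length) (hv : 0 < v.length) {d : ℕ} {z : List Bool}
    (hz : v = (List.replicate d z).flatten) (s : FreeGroup ℕ) (a b t : Γ) :
    Rels w v d s a b t ↔ ∀ r ∈ relators w v d s, FreeGroup.lift (genVal a b t) r = 1 := by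
  set F := FreeGroup.lift (genVal a b t) with hF
  have Fa : F fa = a := FreeGroup.lift_apply_of
  have Fb : F fb = b := FreeGroup.lift_apply_of
  have Ft : F ft = t := FreeGroup.lift_apply_of
  have Fu : F (uWord w s) = uVal w s b t := lift_uWord a b t s
  have hn : v.length = d * z.length := by rw [hz]; simp
  have hd : 0 < d := Nat.pos_of_ne_zero (by rintro rfl; simp [hz] at hv)
  have hnd : v.length / d = z.length := by rw [hn, Nat.mul_div_cancel_left _ hd]
  have odd1 : ∀ o ∈ oddWords (mExp w.length v.length),
      F o ∈ oddSet (mExp w.length v.length) a b := by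
    rintro _ ⟨ε, hε, l, hl, rfl⟩
    exact ⟨ε, hε, l, hl, by simp [Fa, Fb]⟩
  have odd2 : ∀ o ∈ oddSet (mExp w.length v.length) a b,
      ∃ o' ∈ oddWords (mExp w.length v.length), F o' = o := by
    rintro _ ⟨ε, hε, l, hl, rfl⟩
    exact ⟨_, ⟨ε, hε, l, hl, rfl⟩, by simp [Fa, Fb]⟩
  have r2 : a * a = 1 → b * b = 1 → (F (cj fb (ft ^ w.length) * cj fa (bq w)) = 1 ↔
      cj (chain w b t b (w.length - 1)) t = cj a (dpow b (w.getD (w.length - 1) false))) := by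
    intro ha hb
    rw [← cj_pow_length_eq_iff hb t b a hw, map_mul, map_cj, map_cj, map_pow, bq, map_polyPow,
      Fa, Fb, Ft, mul_eq_one_iff_eq_inv, inv_eq_of_mul_eq_one_left (cj_mul_self ha _)]
  have r3 : b * b = 1 → (F (cj fa ((uWord w s)⁻¹ * ft ^ v.length) *
      cj fa⁻¹ ((uWord w s)⁻¹ * bp v)) = 1 ↔ cj (aVal w v s a b t (v.length - 1)) t =
        cj (aVal w v s a b t 0) (dpow b (v.getD (v.length - 1) false))) := by
    intro hb
    rw [aVal, ← cj_pow_length_eq_iff hb t _ _ hv, map_mul, map_cj, map_cj, map_mul, map_mul,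
      map_pow, map_inv, map_inv, bp, map_polyPow, Fa, Fb, Ft, Fu, cj_inv, mul_inv_eq_one,
      ← cj_cj, ← cj_cj]
    rfl
  -- Rewriting a power of t through the chain produces the exponent b^{p_r(t)} in both entries of
  -- the commutator, and it cancels. What remains concerns a_1 and a_{1+jn/d}.
  have r4 : b * b = 1 → ∀ j, j < d → (F (cm (cj fa ((uWord w s)⁻¹ * bpTrunc v (j * (v.length / d))))
      (cj fa ((uWord w s)⁻¹ * ft ^ (j * (v.length / d))))) = 1 ↔
        Commute (aVal w v s a b t 0) (aVal w v s a b t (j * (v.length / d)))) := by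
    intro hb j hj
    have hle : j * z.length ≤ v.length := by rw [hn]; exact Nat.mul_le_mul_right _ hj.le
    have : F (cm (cj fa ((uWord w s)⁻¹ * bpTrunc v (j * (v.length / d))))
        (cj fa ((uWord w s)⁻¹ * ft ^ (j * (v.length / d))))) =
        cm (cj (F fa) ((F (uWord w s))⁻¹ * F (bpTrunc v (j * (v.length / d)))))
          (cj (F fa) ((F (uWord w s))⁻¹ * F ft ^ (j * (v.length / d)))) := by
      simp only [cm, map_mul, map_inv, map_cj, map_pow]
    rw [this, cm_eq_one_iff, bpTrunc, map_polyPow, Fa, Fb, Ft, Fu, hnd,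
      reverse_take_of_eq_flatten hz hj, ← cj_cj, ← cj_cj, cj_pow_eq_chain hb t _ hle, commute_cj]
    rfl
  have r5 : ∀ (x y o : FreeGroup Gen) (i j : ℕ), F (cm (cj x (ft ^ i)) (cj y (ft ^ j * o))) = 1 ↔
      Commute (cj (F x) (t ^ i)) (cj (F y) (t ^ j * F o)) := by
    intro x y o i j
    rw [← cm_eq_one_iff]
    simp only [cm, map_mul, map_inv, map_cj, map_pow, Ft]
  constructor
  · rintro ⟨h1, h2, h3, h4, h5, h6, h7, h8, h9⟩ r hr
    rcases hr with (((hr | ⟨j, hj1, hj2, rfl⟩) | ⟨i, j, o, ho, hi1, hi2, hj1, hj2, rfl⟩) |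
      ⟨i, j, o, ho, hi1, hi2, hj1, hj2, rfl⟩) | ⟨i, j, o, ho, hi1, hi2, hj1, hj2, rfl⟩
    · rcases hr with rfl | rfl | rfl | rfl | hr
      · rw [map_pow, Fa, sq, h1]
      · rw [map_pow, Fb, sq, h2]
      · rw [map_pow, map_mul, Fa, Fb, h3]
      · exact (r2 h1 h2).2 h4
      · obtain rfl := Set.mem_singleton_iff.1 hr
        exact (r3 h2).2 h5
    · exact (r4 h2 j hj2).2 (h6 j hj1 hj2)
    · rw [r5, Fb]; exact h7 i j _ (odd1 o ho) hi1 hi2 hj1 hj2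
    · rw [r5, Fa, Fb]; exact h8 i j _ (odd1 o ho) hi1 hi2 hj1 hj2
    · rw [r5, Fa]; exact h9 i j _ (odd1 o ho) hi1 hi2 hj1 hj2
  · intro h
    have base : ∀ r ∈ ({fa ^ 2, fb ^ 2, (fa * fb) ^ 2 ^ (mExp w.length v.length + 1),
        cj fb (ft ^ w.length) * cj fa (bq w),
        cj fa ((uWord w s)⁻¹ * ft ^ v.length) * cj fa⁻¹ ((uWord w s)⁻¹ * bp v)} :
        Set (FreeGroup Gen)), F r = 1 := fun r hr => h r (Or.inl (Or.inl (Or.inl (Or.inl hr))))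
    have h1 : a * a = 1 := by
      have := base (fa ^ 2) (by simp)
      rwa [map_pow, Fa, sq] at this
    have h2 : b * b = 1 := by
      have := base (fb ^ 2) (by simp)
      rwa [map_pow, Fb, sq] at this
    refine ⟨h1, h2, ?_, (r2 h1 h2).1 (base _ (by simp)), (r3 h2).1 (base _ (by simp)),
      fun j hj1 hj2 => ?_, fun i j o ho hi1 hi2 hj1 hj2 => ?_,
      fun i j o ho hi1 hi2 hj1 hj2 => ?_, fun i j o ho hi1 hi2 hj1 hj2 => ?_⟩
    · have := base ((fa * fb) ^ 2 ^ (mExp w.length v.length + 1)) (by simp)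
      rwa [map_pow, map_mul, Fa, Fb] at this
    · exact (r4 h2 j hj2).1 (h _ (Or.inl (Or.inl (Or.inl (Or.inr ⟨j, hj1, hj2, rfl⟩)))))
    · obtain ⟨o, ho', rfl⟩ := odd2 o ho
      have := h _ (Or.inl (Or.inl (Or.inr ⟨i, j, o, ho', hi1, hi2, hj1, hj2, rfl⟩)))
      rwa [r5, Fb] at this
    · obtain ⟨o, ho', rfl⟩ := odd2 o ho
      have := h _ (Or.inl (Or.inr ⟨i, j, o, ho', hi1, hi2, hj1, hj2, rfl⟩))
      rwa [r5, Fa, Fb] at this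
    · obtain ⟨o, ho', rfl⟩ := odd2 o ho
      have := h _ (Or.inr ⟨i, j, o, ho', hi1, hi2, hj1, hj2, rfl⟩)
      rwa [r5, Fa] at this

end Rels


variable {Γ : Type*} [Group Γ]

/-! ### Elements of subgroups -/

theorem dpow_mem {S : Subgroup Γ} {g : Γ} (hg : g ∈ S) (c : Bool) : dpow g c ∈ S := by
  cases c
  · exact one_mem S
  · exact hg

theorem cj_mem {S : Subgroup Γ} {x g : Γ} (hx : x ∈ S) (hg : g ∈ S) : cj x g ∈ S :=
  mul_mem (mul_mem (inv_mem hg) hx) hg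

theorem cj_dpow (x g : Γ) (c : Bool) : cj (dpow x c) g = dpow (cj x g) c := by
  cases c
  · exact cj_one_left g
  · rfl

theorem cj_cj' (x g h : Γ) : cj (cj x g) h = cj (cj x h) (cj g h) := by
  simp [cj, mul_assoc]

theorem cj_polyPow_mem {S : Subgroup Γ} {b t : Γ} {N : ℕ} (h : ∀ j < N, cj b (t ^ j) ∈ S)
    {l : List Bool} {i : ℕ} (hl : l.length + i ≤ N) : cj (polyPow b t l) (t ^ i) ∈ S := by
  induction l generalizing i with
  | nil => simp [polyPow, cj_one_left]
  | cons c l ih =>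
    rw [List.length_cons] at hl
    rw [polyPow, cj_mul, cj_dpow, cj_cj, ← pow_succ']
    exact mul_mem (dpow_mem (h i (by omega)) c) (ih (by omega))

section Rels

variable {d : ℕ} {s : FreeGroup ℕ} {a b t : Γ}

theorem Rels.cj_pow_length_b (h : Rels w v d s a b t) (hw : 0 < w.length) :
    cj b (t ^ w.length) = cj a (polyPow b t w.reverse) :=
  (cj_pow_length_eq_iff h.b_sq t b a hw).2 h.b_last

/-- By the relator for t^k, the element b^{t^{k+i}} is a^{t^i} conjugated by a product of elements
b^{t^j} with j < k+i. -/
theorem Rels.cj_b_mem (h : Rels w v d s a b t) (hw : 0 < w.length) {S : Subgroup Γ} {n : ℕ}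
    (hb : ∀ j < w.length, cj b (t ^ j) ∈ S) (ha : ∀ i < n, cj a (t ^ i) ∈ S) :
    ∀ j < w.length + n, cj b (t ^ j) ∈ S := by
  intro j
  induction j using Nat.strong_induction_on with
  | _ j ih =>
    intro hj
    by_cases hjk : j < w.length
    · exact hb j hjk
    · obtain ⟨i, rfl⟩ := Nat.exists_eq_add_of_le (not_lt.1 hjk)
      rw [pow_add, ← cj_cj, h.cj_pow_length_b hw, cj_cj']
      refine cj_mem (ha i (by omega)) (cj_polyPow_mem (N := w.length + i)
        (fun j' hj' => ih j' hj' (by omega)) (by simp))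

theorem Rels.chain_b_eq (h : Rels w v d s a b t) {j : ℕ} (hj : j ≤ w.length) :
    chain w b t b j = cj (cj b (t ^ j)) (polyPow b t (w.take j).reverse)⁻¹ := by
  rw [cj_pow_eq_chain h.b_sq t b hj, cj_cj, mul_inv_cancel, cj_one_right]

theorem Rels.aVal_eq (h : Rels w v d s a b t) {i : ℕ} (hi : i ≤ v.length) :
    aVal w v s a b t i = cj (cj (cj a (t ^ i)) (cj (uVal w s b t) (t ^ i))⁻¹)
      (polyPow b t (v.take i).reverse)⁻¹ := by
  rw [← cj_inv, ← cj_cj', cj_pow_eq_chain h.b_sq t _ hi, cj_cj, mul_inv_cancel, cj_one_right]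
  rfl

/-- The letters of s are b_j with j < k, and u contains one further t. So only powers of t below n+k
occur, the range covered by `Rels.cj_b_mem`. -/
theorem Rels.cj_uVal_mem (h : Rels w v d s a b t) (hw : 0 < w.length)
    (hs : s ∈ Subgroup.closure (FreeGroup.of '' twistGens w.length v.length))
    {S : Subgroup Γ} {n : ℕ} (hb : ∀ j < w.length, cj b (t ^ j) ∈ S)
    (ha : ∀ i < n, cj a (t ^ i) ∈ S) {i : ℕ} (hi : i ≤ n) : cj (uVal w s b t) (t ^ i) ∈ S := by
  have hB := h.cj_b_mem hw hb ha
  have hc := fun j => h.chain_b_eq (j := j)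
  clear h
  have hs' : cj (sVal w s b t) (t ^ (i + 1)) ∈ S := by
    rw [sVal]
    induction hs using Subgroup.closure_induction with
    | mem x hx =>
      obtain ⟨j, hj, rfl⟩ := hx
      have hj := twistGens_lt hw hj
      rw [FreeGroup.lift_apply_of, hc _ (by omega), cj_cj', cj_cj b, ← pow_add, cj_inv]
      exact cj_mem (hB _ (by omega)) (inv_mem (cj_polyPow_mem hB (by simp; omega)))
    | one => rw [map_one, cj_one_left]; exact one_mem S
    | mul x y _ _ hx hy => rw [map_mul, cj_mul]; exact mul_mem hx hy
    | inv x _ hx => rw [map_inv, cj_inv]; exact inv_mem hx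
  rw [uVal, cj_cj', cj_cj (sVal w s b t), ← pow_succ', cj_dpow]
  exact cj_mem hs' (dpow_mem (hB i (by omega)) _)

theorem Rels.polyPow_mem (h : Rels w v d s a b t) (hw : 0 < w.length) {S : Subgroup Γ} {n : ℕ}
    (hb : ∀ j < w.length, cj b (t ^ j) ∈ S) (ha : ∀ i < n, cj a (t ^ i) ∈ S) {l : List Bool}
    (hl : l.length ≤ w.length + n) : polyPow b t l ∈ S := by
  have := cj_polyPow_mem (h.cj_b_mem hw hb ha) (l := l) (i := 0) (by omega)
  rwa [pow_zero, cj_one_right] at this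

/-! ### The elements with an odd number of `b`'s -/

/-- With r = ab one has b = ar and a^b = ar². Multiplication by a or a^b on either side therefore
keeps the exponent of r odd, and the order of r bounds the exponent. -/
theorem mem_oddSet {m : ℕ} (ha : a * a = 1) (hb : b * b = 1) (hab : (a * b) ^ 2 ^ (m + 1) = 1)
    {e e' : Γ} (he : e ∈ Subgroup.closure {a, cj a b}) (he' : e' ∈ Subgroup.closure {a, cj a b}) :
    e' * b * e ∈ oddSet m a b := by
  have ha' : a⁻¹ = a := inv_eq_of_mul_eq_one_left ha
  have hb' : b⁻¹ = b := inv_eq_of_mul_eq_one_left hb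
  set r := a * b with hr
  have hbr : b = a * r := by rw [hr, ← mul_assoc, ha, one_mul]
  have hcj : cj a b = a * r ^ (2 : ℤ) := by
    rw [cj, hb', zpow_two, hr]
    simp only [← mul_assoc, ha, one_mul]
  have hra : ∀ i : ℤ, r ^ i * a = a * r ^ (-i) := by
    intro i
    have : a * r * a⁻¹ = r⁻¹ := by rw [hr, mul_inv_rev, ha', hb', ← mul_assoc, ha, one_mul]
    rw [zpow_neg, ← inv_zpow, ← this, conj_zpow, ha', ← mul_assoc, ← mul_assoc, ha, one_mul]
  have hcc : (cj a b)⁻¹ = cj a b := inv_eq_of_mul_eq_one_left (cj_mul_self ha b)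
  set P : Γ → Prop := fun o => ∃ j : ℤ, o = r ^ (2 * j + 1) ∨ o = a * r ^ (2 * j + 1) with hP
  have la : ∀ o, P o → P (a * o) := by
    rintro o ⟨j, rfl | rfl⟩
    · exact ⟨j, Or.inr rfl⟩
    · exact ⟨j, Or.inl (by rw [← mul_assoc, ha, one_mul])⟩
  have lr : ∀ o, P o → P (r ^ (2 : ℤ) * o) := by
    rintro o ⟨j, rfl | rfl⟩
    · exact ⟨j + 1, Or.inl (by rw [← zpow_add]; congr 1; ring)⟩
    · exact ⟨j - 1, Or.inr (by
        rw [← mul_assoc, hra, mul_assoc, ← zpow_add]; congr 2; ring)⟩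
  have ra : ∀ o, P o → P (o * a) := by
    rintro o ⟨j, rfl | rfl⟩
    · exact ⟨-j - 1, Or.inr (by rw [hra]; congr 2; ring)⟩
    · exact ⟨-j - 1, Or.inl (by rw [mul_assoc, hra, ← mul_assoc, ha, one_mul]; congr 1; ring)⟩
  have rr : ∀ o, P o → P (o * r ^ (2 : ℤ)) := by
    rintro o ⟨j, rfl | rfl⟩
    · exact ⟨j + 1, Or.inl (by rw [← zpow_add]; congr 1; ring)⟩
    · exact ⟨j + 1, Or.inr (by rw [mul_assoc, ← zpow_add]; congr 2; ring)⟩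
  have lx : ∀ x ∈ ({a, cj a b} : Set Γ), x⁻¹ = x ∧ ∀ o, P o → P (x * o) ∧ P (o * x) := by
    rintro x (rfl | hx)
    · exact ⟨ha', fun o ho => ⟨la o ho, ra o ho⟩⟩
    · obtain rfl := Set.mem_singleton_iff.1 hx
      refine ⟨hcc, fun o ho => ?_⟩
      rw [hcj]
      exact ⟨by rw [mul_assoc]; exact la _ (lr o ho), by rw [← mul_assoc]; exact rr _ (ra o ho)⟩
  have hl : ∀ o, P o → P (e' * o) := by
    induction he' using Subgroup.closure_induction_left with
    | one => simp
    | mul_left x hx y _ ih =>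
      intro o ho
      rw [mul_assoc]
      exact ((lx x hx).2 _ (ih o ho)).1
    | inv_mul_cancel x hx y _ ih =>
      intro o ho
      rw [mul_assoc, (lx x hx).1]
      exact ((lx x hx).2 _ (ih o ho)).1
  have hr' : ∀ o, P o → P (o * e) := by
    induction he using Subgroup.closure_induction_left with
    | one => simp
    | mul_left x hx y _ ih =>
      intro o ho
      rw [← mul_assoc]
      exact ih _ ((lx x hx).2 _ ho).2
    | inv_mul_cancel x hx y _ ih =>
      intro o ho
      rw [← mul_assoc, (lx x hx).1]
      exact ih _ ((lx x hx).2 _ ho).2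
  obtain ⟨j, hj⟩ := hr' _ (hl b ⟨0, Or.inr (by simpa using hbr)⟩)
  have hN : (0 : ℤ) < 2 ^ m := by positivity
  have hmod : r ^ (2 * (j % 2 ^ m)) = r ^ (2 * j) := by
    have h1 : (2 * j : ℤ) = 2 * (j % 2 ^ m) + 2 ^ (m + 1) * (j / 2 ^ m) := by
      have := Int.emod_add_mul_ediv j (2 ^ m)
      rw [pow_succ]
      linear_combination (-2) * this
    have h2 : r ^ ((2 : ℤ) ^ (m + 1)) = 1 := by
      have : ((2 : ℤ) ^ (m + 1)) = ((2 ^ (m + 1) : ℕ) : ℤ) := by push_cast; rfl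
      rw [this, zpow_natCast, hab]
    conv_rhs => rw [h1, zpow_add, zpow_mul r (2 ^ (m + 1)), h2, one_zpow, mul_one]
  have hnat : r ^ (2 * (j % 2 ^ m).toNat) = r ^ (2 * j) := by
    rw [← hmod, ← zpow_natCast]
    congr 1
    push_cast
    rw [Int.toNat_of_nonneg (Int.emod_nonneg _ hN.ne')]
  have hle : (j % 2 ^ m).toNat ≤ 2 ^ m := by
    have := (Int.emod_lt_of_pos j hN).le
    rw [Int.toNat_le]
    exact_mod_cast this
  have hrs : r ^ (2 * j + 1) = r * r ^ (2 * j) := by rw [add_comm, zpow_add, zpow_one]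
  rcases hj with hj | hj
  · exact ⟨1, le_rfl, (j % 2 ^ m).toNat, hle, by rw [hj, hnat, hrs, pow_one]⟩
  · refine ⟨0, zero_le_one, (j % 2 ^ m).toNat, hle, ?_⟩
    rw [hj, hnat, hrs, pow_zero, one_mul, ← mul_assoc, ← hbr]

end Rels


/-! ### Decomposition of words along their sections -/

/-- The value of a generator of `K(w,v)`. -/
def letterVal (w v : List Bool) (s : FreeGroup ℕ) (a b t : Γ) : Letter → Γ
  | .b j => chain w b t b j
  | .a i => aVal w v s a b t i

/-- `A` for `a_n`, `B` for `b_k` and `1` for the other generators. -/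
def dihVal (w v : List Bool) (A B : Γ) (z : Letter) : Γ :=
  if z = .a (v.length - 1) then A else if z = .b (w.length - 1) then B else 1

/-- The value of a word, given the values of the letters. -/
def wordVal (f : Letter → Γ) (W : List Letter) : Γ := (W.map f).prod

theorem wordVal_nil (f : Letter → Γ) : wordVal f [] = 1 := rfl

theorem wordVal_cons (f : Letter → Γ) (x : Letter) (W : List Letter) :
    wordVal f (x :: W) = f x * wordVal f W := by simp [wordVal]

theorem wordVal_append (f : Letter → Γ) (W V : List Letter) :
    wordVal f (W ++ V) = wordVal f W * wordVal f V := by simp [wordVal]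

theorem wordVal_singleton (f : Letter → Γ) (x : Letter) : wordVal f [x] = f x := by simp [wordVal]

/-- The value of `a_n^s`. -/
def twistedA (w v : List Bool) (s : FreeGroup ℕ) (a b t : Γ) : Γ :=
  cj (aVal w v s a b t (v.length - 1)) (sVal w s b t)

/-- The value of `b_k`. -/
def lastB (w : List Bool) (b t : Γ) : Γ := chain w b t b (w.length - 1)

/-- The dihedral group generated by `a_n^s` and `b_k`. -/
def dihGroup (w v : List Bool) (s : FreeGroup ℕ) (a b t : Γ) : Subgroup Γ :=
  Subgroup.closure {twistedA w v s a b t, lastB w b t}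

/-- The conjugates under `⟨a_n^s, b_k⟩` of the elements `b^{t^i}`, `i < k - 1`, and `a^{t^i}`,
`i < n - 1`, generate a complement of this dihedral group. -/
def baseGroup (w v : List Bool) (s : FreeGroup ℕ) (a b t : Γ) : Subgroup Γ :=
  Subgroup.closure {y | ∃ x e, ((∃ i, i + 1 < w.length ∧ x = cj b (t ^ i)) ∨
    ∃ i, i + 1 < v.length ∧ x = cj a (t ^ i)) ∧ e ∈ dihGroup w v s a b t ∧ y = cj x e}

section Rels

variable {d : ℕ} {s : FreeGroup ℕ} {a b t : Γ}

local notation "aT" => twistedA w v s a b t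
local notation "bT" => lastB w b t
local notation "mG" => baseGroup w v s a b t
local notation "dG" => dihGroup w v s a b t
local notation "ev" => wordVal (letterVal w v s a b t)
local notation "kp" => wordVal (dihVal w v aT bT)
local notation "kq" => wordVal (dihVal w v bT aT)

theorem cj_mem_baseGroup {m e : Γ} (hm : m ∈ mG) (he : e ∈ dG) : cj m e ∈ mG := by
  induction hm using Subgroup.closure_induction with
  | mem m hm =>
    obtain ⟨x, e', hx, he', rfl⟩ := hm
    exact Subgroup.subset_closure ⟨x, e' * e, hx, mul_mem he' he, by rw [cj_cj]⟩
  | one => rw [cj_one_left]; exact one_mem _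
  | mul x y _ _ hx hy => rw [cj_mul]; exact mul_mem hx hy
  | inv x _ hx => rw [cj_inv]; exact inv_mem hx

theorem dihGroup_le_normalizer : dG ≤ Subgroup.normalizer (mG : Set Γ) := by
  intro e he
  rw [Subgroup.mem_normalizer_iff'']
  refine fun m => ⟨fun hm => cj_mem_baseGroup hm he, fun hm => ?_⟩
  have := cj_mem_baseGroup hm (inv_mem he)
  simpa [cj, mul_assoc] using this

theorem mem_baseGroup_of_cj {m g : Γ} (hg : g ∈ Subgroup.normalizer (mG : Set Γ)) (hm : m ∈ mG) :
    cj m g ∈ mG :=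
  (Subgroup.mem_normalizer_iff''.1 hg m).1 hm

theorem lastB_mem : bT ∈ dG := Subgroup.subset_closure (by simp)

theorem twistedA_mem : aT ∈ dG := Subgroup.subset_closure (by simp)

theorem cj_b_mem_baseGroup {i : ℕ} (hi : i + 1 < w.length) : cj b (t ^ i) ∈ mG :=
  Subgroup.subset_closure ⟨_, 1, Or.inl ⟨i, hi, rfl⟩, one_mem _, (cj_one_right _).symm⟩

theorem cj_a_mem_baseGroup {i : ℕ} (hi : i + 1 < v.length) : cj a (t ^ i) ∈ mG :=
  Subgroup.subset_closure ⟨_, 1, Or.inr ⟨i, hi, rfl⟩, one_mem _, (cj_one_right _).symm⟩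

theorem wordVal_dihVal_mem {A B : Γ} {S : Subgroup Γ} (hA : A ∈ S) (hB : B ∈ S)
    (W : List Letter) : wordVal (dihVal w v A B) W ∈ S := by
  induction W with
  | nil => exact one_mem S
  | cons x W ih =>
    rw [wordVal_cons]
    refine mul_mem ?_ ih
    unfold dihVal
    split_ifs
    exacts [hA, hB, one_mem S]

theorem Rels.aVal_mul_self (h : Rels w v d s a b t) (i : ℕ) :
    aVal w v s a b t i * aVal w v s a b t i = 1 :=
  chain_mul_self (cj_mul_self h.a_sq _) i

theorem Rels.letterVal_mul_self (h : Rels w v d s a b t) (x : Letter) :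
    letterVal w v s a b t x * letterVal w v s a b t x = 1 := by
  cases x with
  | b j => exact chain_mul_self h.b_sq j
  | a i => exact h.aVal_mul_self i

section

variable (h : Rels w v d s a b t) (hw : 0 < w.length) (hv : 0 < v.length)
  (hlast : w.getD (w.length - 1) false ≠ v.getD (v.length - 1) false)
include h hw

/-- Only the exponent k-1 is not immediate: that element is b_k, which lies in the dihedral group,
conjugated by a product of elements of the base group. -/
theorem Rels.b_mem_normalizer : ∀ j < w.length, cj b (t ^ j) ∈ Subgroup.normalizer (mG : Set Γ) := by
  have hM : mG ≤ Subgroup.normalizer (mG : Set Γ) := Subgroup.le_normalizer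
  intro j hj
  by_cases hj' : j + 1 < w.length
  · exact hM (cj_b_mem_baseGroup hj')
  · obtain rfl : j = w.length - 1 := by omega
    rw [cj_pow_eq_chain h.b_sq t b (l := w) (by omega)]
    refine cj_mem (dihGroup_le_normalizer lastB_mem) (hM ?_)
    have := cj_polyPow_mem (S := mG) (b := b) (t := t) (N := w.length - 1)
      (fun i hi => cj_b_mem_baseGroup (by omega)) (l := (w.take (w.length - 1)).reverse) (i := 0)
      (by simp)
    rwa [pow_zero, cj_one_right] at this

omit h hw in
theorem a_mem_normalizer :
    ∀ i < v.length - 1, cj a (t ^ i) ∈ Subgroup.normalizer (mG : Set Γ) := fun i hi =>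
  Subgroup.le_normalizer (cj_a_mem_baseGroup (by omega))

theorem Rels.chain_b_mem {j : ℕ} (hj : j + 1 < w.length) : chain w b t b j ∈ mG := by
  rw [h.chain_b_eq (by omega)]
  exact mem_baseGroup_of_cj (inv_mem (h.polyPow_mem hw (h.b_mem_normalizer hw)
    a_mem_normalizer (by simp))) (cj_b_mem_baseGroup hj)

theorem Rels.sVal_mem (hs : s ∈ Subgroup.closure (FreeGroup.of '' twistGens w.length v.length)) :
    sVal w s b t ∈ mG := by
  have hc := fun j => h.chain_b_mem (j := j) hw
  have key : ∀ r ∈ Subgroup.closure (FreeGroup.of '' twistGens w.length v.length),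
      sVal w r b t ∈ mG := by
    intro r hr
    rw [sVal]
    induction hr using Subgroup.closure_induction with
    | mem x hx =>
      obtain ⟨j, hj, rfl⟩ := hx
      rw [FreeGroup.lift_apply_of]
      exact hc j (twistGens_lt hw hj)
    | one => rw [map_one]; exact one_mem _
    | mul x y _ _ hx hy => rw [map_mul]; exact mul_mem hx hy
    | inv x _ hx => rw [map_inv]; exact inv_mem hx
  exact key s hs

theorem Rels.aVal_mem (hs : s ∈ Subgroup.closure (FreeGroup.of '' twistGens w.length v.length))
    {i : ℕ} (hi : i + 1 < v.length) : aVal w v s a b t i ∈ mG := by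
  rw [h.aVal_eq (by omega)]
  refine mem_baseGroup_of_cj (inv_mem (h.polyPow_mem hw (h.b_mem_normalizer hw)
    a_mem_normalizer (by simp; omega))) (mem_baseGroup_of_cj (inv_mem ?_)
      (cj_a_mem_baseGroup hi))
  exact h.cj_uVal_mem hw hs (h.b_mem_normalizer hw) a_mem_normalizer (by omega)

/-- The component of a word in the base group. -/
theorem Rels.base_component_mem
    (hs : s ∈ Subgroup.closure (FreeGroup.of '' twistGens w.length v.length))
    {W : List Letter} (hW : ∀ x ∈ W, x.Valid w v) : ev W * (kp W)⁻¹ ∈ mG := by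
  have hkp : ∀ V, kp V ∈ dG := fun V => wordVal_dihVal_mem twistedA_mem lastB_mem V
  induction W with
  | nil => simp [wordVal_nil]
  | cons x W ih =>
    simp only [List.mem_cons, forall_eq_or_imp] at hW
    have e : ev (x :: W) * (kp (x :: W))⁻¹ =
        letterVal w v s a b t x * (dihVal w v aT bT x)⁻¹ *
          cj (ev W * (kp W)⁻¹) (dihVal w v aT bT x)⁻¹ := by
      rw [wordVal_cons, wordVal_cons]
      simp [cj, mul_assoc]
    rw [e]
    have hx : dihVal w v aT bT x ∈ dG := by
      rw [← wordVal_singleton (dihVal w v aT bT)]; exact hkp [x]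
    refine mul_mem ?_ (cj_mem_baseGroup (ih hW.2) (inv_mem hx))
    rcases x with j | i
    · by_cases hj : j = w.length - 1
      · subst hj
        simp [dihVal, letterVal, lastB]
      · have : j + 1 < w.length := by have := hW.1; simp only [Letter.Valid] at this; omega
        simpa [dihVal, letterVal, hj] using h.chain_b_mem hw this
    · by_cases hi : i = v.length - 1
      · subst hi
        have hsM := h.sVal_mem hw hs
        -- Since s lies in the base group, a_n and a_n^s agree modulo it.
        have e2 : letterVal w v s a b t (.a (v.length - 1)) *
            (dihVal w v aT bT (.a (v.length - 1)))⁻¹ =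
            sVal w s b t * (cj (sVal w s b t) aT⁻¹)⁻¹ := by
          simp [letterVal, dihVal, twistedA, cj, mul_assoc]
        rw [e2]
        exact mul_mem hsM (inv_mem (cj_mem_baseGroup hsM (inv_mem twistedA_mem)))
      · have : i + 1 < v.length := by have := hW.1; simp only [Letter.Valid] at this; omega
        simpa [dihVal, letterVal, hi] using h.aVal_mem hw hs this

-- Conjugation by s^t cancels the u⁻¹ in a_1 = a^{u⁻¹}. This is what the exponent 1 - y_k = x_n in
-- the definition of u is for.
omit hw in
include hlast in
theorem Rels.cj_twistedA : cj aT t = cj a (dpow b (v.getD (v.length - 1) false)) := by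
  have hy : (!(w.getD (w.length - 1) false)) = v.getD (v.length - 1) false := by
    revert hlast; cases w.getD (w.length - 1) false <;> cases v.getD (v.length - 1) false <;> simp
  rw [twistedA, cj_cj', h.a_last, aVal, chain]
  set x := v.getD (v.length - 1) false with hx
  have hu : uVal w s b t = cj (cj (sVal w s b t) t) (dpow b x) := by rw [uVal, hy]
  have hs : cj (sVal w s b t) t = cj (uVal w s b t) (dpow b x) := by
    rw [hu, cj_cj, dpow_mul_self h.b_sq, cj_one_right]
  rw [hs, ← cj_cj', cj_cj a, inv_mul_cancel, cj_one_right]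

omit hw in
theorem Rels.cj_lastB : cj bT t = cj a (dpow b (w.getD (w.length - 1) false)) := h.b_last

omit hw in
theorem Rels.cj_b_b (x : Γ) : cj (cj x b) b = x := by rw [cj_cj, h.b_sq, cj_one_right]

-- The abstract form of φ(b_k) = ⟨b_k, a_n^s⟩ and φ(a_n^s) = ⟨a_n^s, b_k⟩: conjugation by b
-- exchanges the coordinates.
omit hw in
include hlast in
theorem Rels.cj_lastB_eq : cj bT t = cj aT (t * b) := by
  rw [h.cj_lastB, ← cj_cj, h.cj_twistedA hlast]
  revert hlast
  cases w.getD (w.length - 1) false <;> cases v.getD (v.length - 1) false <;>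
    simp [dpow, cj_one_right, h.cj_b_b]

omit hw in
include hlast in
theorem Rels.cj_twistedA_eq : cj aT t = cj bT (t * b) := by
  rw [← cj_cj, h.cj_lastB_eq hlast, ← cj_cj, h.cj_b_b]

omit hw in
theorem Rels.twistedA_mul_self : aT * aT = 1 := cj_mul_self (h.aVal_mul_self _) _

omit hw in
theorem Rels.lastB_mul_self : bT * bT = 1 := chain_mul_self h.b_sq _

-- Conjugated by t, the product becomes a·a^b or a^b·a, that is, (ab)² or its inverse.
omit hw in
include hlast in
theorem Rels.twistedA_mul_lastB_pow : (aT * bT) ^ 2 ^ mExp w.length v.length = 1 := by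
  apply cj_left_injective t
  have hpow : ∀ (x : Γ) (r : ℕ), cj (x ^ r) t = cj x t ^ r := fun x r => by
    induction r with
    | zero => simp [cj_one_left]
    | succ r ih => rw [pow_succ, cj_mul, ih, pow_succ]
  have hb' : b⁻¹ = b := inv_eq_of_mul_eq_one_left h.b_sq
  have ha' : a⁻¹ = a := inv_eq_of_mul_eq_one_left h.a_sq
  have hab := h.ab_pow
  rw [pow_succ', pow_mul] at hab
  have hba : (b * a * b * a) ^ 2 ^ mExp w.length v.length = 1 := by
    have : b * a * b * a = ((a * b) ^ 2)⁻¹ := by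
      rw [sq]; simp only [mul_inv_rev, ha', hb', mul_assoc]
    rw [this, inv_pow, hab, inv_one]
  rw [sq] at hab
  change cj _ t = cj _ t
  rw [hpow, cj_mul, h.cj_twistedA hlast, h.cj_lastB, cj_one_left]
  revert hlast
  cases w.getD (w.length - 1) false <;> cases v.getD (v.length - 1) false <;>
    simp only [ne_eq, not_true_eq_false, false_imp_iff, dpow, if_true, cj, hb',
      Bool.false_eq_true, if_false, inv_one, one_mul, mul_one] <;> intro _
  · exact hba
  · rw [← mul_assoc] at hab
    simpa only [mul_assoc] using hab

-- In K(w,v) this expresses that ⟨m,1⟩ and ⟨1,m'⟩ commute. For generators x^e and x'^{e'} of the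
-- base group, conjugation by the inverse of e^t reduces the claim to a commutator relator with o =
-- e'^t b (e^t)⁻¹, an element with an odd number of b's.
include hlast in
omit hw in
theorem Rels.baseGroup_commute {m m' : Γ} (hm : m ∈ mG) (hm' : m' ∈ mG) :
    Commute (cj m t) (cj m' (t * b)) := by
  have hab := h.ab_pow
  have hE : ∀ e ∈ dG, cj e t ∈ Subgroup.closure {a, cj a b} := by
    intro e he
    have hd : ∀ c, cj a (dpow b c) ∈ Subgroup.closure {a, cj a b} := by
      intro c
      cases c
      · simpa [dpow, cj_one_right] using Subgroup.subset_closure (by simp)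
      · exact Subgroup.subset_closure (by simp [dpow])
    induction he using Subgroup.closure_induction with
    | mem e he =>
      rcases he with rfl | he
      · rw [h.cj_twistedA hlast]; exact hd _
      · obtain rfl := Set.mem_singleton_iff.1 he
        rw [h.cj_lastB]; exact hd _
    | one => rw [cj_one_left]; exact one_mem _
    | mul x y _ _ hx hy => rw [cj_mul]; exact mul_mem hx hy
    | inv x _ hx => rw [cj_inv]; exact inv_mem hx
  have hodd : ∀ e ∈ dG, ∀ e' ∈ dG, cj e' t * b * (cj e t)⁻¹ ∈
      oddSet (mExp w.length v.length) a b := fun e he e' he' =>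
    mem_oddSet h.a_sq h.b_sq hab (inv_mem (hE e he)) (hE e' he')
  -- The mixed relators have a first and b second. The opposite order is obtained by passing to the
  -- inverse of o, which is odd as well.
  have hodd' : ∀ e ∈ dG, ∀ e' ∈ dG, (cj e' t * b * (cj e t)⁻¹)⁻¹ ∈
      oddSet (mExp w.length v.length) a b := fun e he e' he' => by
    have := hodd e' he' e he
    rw [mul_inv_rev, mul_inv_rev, inv_inv, inv_eq_of_mul_eq_one_left h.b_sq, ← mul_assoc]
    exact this
  have comm_inv : ∀ {x y o : Γ}, Commute y (cj x o⁻¹) → Commute x (cj y o) := by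
    intro x y o hxy
    have := (commute_cj (g := o)).2 hxy
    rw [cj_cj, inv_mul_cancel, cj_one_right] at this
    exact this.symm
  have gen : ∀ x e x' e', ((∃ i, i + 1 < w.length ∧ x = cj b (t ^ i)) ∨
      ∃ i, i + 1 < v.length ∧ x = cj a (t ^ i)) → e ∈ dG →
      ((∃ i, i + 1 < w.length ∧ x' = cj b (t ^ i)) ∨
      ∃ i, i + 1 < v.length ∧ x' = cj a (t ^ i)) → e' ∈ dG →
      Commute (cj (cj x e) t) (cj (cj x' e') (t * b)) := by
    intro x e x' e' hx he hx' he'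
    have h1 : cj (cj x e) t = cj (cj x t) (cj e t) := cj_cj' _ _ _
    have h2 : cj (cj x' e') (t * b) =
        cj (cj (cj x' t) (cj e' t * b * (cj e t)⁻¹)) (cj e t) := by
      simp [cj, mul_assoc]
    rw [h1, h2, commute_cj]
    have ho := hodd e he e' he'
    have ho' := hodd' e he e' he'
    rcases hx with ⟨i, hi, rfl⟩ | ⟨i, hi, rfl⟩ <;> rcases hx' with ⟨j, hj, rfl⟩ | ⟨j, hj, rfl⟩ <;>
      rw [cj_cj _ _ t, cj_cj _ _ t, ← pow_succ, ← pow_succ]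
    · rw [cj_cj]
      exact h.bb _ _ _ ho (by omega) hi (by omega) hj
    · apply comm_inv
      rw [cj_cj]
      exact h.ab _ _ _ ho' (by omega) hj (by omega) hi
    · rw [cj_cj]
      exact h.ab _ _ _ ho (by omega) hi (by omega) hj
    · rw [cj_cj]
      exact h.aa _ _ _ ho (by omega) hi (by omega) hj
  induction hm using Subgroup.closure_induction with
  | mem m hm =>
    obtain ⟨x, e, hx, he, rfl⟩ := hm
    induction hm' using Subgroup.closure_induction with
    | mem m' hm' =>
      obtain ⟨x', e', hx', he', rfl⟩ := hm'
      exact gen x e x' e' hx he hx' he'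
    | one => rw [cj_one_left]; exact Commute.one_right _
    | mul y z _ _ hy hz => rw [cj_mul]; exact hy.mul_right hz
    | inv y _ hy => rw [cj_inv]; exact hy.inv_right
  | one => rw [cj_one_left]; exact Commute.one_left _
  | mul y z _ _ hy hz => rw [cj_mul]; exact hy.mul_left hz
  | inv y _ hy => rw [cj_inv]; exact hy.inv_left

end

end Rels


/-! ### Rebuilding the value of a word from its two sections. -/

section Rels

variable {d : ℕ} {s : FreeGroup ℕ} {a b t : Γ}

/-- The element with the given words as sections, provided that the sections are compatible. -/
def assemble (w v : List Bool) (s : FreeGroup ℕ) (a b t : Γ) (V₀ V₁ : List Letter) : Γ :=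
  cj (wordVal (letterVal w v s a b t) V₁ *
    (wordVal (dihVal w v (twistedA w v s a b t) (lastB w b t)) V₁)⁻¹) (t * b) *
      cj (wordVal (letterVal w v s a b t) V₀) t

local notation "aT" => twistedA w v s a b t
local notation "bT" => lastB w b t
local notation "mG" => baseGroup w v s a b t
local notation "dG" => dihGroup w v s a b t
local notation "ev" => wordVal (letterVal w v s a b t)
local notation "kp" => wordVal (dihVal w v aT bT)
local notation "kq" => wordVal (dihVal w v bT aT)

variable (h : Rels w v d s a b t) (hw : 0 < w.length) (hv : 0 < v.length)
  (hlast : w.getD (w.length - 1) false ≠ v.getD (v.length - 1) false)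
  (hs : s ∈ Subgroup.closure (FreeGroup.of '' twistGens w.length v.length))

include h hlast

/-- On words, `kp` is the projection to the dihedral group and `kq` is ψ. They are exchanged because
a_n^s and b_k are exchanged on passing to the other half of the tree. -/
theorem Rels.cj_kq (V : List Letter) : cj (kq V) t = cj (kp V) (t * b) := by
  induction V with
  | nil => rw [wordVal_nil, wordVal_nil, cj_one_left, cj_one_left]
  | cons x V ih =>
    rw [wordVal_cons, wordVal_cons, cj_mul, cj_mul, ih]
    congr 1
    unfold dihVal
    split_ifs
    · exact h.cj_lastB_eq hlast
    · exact h.cj_twistedA_eq hlast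
    · rw [cj_one_left, cj_one_left]

theorem Rels.cj_kp (V : List Letter) : cj (kp V) t = cj (kq V) (t * b) := by
  rw [← cj_cj (kq V), h.cj_kq hlast, ← cj_cj, h.cj_b_b]

theorem Rels.kp_eq_swap {V₀ V₁ : List Letter} (hV : kp V₁ = kq V₀) : kp V₀ = kq V₁ := by
  apply cj_left_injective (t * b)
  change cj _ _ = cj _ _
  rw [← h.cj_kq hlast, ← h.cj_kp hlast, hV]

include hw hs

/-- The model is ⟨g, ψ(g)⟩⟨1,m⟩: only the second coordinate ψ(g), here `kq V`, acts on m. The part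
of the value in the base group is supported on the other half. -/
theorem Rels.cj_ev_mul {V : List Letter} (hV : ∀ x ∈ V, x.Valid w v) {m : Γ} (hm : m ∈ mG) :
    cj (ev V) t * cj m (t * b) = cj (cj m (kq V)⁻¹) (t * b) * cj (ev V) t := by
  have hq : kq V ∈ dG := wordVal_dihVal_mem lastB_mem twistedA_mem V
  have e : ev V = (ev V * (kp V)⁻¹) * kp V := by simp
  have hc := h.baseGroup_commute hlast (h.base_component_mem hw hs hV)
    (cj_mem_baseGroup hm (inv_mem hq))
  rw [e, cj_mul, ← mul_assoc, ← hc.eq, mul_assoc, mul_assoc, h.cj_kp hlast, ← cj_mul, ← cj_mul]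
  simp [cj, mul_assoc]

/-- `assemble` imitates ⟨g₀,g₁⟩ = ⟨1, g₁ψ(g₀)⁻¹⟩⟨g₀, ψ(g₀)⟩, where compatibility means that ψ(g₀) is
the dihedral part of g₁. Multiplicativity comes down to one transposition, `Rels.cj_ev_mul`. -/
theorem Rels.assemble_append {V₀ V₁ W₀ W₁ : List Letter} (hV₀ : ∀ x ∈ V₀, x.Valid w v)
    (hW₁ : ∀ x ∈ W₁, x.Valid w v) (hV : kp V₁ = kq V₀) :
    assemble w v s a b t (V₀ ++ W₀) (V₁ ++ W₁) =
      assemble w v s a b t V₀ V₁ * assemble w v s a b t W₀ W₁ := by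
  have hm := h.cj_ev_mul hw hlast hs hV₀ (h.base_component_mem hw hs hW₁)
  have e : ev (V₁ ++ W₁) * (kp (V₁ ++ W₁))⁻¹ =
      (ev V₁ * (kp V₁)⁻¹) * cj (ev W₁ * (kp W₁)⁻¹) (kq V₀)⁻¹ := by
    rw [← hV, wordVal_append, wordVal_append]
    simp [cj, mul_assoc]
  unfold assemble
  rw [e, wordVal_append, cj_mul, cj_mul (ev V₀)]
  calc _ = cj (ev V₁ * (kp V₁)⁻¹) (t * b) * (cj (cj (ev W₁ * (kp W₁)⁻¹) (kq V₀)⁻¹) (t * b) *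
        cj (ev V₀) t) * cj (ev W₀) t := by simp only [mul_assoc]
    _ = _ := by rw [← hm]; simp only [mul_assoc]

/-- Once the dihedral parts are split off on both sides, what has to be interchanged lies in M^t and
M^{tb}, which commute. -/
theorem Rels.assemble_swap {W₀ W₁ : List Letter} (hW₀ : ∀ x ∈ W₀, x.Valid w v)
    (hW₁ : ∀ x ∈ W₁, x.Valid w v) (hW : kp W₁ = kq W₀) :
    cj (assemble w v s a b t W₀ W₁) b = assemble w v s a b t W₁ W₀ := by
  have hc := h.baseGroup_commute hlast (h.base_component_mem hw hs hW₁)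
    (h.base_component_mem hw hs hW₀)
  have e0 : cj (ev W₀) (t * b) =
      cj (ev W₀ * (kp W₀)⁻¹) (t * b) * cj (kp W₁) t := by
    rw [h.cj_kp hlast, ← h.kp_eq_swap hlast hW, ← cj_mul, inv_mul_cancel_right]
  have e1 : cj (ev W₁) t = cj (ev W₁ * (kp W₁)⁻¹) t * cj (kp W₁) t := by
    rw [← cj_mul, inv_mul_cancel_right]
  unfold assemble
  rw [cj_mul, ← cj_cj _ t b, h.cj_b_b, cj_cj (ev W₀), e0, e1, ← mul_assoc, hc.eq, mul_assoc]

include hv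

-- For a_1 this is the relation that closes the chain of the a_i. For the other generators it is the
-- recursion of the chains.
omit hs in
theorem Rels.assemble_secL {x : Letter} (hx : x.Valid w v) (hx0 : x ≠ .b 0) :
    kp (secL w v true x) = kq (secL w v false x) ∧
      letterVal w v s a b t x = assemble w v s a b t (secL w v false x) (secL w v true x) := by
  have ha := h.a_last
  have hsw := h.cj_lastB_eq hlast
  have hn1 : ∀ (y z : Γ), cj (y * z⁻¹) (t * b) * cj z (t * b) = cj (cj y t) b := by
    intro y z
    rw [← cj_mul, inv_mul_cancel_right, cj_cj]
  rcases x with (_ | j) | (_ | i)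
  · exact absurd rfl hx0
  · have hj : j ≠ w.length - 1 := by simp only [Letter.Valid] at hx; omega
    cases hy : w.getD j false <;>
      simp [-List.getD_eq_getElem?_getD, secL, hy, assemble, wordVal_nil, wordVal_singleton, dihVal, hj,
        letterVal, chain, dpow, cj_one_left, cj_one_right, cj_cj]
  · set x := v.getD (v.length - 1) false with hxd
    cases hx : x
    · simp only [secL, ← hxd, hx, if_true, Bool.true_eq_false, if_false, wordVal_singleton,
        assemble]
      refine ⟨by simp [dihVal], ?_⟩
      rw [hx] at ha
      simp only [letterVal, dihVal]
      simp [dpow, cj_one_right] at ha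
      simp [ha, lastB, cj_one_left]
    · simp only [secL, ← hxd, hx, if_true, Bool.false_eq_true, if_false, wordVal_singleton,
        assemble]
      refine ⟨by simp [dihVal], ?_⟩
      rw [hx] at ha
      simp only [letterVal, dihVal]
      simp only [if_true]
      rw [lastB] at hsw
      rw [hsw, hn1, ha]
      simp [dpow, h.cj_b_b]
  · have hi : i ≠ v.length - 1 := by simp only [Letter.Valid] at hx; omega
    cases hy : v.getD i false <;>
      simp [-List.getD_eq_getElem?_getD, secL, hy, assemble, wordVal_nil, wordVal_singleton, dihVal, hi,
        letterVal, chain, aVal, dpow, cj_one_left, cj_one_right, cj_cj]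

/-- The value of a word can be recovered from its sections. -/
theorem Rels.ev_eq_assemble {W : List Letter} (hW : ∀ x ∈ W, x.Valid w v) :
    kp (sec w v true W) = kq (sec w v false W) ∧
      ev W * dpow b (par W) = assemble w v s a b t (sec w v false W) (sec w v true W) := by
  induction W with
  | nil => simp [sec, assemble, wordVal_nil, par, dpow, cj_one_left]
  | cons x W ih =>
    simp only [List.mem_cons, forall_eq_or_imp] at hW
    obtain ⟨ih1, ih2⟩ := ih hW.2
    have hval := valid_sec hw hv hW.2
    by_cases hx : x = .b 0
    · subst hx
      simp only [sec, secL, flips, decide_true, Bool.xor_true, Bool.not_true, Bool.not_false,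
        List.nil_append, par, Bool.true_xor]
      refine ⟨h.kp_eq_swap hlast ih1, ?_⟩
      rw [← h.assemble_swap hw hlast hs (hval _) (hval _) ih1, ← ih2, wordVal_cons]
      have hb : b⁻¹ = b := inv_eq_of_mul_eq_one_left h.b_sq
      cases par W
      · simp [dpow, letterVal, chain, cj, hb]
      · simp [dpow, letterVal, chain, cj, hb, mul_assoc, h.b_sq]
    · have hf : flips x = false := by simp [flips, hx]
      simp only [sec, hf, Bool.xor_false, par, Bool.false_xor]
      obtain ⟨hx1, hx2⟩ := h.assemble_secL hw hv hlast hW.1 hx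
      refine ⟨by rw [wordVal_append, wordVal_append, hx1, ih1], ?_⟩
      rw [h.assemble_append hw hlast hs (valid_secL hw hv hW.1 _) (hval _) hx1, ← ih2, ← hx2,
        wordVal_cons, mul_assoc]

omit hv hs in
theorem Rels.kp_eq_one (hv : 0 < v.length) (hkn : ¬ (w.length = 1 ∧ v.length = 1))
    {W : List Letter} (hW : IsTriv w v W) : kp W = 1 :=
  hW.prod_eq_one hw hv hlast hkn h.twistedA_mul_self h.lastB_mul_self
    (h.twistedA_mul_lastB_pow hlast)

theorem Rels.ev_eq_one_of_sec (hkn : ¬ (w.length = 1 ∧ v.length = 1)) {W : List Letter}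
    (hW : IsTriv w v W) (hsec : ∀ c, ev (sec w v c W) = 1) : ev W = 1 := by
  have h1 := (h.ev_eq_assemble hw hv hlast hs hW.valid).2
  rw [hW.par_eq, assemble, hsec, hsec, h.kp_eq_one hw hlast hv hkn (hW.sec hw hv true)] at h1
  simpa [dpow, cj_one_left] using h1

end Rels


/-! ### Periods of the kneading word -/

/-- The bi-infinite periodic continuation of a word. -/
def cyc (v : List Bool) (e : ℤ) : Bool := v.getD (e % v.length).toNat false

theorem cyc_natCast {i : ℕ} (hi : i < v.length) : cyc v i = v.getD i false := by
  have : ((i : ℤ) % v.length).toNat = i := by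
    rw [← Int.natCast_mod, Int.toNat_natCast, Nat.mod_eq_of_lt hi]
  rw [cyc, this]

theorem cyc_periodic (v : List Bool) : Function.Periodic (cyc v) v.length := fun e => by
  rw [cyc, cyc, Int.add_emod_right]

theorem cyc_add_int_mul (v : List Bool) (e f : ℤ) : cyc v (e + f * v.length) = cyc v e :=
  (cyc_periodic v).int_mul f e

theorem eq_flatten_replicate_take {g : ℕ} : ∀ {e : ℕ} {l : List Bool}, l.length = e * g →
    (∀ i, i + g < l.length → l.getD (i + g) false = l.getD i false) →
    l = (List.replicate e (l.take g)).flatten := by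
  intro e
  induction e with
  | zero =>
    intro l hl _
    rw [zero_mul] at hl
    simp [List.length_eq_zero_iff.1 hl]
  | succ e ih =>
    intro l hl hp
    have hlen : (l.drop g).length = e * g := by
      rw [List.length_drop, hl, Nat.succ_mul, Nat.add_sub_cancel]
    have hget : ∀ i, (l.drop g).getD i false = l.getD (i + g) false := fun i => by
      simp [List.getElem?_drop, Nat.add_comm]
    have h1 := ih hlen fun i hi => by
      rw [hget, hget]
      exact hp _ (by rw [hlen] at hi; rw [hl, Nat.succ_mul]; omega)
    have h2 : List.replicate e ((l.drop g).take g) = List.replicate e (l.take g) := by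
      rcases Nat.eq_zero_or_pos e with rfl | he
      · rfl
      · have hge : g ≤ e * g := Nat.le_mul_of_pos_left g he
        have hlt : ∀ i, i < g → i + g < l.length := fun i hi => by rw [hl, Nat.succ_mul]; omega
        congr 1
        refine List.ext_getElem (by simp [hl, Nat.succ_mul]; omega) fun i hi hi' => ?_
        have hig : i < g := by simp at hi'; omega
        have := hp i (hlt i hig)
        rw [List.getD_eq_getElem _ _ (hlt i hig),
          List.getD_eq_getElem _ _ (by have := hlt i hig; omega)] at this
        simpa [Nat.add_comm] using this
    rw [List.replicate_succ, List.flatten_cons, ← h2, ← h1, List.take_append_drop]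

theorem getD_flatten_replicate {z : List Bool} {d i : ℕ} (hi : i < d * z.length) :
    ((List.replicate d z).flatten).getD i false = z.getD (i % z.length) false := by
  induction d generalizing i with
  | zero => simp at hi
  | succ d ih =>
    rw [List.replicate_succ, List.flatten_cons]
    by_cases h : i < z.length
    · rw [List.getD_append _ _ _ _ h, Nat.mod_eq_of_lt h]
    · rw [List.getD_append_right _ _ _ _ (not_lt.1 h), ih (by rw [Nat.succ_mul] at hi; omega),
        ← Nat.mod_eq_sub_mod (not_lt.1 h)]

theorem cyc_eq_of_eq_flatten {d : ℕ} {z : List Bool} (hz : v = (List.replicate d z).flatten)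
    (hv : 0 < v.length) (e : ℤ) : cyc v e = z.getD (e % z.length).toNat false := by
  have hn : v.length = d * z.length := by rw [hz]; simp
  have hpos : (0 : ℤ) < v.length := by exact_mod_cast hv
  have h0 := Int.emod_nonneg e hpos.ne'
  have h1 := Int.emod_lt_of_pos e hpos
  have h2 : (e % v.length).toNat < d * z.length := by rw [← hn]; omega
  have h3 : (e % v.length).toNat % z.length = (e % z.length).toNat := by
    have : (((e % v.length).toNat % z.length : ℕ) : ℤ) = e % z.length := by
      rw [Int.natCast_mod, Int.toNat_of_nonneg h0]
      exact Int.emod_emod_of_dvd _ ⟨d, by rw [hn]; push_cast; ring⟩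
    rw [← this, Int.toNat_natCast]
  rw [cyc]
  generalize (e % v.length).toNat = N at *
  rw [hz, getD_flatten_replicate h2, h3]

/-- Every period of the kneading word is a multiple of the length of its primitive root. -/
theorem dvd_of_cyc_periodic (hv : 0 < v.length) {d : ℕ}
    (hd : IsGreatest {e : ℕ | ∃ z : List Bool, v = (List.replicate e z).flatten} d) {δ : ℤ}
    (hδ : Function.Periodic (cyc v) δ) : ((v.length / d : ℕ) : ℤ) ∣ δ := by
  obtain ⟨⟨z, hz⟩, hmax⟩ := hd
  have hn : v.length = d * z.length := by
    have := congrArg List.length hz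
    simpa using this
  have hd0 : 0 < d := Nat.pos_of_ne_zero (by rintro rfl; omega)
  have hz0 : 0 < z.length := Nat.pos_of_ne_zero (by intro h; rw [h] at hn; omega)
  rw [show v.length / d = z.length by rw [hn, Nat.mul_div_cancel_left _ hd0]]
  have hp : Function.Periodic (cyc v) (z.length : ℤ) := fun e => by
    rw [cyc_eq_of_eq_flatten hz hv, cyc_eq_of_eq_flatten hz hv, Int.add_emod_right]
  -- The gcd of two periods is a period. It divides |z|, so v is a power with exponent d·|z|/g, and
  -- maximality of d forces g = |z|.
  set g := Int.gcd z.length δ with hg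
  have hgp : Function.Periodic (cyc v) (g : ℤ) := by
    rw [hg, Int.gcd_eq_gcd_ab, mul_comm _ (Int.gcdA _ _), mul_comm _ (Int.gcdB _ _)]
    exact (hp.int_mul _).add_period (hδ.int_mul _)
  obtain ⟨c, hc⟩ : g ∣ z.length := by
    have := Int.gcd_dvd_left (z.length : ℤ) δ
    exact_mod_cast this
  have hle : d * c ≤ d := by
    refine hmax ⟨v.take g, eq_flatten_replicate_take ?_ fun i hi => ?_⟩
    · conv_lhs => rw [hn, hc]
      ring
    · have := hgp i
      rw [← cyc_natCast hi, ← cyc_natCast (show i < v.length by omega), ← this]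
      push_cast; rfl
  have hc1 : c = 1 := by
    have h1 : c ≤ 1 := Nat.le_of_mul_le_mul_left (by simpa using hle) hd0
    have h2 : c ≠ 0 := by rintro rfl; omega
    omega
  rw [hc, hc1, mul_one]
  exact Int.gcd_dvd_right _ _

/-! ### Paths along which a generator survives -/

/-- The generator `x` has a non-trivial section along the path `p`, generator by generator. -/
def Surv (w v : List Bool) : List Bool → Letter → Prop
  | [], _ => True
  | c :: p, x => ∃ x', secL w v c x = [x'] ∧ Surv w v p x'

/-- Each letter of the path lowers the index by one, and b_1 has no non-empty section. -/
theorem surv_b {p : List Bool} {j : ℕ} (h : Surv w v p (.b j)) : p.length ≤ j := by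
  induction p generalizing j with
  | nil => simp
  | cons c p ih =>
    obtain ⟨x', hx, hp⟩ := h
    cases j with
    | zero => simp [secL] at hx
    | succ j =>
      rw [secL] at hx
      split_ifs at hx
      obtain rfl := (List.cons.inj hx).1
      simpa using ih hp

/-- A surviving a descends cyclically through the a's, which forces the path to spell v backwards.
It can leave the cycle only from a_1 to b_k, and since the b's die out this happens only within the
last k letters. -/
theorem surv_a {p : List Bool} {i : ℕ} (hw : 0 < w.length) (hv : 0 < v.length) (hi : i < v.length)
    (h : Surv w v p (.a i)) {q : ℕ} (hq : q + w.length < p.length) :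
    p.getD q false = cyc v (i - 1 - q) := by
  induction p generalizing i q with
  | nil => simp at hq
  | cons c p ih =>
    obtain ⟨x', hx, hp⟩ := h
    obtain ⟨r, hr, hri, hc, rfl⟩ : ∃ r : ℕ, r < v.length ∧ (∃ e : ℤ, (r : ℤ) = i - 1 + e * v.length) ∧
        c = v.getD r false ∧ x' = .a r := by
      cases i with
      | zero =>
        rw [secL] at hx
        split_ifs at hx with hc
        · exact ⟨v.length - 1, by omega, ⟨1, by push_cast [Nat.cast_sub hv]; ring⟩, hc,
            (List.cons.inj hx).1.symm⟩
        · obtain rfl := (List.cons.inj hx).1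
          have := surv_b hp
          rw [List.length_cons] at hq
          omega
      | succ i =>
        rw [secL] at hx
        split_ifs at hx with hc
        exact ⟨i, by omega, ⟨0, by push_cast; ring⟩, hc, (List.cons.inj hx).1.symm⟩
    have hcyc : ∀ q : ℤ, cyc v (r - q) = cyc v (i - 1 - q) := fun q => by
      obtain ⟨e, he⟩ := hri
      rw [he, show (i : ℤ) - 1 + e * v.length - q = i - 1 - q + e * v.length by ring]
      exact cyc_add_int_mul v _ e
    cases q with
    | zero =>
      have := hcyc 0
      simp only [Int.sub_zero] at this
      rw [List.getD_cons_zero, hc, ← cyc_natCast hr, this]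
      simp
    | succ q =>
      rw [List.getD_cons_succ, ih hr hp (by simp at hq; omega)]
      have := hcyc (q + 1)
      push_cast
      rw [← this]
      congr 1; ring

/-- The first n letters of the path spell a full cycle of v backwards, once from each of the two
starting indices. -/
theorem cyc_periodic_of_surv {p : List Bool} {i i' : ℕ} (hw : 0 < w.length) (hv : 0 < v.length)
    (hi : i < v.length) (hi' : i' < v.length) (hp : p.length = v.length + w.length)
    (h : Surv w v p (.a i)) (h' : Surv w v p (.a i')) :
    Function.Periodic (cyc v) ((i' : ℤ) - i) := by
  have hpos : (0 : ℤ) < v.length := by exact_mod_cast hv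
  have key : ∀ q : ℕ, q < v.length → cyc v (i - 1 - q) = cyc v (i' - 1 - q) := fun q hq => by
    rw [← surv_a hw hv hi h (by omega), ← surv_a hw hv hi' h' (by omega)]
  intro e
  set m := ((i : ℤ) - 1 - e) % v.length with hm
  have h0 := Int.emod_nonneg ((i : ℤ) - 1 - e) hpos.ne'
  have h1 := Int.emod_lt_of_pos ((i : ℤ) - 1 - e) hpos
  have h2 := key m.toNat (by omega)
  rw [Int.toNat_of_nonneg h0] at h2
  obtain ⟨f, hf⟩ : ∃ f : ℤ, (i : ℤ) - 1 - m = e + f * v.length := by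
    refine ⟨((i : ℤ) - 1 - e) / v.length, ?_⟩
    have := Int.emod_add_mul_ediv ((i : ℤ) - 1 - e) v.length
    linear_combination -this
  have h3 : (i' : ℤ) - 1 - m = e + (i' - i) + f * v.length := by linear_combination hf
  rw [hf, h3] at h2
  rw [cyc_add_int_mul, cyc_add_int_mul] at h2
  exact h2.symm

theorem secL_length_le (c : Bool) (x : Letter) : (secL w v c x).length ≤ 1 := by
  rcases x with (_ | j) | (_ | i) <;> simp only [secL] <;> (try split_ifs) <;> simp

theorem sec_length_le (c : Bool) (W : List Letter) : (sec w v c W).length ≤ W.length := by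
  induction W generalizing c with
  | nil => simp [sec]
  | cons x W ih =>
    have h1 := secL_length_le (w := w) (v := v) c x
    have h2 := ih (xor c (flips x))
    simp only [sec, List.length_append, List.length_cons]
    omega

/-- No letter may be lost. In particular b_1 does not occur, so all sections are taken at the same
letter c. -/
theorem secL_of_sec_length_eq {c : Bool} {W : List Letter} (h : (sec w v c W).length = W.length) :
    ∀ x ∈ W, ∃ x' ∈ sec w v c W, secL w v c x = [x'] := by
  induction W generalizing c with
  | nil => simp
  | cons x W ih =>
    have h1 := secL_length_le (w := w) (v := v) c x
    have h2 := sec_length_le (w := w) (v := v) (xor c (flips x)) W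
    simp only [sec, List.length_append, List.length_cons] at h
    obtain ⟨x', hx'⟩ := List.length_eq_one_iff.1 (show (secL w v c x).length = 1 by omega)
    have hf : flips x = false := by
      by_contra hf
      have : x = .b 0 := by simpa [flips] using hf
      subst this
      simp [secL] at hx'
    have ih := ih (c := c) (by rw [hf, Bool.xor_false] at h h2; omega)
    intro y hy
    rw [sec, hf, Bool.xor_false]
    rcases List.mem_cons.1 hy with rfl | hy
    · exact ⟨x', by simp [hx'], hx'⟩
    · obtain ⟨y', hy', he⟩ := ih y hy
      exact ⟨y', by simp [hy'], he⟩

/-! ### Contraction -/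

theorem prod_eq_one_of_even_count {α D : Type*} [DecidableEq α] [Group D] {f : α → D} :
    ∀ (N : ℕ) {W : List α}, W.length = N → (∀ x ∈ W, f x * f x = 1) →
      (∀ x ∈ W, ∀ y ∈ W, Commute (f x) (f y)) → (∀ x, Even (W.count x)) →
      (W.map f).prod = 1 := by
  intro N
  induction N using Nat.strong_induction_on with
  | _ N ih =>
    intro W hN h1 h2 h3
    cases W with
    | nil => rfl
    | cons x V =>
      have hx : x ∈ V := by
        by_contra hx
        have := h3 x
        rw [List.count_cons_self, List.count_eq_zero_of_not_mem hx] at this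
        simp at this
      have hp : (x :: V).Perm (x :: x :: V.erase x) := (List.perm_cons_erase hx).cons x
      have hs : ∀ y ∈ V.erase x, y ∈ x :: V := fun y hy =>
        List.mem_cons_of_mem _ (List.mem_of_mem_erase hy)
      have hc : ((x :: V).map f).Pairwise Commute := by
        rw [List.pairwise_map]
        exact List.pairwise_of_forall_mem_list fun y hy z hz => h2 y hy z hz
      rw [(hp.map f).prod_eq' hc, List.map_cons, List.map_cons, List.prod_cons, List.prod_cons,
        ← mul_assoc, h1 x (by simp), one_mul]
      have hl := hp.length_eq
      refine ih (V.erase x).length (by simp at hl hN; omega) rfl (fun y hy => h1 y (hs y hy))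
        (fun y hy z hz => h2 y (hs y hy) z (hs z hz)) fun y => ?_
      have h4 := h3 y
      rw [hp.count_eq] at h4
      by_cases hxy : x = y
      · subst hxy
        rw [List.count_cons_self, List.count_cons_self] at h4
        rw [Nat.even_iff] at *
        omega
      · rwa [List.count_cons_of_ne hxy, List.count_cons_of_ne hxy] at h4

section Rels

variable {d : ℕ} {s : FreeGroup ℕ} {a b t : Γ}

local notation "ev" => wordVal (letterVal w v s a b t)

variable (h : Rels w v d s a b t) (hw : 0 < w.length) (hv : 0 < v.length)
  (hlast : w.getD (w.length - 1) false ≠ v.getD (v.length - 1) false)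
  (hkn : ¬ (w.length = 1 ∧ v.length = 1))
  (hs : s ∈ Subgroup.closure (FreeGroup.of '' twistGens w.length v.length))
  (hd : IsGreatest {e : ℕ | ∃ z : List Bool, v = (List.replicate e z).flatten} d)
include h hv hd

/-- Indices that differ by a multiple of n/d carry the same letter of v. So conjugation by t and one
common power of b moves a commuting pair to the next pair, starting from a relator. -/
theorem Rels.commute_aVal {i j : ℕ} (hi : i + j * (v.length / d) < v.length) :
    Commute (aVal w v s a b t i) (aVal w v s a b t (i + j * (v.length / d))) := by
  obtain ⟨⟨z, hz⟩, -⟩ := hd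
  have hn : v.length = d * z.length := by
    have := congrArg List.length hz
    simpa using this
  have hd0 : 0 < d := Nat.pos_of_ne_zero (by rintro rfl; omega)
  rw [show v.length / d = z.length by rw [hn, Nat.mul_div_cancel_left _ hd0]] at *
  induction i with
  | zero =>
    rw [zero_add] at hi ⊢
    rcases Nat.eq_zero_or_pos j with rfl | hj
    · rw [zero_mul]
    · have hjd : j < d := by
        rw [hn] at hi
        exact lt_of_mul_lt_mul_right hi (Nat.zero_le _)
      have := h.comm j hj hjd
      rwa [hn, Nat.mul_div_cancel_left _ hd0] at this
  | succ i ih =>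
    have ih := ih (by omega)
    have hget : ∀ i', i' < v.length → v.getD i' false = z.getD (i' % z.length) false := by
      intro i' hi'
      have h1 : v.getD i' false = ((List.replicate d z).flatten).getD i' false := by rw [← hz]
      rw [h1, getD_flatten_replicate (by omega)]
    have e : v.getD (i + j * z.length) false = v.getD i false := by
      rw [hget _ (by omega), hget _ (by omega), Nat.add_mul_mod_self_right]
    rw [show i + 1 + j * z.length = i + j * z.length + 1 by ring, aVal, aVal, chain, chain, e,
      commute_cj, commute_cj]
    exact ih

theorem Rels.commute_aVal_of_periodic {i i' : ℕ} (hi : i < v.length) (hi' : i' < v.length)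
    (hp : Function.Periodic (cyc v) ((i' : ℤ) - i)) :
    Commute (aVal w v s a b t i) (aVal w v s a b t i') := by
  wlog hii : i ≤ i' generalizing i i'
  · refine (this hi' hi ?_ (by omega)).symm
    have := hp.neg
    rwa [neg_sub] at this
  obtain ⟨e, he⟩ := dvd_of_cyc_periodic hv hd hp
  have he' : (v.length / d) ∣ i' - i := by
    rw [← Int.natCast_dvd_natCast, Nat.cast_sub hii]
    exact ⟨e, he⟩
  obtain ⟨j, hj⟩ := he'
  obtain rfl : i' = i + j * (v.length / d) := by rw [mul_comm]; omega
  exact h.commute_aVal hv hd hi'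

include hw hlast hkn hs

/-- The values of trivial words are trivial. -/
theorem Rels.ev_eq_one : ∀ (N : ℕ) {W : List Letter}, W.length = N → IsTriv w v W → ev W = 1 := by
  intro N
  induction N using Nat.strong_induction_on with
  | _ N ih =>
    -- If the value is not 1, some section has value different from 1, and by the induction
    -- hypothesis it has full length. Iteration gives paths of any length r along which all letters
    -- survive.
    have claim : ∀ r : ℕ, ∀ W : List Letter, W.length = N → IsTriv w v W →
        ev W = 1 ∨ ∃ p : List Bool, p.length = r ∧ ∀ x ∈ W, Surv w v p x := by
      intro r
      induction r with
      | zero => exact fun W _ _ => Or.inr ⟨[], rfl, fun _ _ => trivial⟩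
      | succ r ihr =>
        intro W hN hW
        by_cases hsec : ∀ c, ev (sec w v c W) = 1
        · exact Or.inl (h.ev_eq_one_of_sec hw hv hlast hs hkn hW hsec)
        · obtain ⟨c, hc⟩ := not_forall.1 hsec
          have hWc := hW.sec hw hv c
          have hlen : (sec w v c W).length = N := by
            by_contra hne
            have := sec_length_le (w := w) (v := v) c W
            exact hc (ih _ (by omega) rfl hWc)
          obtain ⟨p, hp, hps⟩ := (ihr _ hlen hWc).resolve_left hc
          refine Or.inr ⟨c :: p, by rw [List.length_cons, hp], fun x hx => ?_⟩
          obtain ⟨x', hx', he⟩ := secL_of_sec_length_eq (hlen.trans hN.symm) x hx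
          exact ⟨x', he, hps x' hx'⟩
    intro W hN hW
    rcases claim (v.length + w.length) W hN hW with h1 | ⟨p, hp, hps⟩
    · exact h1
    -- At depth n+k no b survives. The word then consists of a's, which commute pairwise by
    -- periodicity and occur with even multiplicity.
    · have ha : ∀ x ∈ W, ∃ i, i < v.length ∧ x = .a i := by
        intro x hx
        cases x with
        | b j =>
          have h1 := surv_b (hps _ hx)
          have h2 : j < w.length := hW.valid _ hx
          omega
        | a i => exact ⟨i, hW.valid _ hx, rfl⟩
      refine prod_eq_one_of_even_count W.length rfl (fun x _ => h.letterVal_mul_self x)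
        (fun x hx y hy => ?_) fun x => ?_
      · obtain ⟨i, hi, rfl⟩ := ha x hx
        obtain ⟨i', hi', rfl⟩ := ha y hy
        exact h.commute_aVal_of_periodic hv hd hi hi'
          (cyc_periodic_of_surv hw hv hi hi' hp (hps _ hx) (hps _ hy))
      · by_cases hx : x ∈ W
        · exact hW.even_count hw hv hlast (hW.valid x hx)
        · rw [List.count_eq_zero_of_not_mem hx]
          exact Even.zero

end Rels


/-! ### The relations in the HNN extension -/

/-- Congruent indices carry the same letter, so the sections at that letter have congruent indices
again. The case of a_1 fits in because |z| divides n, and its other coordinate b_k meets a trivial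
one. -/
theorem aAct_comm {d : ℕ} {z : List Bool} (hz : v = (List.replicate d z).flatten)
    (hv : 0 < v.length) (l : List Bool) : ∀ {i i' : ℕ}, i < v.length → i' < v.length →
      i ≡ i' [MOD z.length] → aAct w v i (aAct w v i' l) = aAct w v i' (aAct w v i l) := by
  have hn : v.length = d * z.length := by
    have := congrArg List.length hz
    simpa using this
  have hget : ∀ {i i'}, i < v.length → i' < v.length → i ≡ i' [MOD z.length] →
      v.getD i false = v.getD i' false := by
    have key : ∀ i, i < v.length → v.getD i false = z.getD (i % z.length) false := by
      intro i hi
      have h1 : v.getD i false = ((List.replicate d z).flatten).getD i false := by rw [← hz]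
      rw [h1, getD_flatten_replicate (by omega)]
    intro i i' hi hi' h
    rw [key i hi, key i' hi', h]
  have hzero : ∀ {i}, 0 ≡ i + 1 [MOD z.length] → v.length - 1 ≡ i [MOD z.length] := by
    intro i hi
    refine Nat.ModEq.add_right_cancel' 1 ?_
    rw [Nat.sub_add_cancel hv]
    refine Nat.ModEq.trans ?_ hi
    rw [hn]
    exact (Nat.modEq_zero_iff_dvd.2 (dvd_mul_left _ _))
  induction l with
  | nil => intro i i' _ _ _; cases i <;> cases i' <;> simp [aAct]
  | cons c r ih =>
    have mixed : ∀ {i}, i + 1 < v.length → 0 ≡ i + 1 [MOD z.length] →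
        aAct w v 0 (aAct w v (i + 1) (c :: r)) = aAct w v (i + 1) (aAct w v 0 (c :: r)) := by
      intro i hi h
      have e := hget (by omega) (by omega) (hzero h)
      have := ih (show v.length - 1 < v.length by omega) (by omega) (hzero h)
      simp only [aAct, ← e]
      split_ifs
      · rw [this]
      · rfl
    intro i i' hi hi' h
    cases i with
    | zero =>
      cases i' with
      | zero => rfl
      | succ i' => exact mixed hi' h
    | succ i =>
      cases i' with
      | zero => exact (mixed hi h.symm).symm
      | succ i' =>
        have h' := Nat.ModEq.add_right_cancel' 1 h
        have e := hget (by omega) (by omega) h'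
        have := ih (show i < v.length by omega) (show i' < v.length by omega) h'
        simp only [aAct, e]
        split_ifs
        · rw [this]
        · rfl

theorem genA_commute {d : ℕ} {z : List Bool} (hz : v = (List.replicate d z).flatten)
    {i i' : ℕ} (hi : i < v.length) (hi' : i' < v.length) (h : i ≡ i' [MOD z.length]) :
    Commute (genA w v i hi) (genA w v i' hi') := by
  refine Subtype.ext (TreeAut.ext fun l => ?_)
  exact aAct_comm hz (by omega) l hi' hi h.symm

/-! ### Conjugation by the stable letter. -/

section HNN

variable {φ : K w v →* K w v} {hφ : Function.Injective φ}

theorem hnn_cj_of {G : Type*} [Group G] {φ : G →* G} {hφ : Function.Injective φ} (g : G) :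
    cj (HNNExtension.of g : AscendingHNN φ hφ) HNNExtension.t = HNNExtension.of (φ g) := by
  have := HNNExtension.equiv_symm_eq_conj
    (φ := (MonoidHom.ofInjective hφ).symm.trans Subgroup.topEquiv.symm) ⟨g, Subgroup.mem_top g⟩
  exact this.symm

theorem hnn_cj_of_pow {G : Type*} [Group G] {φ : G →* G} {hφ : Function.Injective φ} (g : G)
    (i : ℕ) : cj (HNNExtension.of g : AscendingHNN φ hφ) (HNNExtension.t ^ i) =
      HNNExtension.of (φ^[i] g) := by
  induction i with
  | zero => simp [cj_one_right]
  | succ i ih => rw [pow_succ, ← cj_cj, ih, hnn_cj_of, Function.iterate_succ_apply']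

theorem hnn_polyPow {G : Type*} [Group G] {φ : G →* G} {hφ : Function.Injective φ} (g : G)
    (l : List Bool) : ∃ p : G, polyPow (HNNExtension.of g : AscendingHNN φ hφ) HNNExtension.t l =
      HNNExtension.of p := by
  induction l with
  | nil => exact ⟨1, by simp [polyPow]⟩
  | cons c l ih =>
    obtain ⟨p, hp⟩ := ih
    exact ⟨dpow g c * φ p, by rw [polyPow, hp, hnn_cj_of, map_mul, map_dpow]⟩

end HNN

/-! ### Homomorphisms that turn φ into conjugation by t. -/

section Shift

variable {hw : 0 < w.length} {hv : 0 < v.length} {s : FreeGroup ℕ} {φ : K w v →* K w v}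

theorem genB_mul_self {j : ℕ} (hj : j < w.length) : genB w v j hj * genB w v j hj = 1 :=
  genK_mul_self (x := .b j) hj

theorem genA_mul_self {i : ℕ} (hi : i < v.length) : genA w v i hi * genA w v i hi = 1 :=
  genK_mul_self (x := .a i) hi

theorem cj_dpow_eq_iff {G : Type*} [Group G] {b x y : G} (hb : b * b = 1) (c : Bool) :
    x = cj y (dpow b c) ↔ cj x (dpow b c) = y := by
  rw [cj_eq_iff, dpow_inv hb]

/-- A homomorphism from `K(w,v)` which turns `φ` into conjugation by `t` on the generators with
`φ(b_j) = b_{j+1}^{b_1^{y_j}}` and `φ(a_i) = a_{i+1}^{b_1^{x_i}}` sends the generators to the terms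
of the two chains. -/
theorem IsShift.map_genB (h : IsShift w v hw hv (FreeGroup.lift (bK w v) s) φ) {Γ : Type*} [Group Γ]
    (f : K w v →* Γ) {t : Γ} (hf : ∀ g, f (φ g) = cj (f g) t) {j : ℕ} (hj : j < w.length) :
    f (genB w v j hj) = chain w (f (genB w v 0 hw)) t (f (genB w v 0 hw)) j := by
  induction j with
  | zero => rfl
  | succ j ih =>
    have h1 := (cj_dpow_eq_iff (genB_mul_self hw) _).1 (h.b_succ j hj)
    rw [← h1, map_cj, map_dpow, hf, ih (by omega), chain]

theorem IsShift.map_genA (h : IsShift w v hw hv (FreeGroup.lift (bK w v) s) φ) {Γ : Type*} [Group Γ]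
    (f : K w v →* Γ) {t : Γ} (hf : ∀ g, f (φ g) = cj (f g) t) {i : ℕ} (hi : i < v.length) :
    f (genA w v i hi) = chain v (f (genB w v 0 hw)) t (f (genA w v 0 hv)) i := by
  induction i with
  | zero => rfl
  | succ i ih =>
    have h1 := (cj_dpow_eq_iff (genB_mul_self hw) _).1 (h.a_succ i hi)
    rw [← h1, map_cj, map_dpow, hf, ih (by omega), chain]

theorem IsShift.map_lift_bK (h : IsShift w v hw hv (FreeGroup.lift (bK w v) s) φ)
    (hs : s ∈ Subgroup.closure (FreeGroup.of '' twistGens w.length v.length)) {Γ : Type*} [Group Γ]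
    (f : K w v →* Γ) {t : Γ} (hf : ∀ g, f (φ g) = cj (f g) t) :
    f (FreeGroup.lift (bK w v) s) = sVal w s (f (genB w v 0 hw)) t := by
  refine eq_on_twist (f := f.comp (FreeGroup.lift (bK w v))) (fun j hj => ?_) hs
  have := twistGens_lt hw hj
  rw [MonoidHom.comp_apply, FreeGroup.lift_apply_of, FreeGroup.lift_apply_of,
    bK_of_lt (by omega), h.map_genB f hf]

theorem IsShift.map_uElt (h : IsShift w v hw hv (FreeGroup.lift (bK w v) s) φ)
    (hs : s ∈ Subgroup.closure (FreeGroup.of '' twistGens w.length v.length)) {Γ : Type*} [Group Γ]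
    (f : K w v →* Γ) {t : Γ} (hf : ∀ g, f (φ g) = cj (f g) t) :
    f (uElt w v hw (FreeGroup.lift (bK w v) s) φ) = uVal w s (f (genB w v 0 hw)) t := by
  rw [uElt, uVal, map_cj, map_dpow, hf, h.map_lift_bK hs f hf]

/-- The element `a_1^u`. -/
def aElt (w v : List Bool) (hw : 0 < w.length) (hv : 0 < v.length) (s : FreeGroup ℕ)
    (φ : K w v →* K w v) : K w v :=
  cj (genA w v 0 hv) (uElt w v hw (FreeGroup.lift (bK w v) s) φ)

theorem IsShift.map_genA_eq_aVal (h : IsShift w v hw hv (FreeGroup.lift (bK w v) s) φ)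
    (hs : s ∈ Subgroup.closure (FreeGroup.of '' twistGens w.length v.length)) {Γ : Type*} [Group Γ]
    (f : K w v →* Γ) {t : Γ} (hf : ∀ g, f (φ g) = cj (f g) t) {i : ℕ} (hi : i < v.length) :
    f (genA w v i hi) = aVal w v s (f (aElt w v hw hv s φ)) (f (genB w v 0 hw)) t i := by
  rw [aVal, h.map_genA f hf hi, aElt, map_cj, h.map_uElt hs f hf, cj_cj, mul_inv_cancel,
    cj_one_right]

variable {ψ : K w v →* TreeAut}

/-- The prescription for φ(b_k) makes a_1^u the conjugate of φ(b_k) by b_1^{y_k}, and the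
coordinates of φ(b_k) are known. -/
theorem isAt_aElt (h : IsShift w v hw hv (FreeGroup.lift (bK w v) s) φ)
    (hφ : ∀ g, IsAt (φ g) false g (ψ g))
    (hψ : ∀ x (hx : Letter.Valid w v x), ψ (genK hx) =
        if x = .a (v.length - 1) then treeB w (w.length - 1) else
        if x = .b (w.length - 1) then cj (treeA w v (v.length - 1)) (evalTree w s) else 1) :
    IsAt (aElt w v hw hv s φ) (w.getD (w.length - 1) false) (treeB w (w.length - 1))
      (cj (treeA w v (v.length - 1)) (evalTree w s)) := by
  have h1 := h.b_last
  rw [← cj_cj] at h1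
  have h2 := (cj_dpow_eq_iff (genB_mul_self hw) _).1 h1
  have h3 := hφ (genB w v (w.length - 1) (by omega))
  have h4 := hψ (.b (w.length - 1)) (show w.length - 1 < w.length by omega)
  rw [if_neg (by simp), if_pos rfl] at h4
  have h5 : ψ (genB w v (w.length - 1) (by omega)) =
      cj (treeA w v (v.length - 1)) (evalTree w s) := h4
  rw [h5] at h3
  rw [aElt, ← h2, coe_cj, coe_dpow]
  have h6 := h3.cj_dpow (w := w) (w.getD (w.length - 1) false)
  rw [Bool.false_xor] at h6
  exact h6

theorem aElt_mul_genB_sq {A B : K w v} (hB : B * B = 1) : (A * B) ^ 2 = A * cj A B := by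
  rw [sq, cj, inv_eq_of_mul_eq_one_left hB]
  simp only [mul_assoc]

/-- Elements whose images under `φ` are supported on one half of the tree commute with the
conjugates of each other by elements that move the first level. -/
theorem commute_shift {A : K w v} {c : Bool} {p q : TreeAut} (hA : IsAt A c p q)
    (hφ : ∀ g, IsAt (φ g) false g (ψ g)) {m : ℕ} {o g g' : K w v}
    (ho : o ∈ oddSet m A (genB w v 0 hw)) (hg : ψ g = 1) (hg' : ψ g' = 1) :
    Commute (φ g) (cj (φ g') o) := by
  obtain ⟨ε, -, l, -, rfl⟩ := ho
  set B := genB w v 0 hw with hB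
  have hA2 : IsAt ((A * cj A B : K w v) : TreeAut) c (p * q) (q * p) :=
    hA.mul (hA.cj_sigma (w := w))
  have h1 := hφ g
  have h2 := hφ g'
  rw [hg] at h1
  rw [hg'] at h2
  -- Here o is a power of A, then b_1, then a power of (A·b_1)² = A·A^{b_1}. Only the middle factor
  -- moves the first level, so the support changes sides exactly once.
  have ex : ∃ r, IsAt (cj (φ g') (A ^ ε * B * (A * B) ^ (2 * l)) : K w v) true r 1 := by
    rw [pow_mul, aElt_mul_genB_sq (genB_mul_self hw), ← cj_cj, ← cj_cj, coe_cj, coe_cj, coe_cj]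
    have hAε := hA.pow ε
    have hAl := hA2.pow l
    cases c
    · have h3 := ((h2.cj hAε).cj_sigma (w := w)).cj hAl
      rw [cj_one_left, cj_one_left] at h3
      exact ⟨_, h3.flip⟩
    · have h3 := ((h2.flip.cj hAε).cj_sigma (w := w)).cj hAl
      rw [cj_one_left, cj_one_left] at h3
      exact ⟨_, h3⟩
  obtain ⟨r, hr⟩ := ex
  have h4 := hr.of_ne (c' := false) (by decide)
  have h5 := h1.mul h4
  have h6 := h4.mul h1
  rw [one_mul, mul_one] at h5 h6
  exact Subtype.ext (h5.eq h6)

end Shift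


/-! ### The relations hold in the HNN extension -/

section RelsHNN

variable {hw : 0 < w.length} {hv : 0 < v.length} {s : FreeGroup ℕ} {φ : K w v →* K w v}
  {hφ : Function.Injective φ} {ψ : K w v →* TreeAut} {d : ℕ}

theorem oddSet_map {Γ Δ : Type*} [Group Γ] [Group Δ] (f : Γ →* Δ) {m : ℕ} {a b : Γ} {o : Δ}
    (ho : o ∈ oddSet m (f a) (f b)) : ∃ o' ∈ oddSet m a b, o = f o' := by
  obtain ⟨ε, hε, l, hl, rfl⟩ := ho
  exact ⟨_, ⟨ε, hε, l, hl, rfl⟩, by simp⟩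

/-- The computation takes place in the HNN extension, where φ is conjugation by t and
`cj_pow_eq_chain` applies. It descends because the base group embeds. -/
theorem IsShift.iterate_genB (hφ : Function.Injective φ)
    (h : IsShift w v hw hv (FreeGroup.lift (bK w v) s) φ) {j : ℕ}
    (hj : j < w.length) : ∃ p, φ^[j] (genB w v 0 hw) = cj (genB w v j hj) p := by
  obtain ⟨p, hp⟩ := hnn_polyPow (hφ := hφ) (genB w v 0 hw) (w.take j).reverse
  refine ⟨p, HNNExtension.of_injective (φ := (MonoidHom.ofInjective hφ).symm.trans
    Subgroup.topEquiv.symm) ?_⟩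
  rw [← hnn_cj_of_pow, cj_pow_eq_chain (b := HNNExtension.of (genB w v 0 hw)) _ _ _ hj.le, hp,
    ← h.map_genB HNNExtension.of (fun g => (hnn_cj_of g).symm) hj, map_cj]
  rw [← map_mul, genB_mul_self, map_one]

theorem IsShift.iterate_genA (hφ : Function.Injective φ)
    (h : IsShift w v hw hv (FreeGroup.lift (bK w v) s) φ) {i : ℕ}
    (hi : i < v.length) : ∃ p, φ^[i] (genA w v 0 hv) = cj (genA w v i hi) p := by
  obtain ⟨p, hp⟩ := hnn_polyPow (hφ := hφ) (genB w v 0 hw) (v.take i).reverse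
  refine ⟨p, HNNExtension.of_injective (φ := (MonoidHom.ofInjective hφ).symm.trans
    Subgroup.topEquiv.symm) ?_⟩
  rw [← hnn_cj_of_pow, cj_pow_eq_chain (b := HNNExtension.of (genB w v 0 hw)) _ _ _ hi.le, hp,
    ← h.map_genA HNNExtension.of (fun g => (hnn_cj_of g).symm) hi, map_cj]
  rw [← map_mul, genB_mul_self, map_one]

theorem IsShift.snd_iterate_genB (hφ : Function.Injective φ)
    (h : IsShift w v hw hv (FreeGroup.lift (bK w v) s) φ)
    (hψ : ∀ (x : Letter) (hx : x.Valid w v), ψ (genK hx) =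
      if x = .a (v.length - 1) then treeB w (w.length - 1)
      else if x = .b (w.length - 1) then cj (treeA w v (v.length - 1)) (evalTree w s) else 1)
    {j : ℕ} (hj : j + 1 < w.length) : ψ (φ^[j] (genB w v 0 hw)) = 1 := by
  have hj' : j < w.length := by omega
  obtain ⟨p, hp⟩ := h.iterate_genB hφ hj'
  have h1 : ψ (genB w v j hj') = 1 := by
    refine (hψ (.b j) hj').trans ?_
    rw [if_neg (by simp), if_neg (by simp; omega)]
  rw [hp, map_cj, h1, cj_one_left]

theorem IsShift.snd_iterate_aElt (hφ : Function.Injective φ)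
    (h : IsShift w v hw hv (FreeGroup.lift (bK w v) s) φ)
    (hψ : ∀ (x : Letter) (hx : x.Valid w v), ψ (genK hx) =
      if x = .a (v.length - 1) then treeB w (w.length - 1)
      else if x = .b (w.length - 1) then cj (treeA w v (v.length - 1)) (evalTree w s) else 1)
    {i : ℕ} (hi : i + 1 < v.length) : ψ (φ^[i] (aElt w v hw hv s φ)) = 1 := by
  have hi' : i < v.length := by omega
  obtain ⟨p, hp⟩ := h.iterate_genA hφ hi'
  have h1 : ψ (genA w v i hi') = 1 := by
    refine (hψ (.a i) hi').trans ?_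
    rw [if_neg (by simp; omega), if_neg (by simp)]
  have h2 : φ^[i] (aElt w v hw hv s φ) =
      cj (φ^[i] (genA w v 0 hv)) (φ^[i] (uElt w v hw (FreeGroup.lift (bK w v) s) φ)) := by
    simp only [aElt, cj, iterate_map_mul, iterate_map_inv]
  rw [h2, hp, map_cj, map_cj, h1, cj_one_left, cj_one_left]

/-- The square of a_1^u b_1 has the coordinates b_k a_n^s and a_n^s b_k, whose 2^m-th powers vanish
by the choice of s. -/
theorem IsTwist.aElt_mul_genB_pow (hs : IsTwist w v s)
    (hA : IsAt (aElt w v hw hv s φ : K w v) (w.getD (w.length - 1) false) (treeB w (w.length - 1))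
      (cj (treeA w v (v.length - 1)) (evalTree w s))) :
    (aElt w v hw hv s φ * genB w v 0 hw) ^ 2 ^ (mExp w.length v.length + 1) = 1 := by
  rw [pow_succ', pow_mul, aElt_mul_genB_sq (genB_mul_self _)]
  apply Subtype.ext
  have h1 := (hA.mul (hA.cj_sigma (w := w))).pow (2 ^ mExp w.length v.length)
  rw [hs.2] at h1
  have h2 : treeB w (w.length - 1) * cj (treeA w v (v.length - 1)) (evalTree w s) =
      treeB w (w.length - 1) * (cj (treeA w v (v.length - 1)) (evalTree w s) *
        treeB w (w.length - 1)) * (treeB w (w.length - 1))⁻¹ := by group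
  rw [h2, conj_pow, hs.2, mul_one, mul_inv_cancel] at h1
  exact h1.eq_one

theorem rels_hnn (hs : IsTwist w v s) {z : List Bool} (hz : v = (List.replicate d z).flatten)
    (h : IsShift w v hw hv (FreeGroup.lift (bK w v) s) φ)
    (hψ0 : ∀ g, IsAt (φ g : K w v) false g (ψ g))
    (hψ : ∀ (x : Letter) (hx : x.Valid w v), ψ (genK hx) =
      if x = .a (v.length - 1) then treeB w (w.length - 1)
      else if x = .b (w.length - 1) then cj (treeA w v (v.length - 1)) (evalTree w s) else 1) :
    Rels w v d s (HNNExtension.of (aElt w v hw hv s φ) : AscendingHNN φ hφ)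
      (HNNExtension.of (genB w v 0 hw)) HNNExtension.t := by
  have hA := isAt_aElt h hψ0 hψ
  have hf : ∀ g, (HNNExtension.of (φ g) : AscendingHNN φ hφ) =
    cj (HNNExtension.of g) HNNExtension.t := fun g => (hnn_cj_of g).symm
  have haV : ∀ {i : ℕ} (hi : i < v.length), aVal w v s
      (HNNExtension.of (aElt w v hw hv s φ) : AscendingHNN φ hφ)
      (HNNExtension.of (genB w v 0 hw)) HNNExtension.t i = HNNExtension.of (genA w v i hi) :=
    fun hi => (h.map_genA_eq_aVal hs.1 HNNExtension.of hf hi).symm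
  -- The exponents of t in the commutator relators are positive, so each entry contains an outermost
  -- φ, as `commute_shift` requires.
  have key : ∀ {i j : ℕ} {g g' : K w v} {o : AscendingHNN φ hφ},
      o ∈ oddSet (mExp w.length v.length)
        (HNNExtension.of (aElt w v hw hv s φ) : AscendingHNN φ hφ)
        (HNNExtension.of (genB w v 0 hw)) → ψ (φ^[i] g) = 1 → ψ (φ^[j] g') = 1 →
      Commute (cj (HNNExtension.of g : AscendingHNN φ hφ) (HNNExtension.t ^ (i + 1)))
        (cj (HNNExtension.of g' : AscendingHNN φ hφ) (HNNExtension.t ^ (j + 1) * o)) := by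
    intro i j g g' o ho hg hg'
    obtain ⟨o', ho', rfl⟩ := oddSet_map HNNExtension.of ho
    rw [← cj_cj, hnn_cj_of_pow, hnn_cj_of_pow, ← map_cj, Function.iterate_succ_apply',
      Function.iterate_succ_apply']
    exact (commute_shift hA hψ0 ho' hg hg').map HNNExtension.of
  have hB1 {j : ℕ} (hj : j + 1 < w.length) := h.snd_iterate_genB hφ hψ hj
  have hA1 {i : ℕ} (hi : i + 1 < v.length) := h.snd_iterate_aElt hφ hψ hi
  refine ⟨?_, ?_, ?_, ?_, ?_, ?_, ?_, ?_, ?_⟩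
  · rw [← map_mul, aElt, cj_mul_self (genA_mul_self _), map_one]
  · rw [← map_mul, genB_mul_self, map_one]
  · rw [← map_mul, ← map_pow, hs.aElt_mul_genB_pow hA, map_one]
  · rw [← h.map_genB HNNExtension.of hf (by omega), ← hf, h.b_last, ← cj_cj, map_cj, map_dpow]
    rfl
  · rw [haV (by omega), haV hv, ← hf, h.a_last, map_cj, map_dpow]
  · intro j hj hjd
    have hn : v.length = d * z.length := by
      conv_lhs => rw [hz]
      simp
    have hd : 0 < d := by omega
    have hz0 : 0 < z.length := Nat.pos_of_ne_zero fun h0 => by rw [h0] at hn; omega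
    have hq : v.length / d = z.length := by rw [hn, Nat.mul_div_cancel_left _ hd]
    rw [hq]
    have hlt : j * z.length < v.length := by rw [hn]; exact Nat.mul_lt_mul_of_pos_right hjd hz0
    rw [haV hv, haV hlt]
    exact (genA_commute hz hv hlt (by simp [Nat.ModEq])).map HNNExtension.of
  · rintro (_ | i) (_ | j) o ho hi hi' hj hj' <;> try omega
    exact key ho (hB1 hi') (hB1 hj')
  · rintro (_ | i) (_ | j) o ho hi hi' hj hj' <;> try omega
    exact key ho (hA1 hi') (hB1 hj')
  · rintro (_ | i) (_ | j) o ho hi hi' hj hj' <;> try omega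
    exact key ho (hA1 hi') (hA1 hj')

end RelsHNN


/-! ### Homomorphisms from `K(w,v)` to groups that satisfy the relations -/

section Realization

variable {d : ℕ} {s : FreeGroup ℕ} {a b t : Γ}

theorem chain_succ_cj {l : List Bool} {g : Γ} (hb : b * b = 1) (j : ℕ) :
    cj (chain l b t g (j + 1)) (dpow b (l.getD j false)) = cj (chain l b t g j) t := by
  change cj (cj (cj (chain l b t g j) t) (dpow b (l.getD j false))) _ = _
  rw [cj_cj, dpow_mul_self hb, cj_one_right]

theorem map_uVal {Δ : Type*} [Group Δ] (f : Γ →* Δ) (w : List Bool) (s : FreeGroup ℕ) (b t : Γ) :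
    f (uVal w s b t) = uVal w s (f b) (f t) := by
  have h : f.comp (FreeGroup.lift (chain w b t b)) =
      FreeGroup.lift (chain w (f b) (f t) (f b)) := by
    ext j
    simp [map_chain]
  rw [uVal, map_cj, map_cj, map_dpow]
  exact congrArg (fun x => cj (cj x _) _) (DFunLike.congr_fun h s)

theorem Rels.exists_hom (h : Rels w v d s a b t) (hw : 0 < w.length) (hv : 0 < v.length)
    (hlast : w.getD (w.length - 1) false ≠ v.getD (v.length - 1) false)
    (hkn : ¬ (w.length = 1 ∧ v.length = 1))
    (hs : s ∈ Subgroup.closure (FreeGroup.of '' twistGens w.length v.length))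
    (hd : IsGreatest {e : ℕ | ∃ z : List Bool, v = (List.replicate e z).flatten} d) :
    ∃ ι : K w v →* Γ, ∀ (x : Letter) (hx : x.Valid w v),
      ι (genK hx) = letterVal w v s a b t x :=
  Kneading.exists_hom _ (fun x _ => h.letterVal_mul_self x)
    (fun _ hW => h.ev_eq_one hw hv hlast hkn hs hd _ rfl hW)

variable {hw : 0 < w.length} {hv : 0 < v.length} {φ : K w v →* K w v} {ι : K w v →* Γ}

theorem Rels.map_shift (h : Rels w v d s a b t)
    (hs : s ∈ Subgroup.closure (FreeGroup.of '' twistGens w.length v.length))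
    (hφ : IsShift w v hw hv (FreeGroup.lift (bK w v) s) φ)
    (hι : ∀ (x : Letter) (hx : x.Valid w v), ι (genK hx) = letterVal w v s a b t x) (g : K w v) :
    ι (φ g) = cj (ι g) t := by
  have hB {j : ℕ} (hj : j < w.length) : ι (genB w v j hj) = chain w b t b j := hι (.b j) hj
  have hA {i : ℕ} (hi : i < v.length) : ι (genA w v i hi) = aVal w v s a b t i := hι (.a i) hi
  have hB0 : ι (genB w v 0 hw) = b := hB hw
  have hbs {j : ℕ} (hj : j + 1 < w.length) :
      ι (φ (genB w v j (by omega))) = cj (chain w b t b j) t := by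
    rw [hφ.b_succ j hj, map_cj, map_dpow, hB, hB0, chain_succ_cj h.b_sq]
  have hc (x : Γ) : (MulAut.conj t⁻¹).toMonoidHom x = cj x t := by simp [cj]
  -- The value of u is needed before φ(b_k) can be treated. It depends only on φ(b_j) with j < k.
  have hS : ι (φ (FreeGroup.lift (bK w v) s)) = cj (sVal w s b t) t := by
    rw [← hc]
    refine eq_on_twist (f := (ι.comp φ).comp (FreeGroup.lift (bK w v)))
      (g := (MulAut.conj t⁻¹).toMonoidHom.comp (FreeGroup.lift (chain w b t b)))
      (fun j hj => ?_) hs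
    have hj' := twistGens_lt hw hj
    simp only [MonoidHom.comp_apply, FreeGroup.lift_apply_of]
    rw [bK_of_lt (by omega), hbs hj', hc]
  have hu : ι (uElt w v hw (FreeGroup.lift (bK w v) s) φ) = uVal w s b t := by
    rw [uElt, map_cj, map_dpow, hS, hB0, uVal]
  have hfg : ι.comp φ = (MulAut.conj t⁻¹).toMonoidHom.comp ι := by
    refine hom_ext_genK fun x hx => ?_
    rw [MonoidHom.comp_apply, MonoidHom.comp_apply, hc]
    match x, hx with
    | .b j, hj =>
      replace hj : j < w.length := hj
      change ι (φ (genB w v j hj)) = cj (ι (genB w v j hj)) t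
      rw [hB]
      obtain hj' | rfl : j + 1 < w.length ∨ j = w.length - 1 := by omega
      · exact hbs hj'
      · rw [hφ.b_last, map_cj, map_mul, hu, hA, map_dpow, hB0, h.b_last]
        change cj (cj a (uVal w s b t)⁻¹) _ = _
        rw [cj_cj, inv_mul_cancel_left]
    | .a i, hi =>
      replace hi : i < v.length := hi
      change ι (φ (genA w v i hi)) = cj (ι (genA w v i hi)) t
      rw [hA]
      obtain hi' | rfl : i + 1 < v.length ∨ i = v.length - 1 := by omega
      · rw [hφ.a_succ i hi', map_cj, map_dpow, hA, hB0]
        exact chain_succ_cj h.b_sq i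
      · rw [hφ.a_last, map_cj, map_dpow, hA, hB0, h.a_last]
  exact (DFunLike.congr_fun hfg g).trans (hc _)

theorem map_aElt_of_shift (hφ : IsShift w v hw hv (FreeGroup.lift (bK w v) s) φ)
    (hs : s ∈ Subgroup.closure (FreeGroup.of '' twistGens w.length v.length))
    (hι : ∀ (x : Letter) (hx : x.Valid w v), ι (genK hx) = letterVal w v s a b t x)
    (hιφ : ∀ g, ι (φ g) = cj (ι g) t) : ι (aElt w v hw hv s φ) = a := by
  have hB0 : ι (genB w v 0 hw) = b := hι (.b 0) hw
  rw [aElt, map_cj, hφ.map_uElt hs ι hιφ, hB0, show ι (genA w v 0 hv) = _ from hι (.a 0) hv]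
  change cj (cj a (uVal w s b t)⁻¹) _ = _
  rw [cj_cj, inv_mul_cancel, cj_one_right]

theorem iterate_shift (hιφ : ∀ g, ι (φ g) = cj (ι g) t) (g : K w v) (i : ℕ) :
    ι (φ^[i] g) = cj (ι g) (t ^ i) := by
  induction i with
  | zero => rw [pow_zero, cj_one_right]; rfl
  | succ i ih => rw [Function.iterate_succ_apply', hιφ, ih, cj_cj, pow_succ]

/-- Solving the chain formulas expresses the values of the generators by conjugates under powers of
t. The exponents stay inside the subgroup by `Rels.polyPow_mem` and `Rels.cj_uVal_mem`. Conversely,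
a^{t^i} and b^{t^j} are the images of iterates of φ. -/
theorem Rels.range_eq (h : Rels w v d s a b t) (hw : 0 < w.length)
    (hs : s ∈ Subgroup.closure (FreeGroup.of '' twistGens w.length v.length))
    (hι : ∀ (x : Letter) (hx : x.Valid w v), ι (genK hx) = letterVal w v s a b t x)
    (hιφ : ∀ g, ι (φ g) = cj (ι g) t) {A B : K w v} (hA : ι A = a) (hB : ι B = b) :
    ι.range = Subgroup.closure ({g | ∃ i < v.length, g = cj a (t ^ i)} ∪
      {g | ∃ j < w.length, g = cj b (t ^ j)}) := by
  apply le_antisymm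
  · set S := Subgroup.closure ({g | ∃ i < v.length, g = cj a (t ^ i)} ∪
      {g | ∃ j < w.length, g = cj b (t ^ j)}) with hS
    have ha : ∀ i < v.length, cj a (t ^ i) ∈ S :=
      fun i hi => Subgroup.subset_closure (Or.inl ⟨i, hi, rfl⟩)
    have hb : ∀ j < w.length, cj b (t ^ j) ∈ S :=
      fun j hj => Subgroup.subset_closure (Or.inr ⟨j, hj, rfl⟩)
    have hp {l : List Bool} (hl : l.length ≤ w.length + v.length) : polyPow b t l ∈ S :=
      h.polyPow_mem hw hb ha hl
    rw [MonoidHom.range_eq_map, ← closure_genK, MonoidHom.map_closure, Subgroup.closure_le]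
    rintro _ ⟨_, ⟨x, hx, rfl⟩, rfl⟩
    rw [hι]
    match x, hx with
    | .b j, hj =>
      have hj : j < w.length := hj
      change chain w b t b j ∈ S
      rw [h.chain_b_eq hj.le]
      exact cj_mem (hb j hj) (inv_mem (hp (by simp)))
    | .a i, hi =>
      have hi : i < v.length := hi
      change aVal w v s a b t i ∈ S
      rw [h.aVal_eq hi.le]
      exact cj_mem (cj_mem (ha i hi) (inv_mem (h.cj_uVal_mem hw hs hb ha hi.le)))
        (inv_mem (hp (by simp)))
  · rw [Subgroup.closure_le]
    rintro _ (⟨i, -, rfl⟩ | ⟨j, -, rfl⟩)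
    · exact ⟨φ^[i] A, by rw [iterate_shift hιφ, hA]⟩
    · exact ⟨φ^[j] B, by rw [iterate_shift hιφ, hB]⟩

end Realization

/-! ### The presented group -/

section Presentation

variable (w v : List Bool) (d : ℕ) (s : FreeGroup ℕ)

theorem rels_presented {w v : List Bool} (hw : 0 < w.length) (hv : 0 < v.length) {d : ℕ}
    {z : List Bool} (hz : v = (List.replicate d z).flatten) (s : FreeGroup ℕ) :
    Rels w v d s (pa w v d s) (pb w v d s) (pt w v d s) := by
  rw [rels_iff hw hv hz]
  intro r hr
  have : FreeGroup.lift (genVal (pa w v d s) (pb w v d s) (pt w v d s)) =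
      PresentedGroup.mk (relators w v d s) := by
    ext x
    cases x <;> rw [FreeGroup.lift_apply_of] <;> rfl
  rw [this]
  exact PresentedGroup.one_of_mem hr

instance : Finite Gen :=
  Finite.of_injective (fun x : Gen => match x with | .a => (0 : Fin 3) | .b => 1 | .t => 2)
    (by rintro (_ | _ | _) (_ | _ | _) <;> simp)

theorem finite_oddWords (m : ℕ) : (oddWords m).Finite := by
  refine (((Set.finite_Iic 1).prod (Set.finite_Iic (2 ^ m))).image
    (fun p : ℕ × ℕ => fa ^ p.1 * fb * (fa * fb) ^ (2 * p.2))).subset ?_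
  rintro _ ⟨ε, hε, l, hl, rfl⟩
  exact ⟨(ε, l), ⟨hε, hl⟩, rfl⟩

theorem finite_setOf_word {D : Type*} {k n m : ℕ} (F : ℕ → ℕ → FreeGroup Gen → D) :
    {r | ∃ i j, ∃ o ∈ oddWords m, 1 ≤ i ∧ i < k ∧ 1 ≤ j ∧ j < n ∧ r = F i j o}.Finite := by
  refine (((Set.finite_Iio k).prod ((Set.finite_Iio n).prod (finite_oddWords m))).image
    (fun p => F p.1 p.2.1 p.2.2)).subset ?_
  rintro _ ⟨i, j, o, ho, -, hi, -, hj, rfl⟩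
  exact ⟨(i, j, o), ⟨hi, hj, ho⟩, rfl⟩

theorem finite_relators : (relators w v d s).Finite := by
  refine ((((Set.Finite.union ?_ ?_).union (finite_setOf_word _)).union
    (finite_setOf_word _)).union (finite_setOf_word _))
  · simp
  · refine ((Set.finite_Iio d).image fun j =>
      cm (cj fa ((uWord w s)⁻¹ * bpTrunc v (j * (v.length / d))))
        (cj fa ((uWord w s)⁻¹ * ft ^ (j * (v.length / d))))).subset ?_
    rintro _ ⟨j, -, hj, rfl⟩
    exact ⟨j, hj, rfl⟩

theorem isFinitelyPresented_FPGroup : Group.IsFinitelyPresented (FPGroup w v d s) := by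
  have := (finite_relators w v d s).to_subtype
  infer_instance

theorem closure_pb_pt {w v : List Bool} {d : ℕ} {s : FreeGroup ℕ} (hw : 0 < w.length)
    (h : Rels w v d s (pa w v d s) (pb w v d s) (pt w v d s)) :
    Subgroup.closure {pb w v d s, pt w v d s} = ⊤ := by
  set S := Subgroup.closure {pb w v d s, pt w v d s}
  have hb : pb w v d s ∈ S := Subgroup.subset_closure (by simp)
  have ht : pt w v d s ∈ S := Subgroup.subset_closure (by simp)
  have hp : ∀ l, polyPow (pb w v d s) (pt w v d s) l ∈ S := by
    intro l
    induction l with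
    | nil => exact one_mem _
    | cons c l ih => exact mul_mem (dpow_mem hb c) (cj_mem ih ht)
  have ha : pa w v d s ∈ S := by
    rw [cj_eq_iff.1 (h.cj_pow_length_b hw).symm]
    exact cj_mem (cj_mem hb (pow_mem ht _)) (inv_mem (hp _))
  rw [eq_top_iff, ← PresentedGroup.closure_range_of, Subgroup.closure_le]
  rintro _ ⟨_ | _ | _, rfl⟩
  exacts [ha, hb, ht]

end Presentation

/-! ### The isomorphism with the HNN extension. -/

section Equiv

variable {hw : 0 < w.length} {hv : 0 < v.length} {d : ℕ} {s : FreeGroup ℕ} {φ : K w v →* K w v}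
  {ι : K w v →* FPGroup w v d s}

/-- The relations in the HNN extension give a map from the presented group, and the intertwining
property of ι gives a map back. They are mutually inverse on generators. -/
theorem exists_mulEquiv_hnn (hφi : Function.Injective φ)
    (hs : s ∈ Subgroup.closure (FreeGroup.of '' twistGens w.length v.length))
    {z : List Bool} (hz : v = (List.replicate d z).flatten)
    (hφ : IsShift w v hw hv (FreeGroup.lift (bK w v) s) φ)
    (hR : Rels w v d s (HNNExtension.of (aElt w v hw hv s φ) : AscendingHNN φ hφi)
      (HNNExtension.of (genB w v 0 hw)) HNNExtension.t)
    (hι : ∀ (x : Letter) (hx : x.Valid w v),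
      ι (genK hx) = letterVal w v s (pa w v d s) (pb w v d s) (pt w v d s) x)
    (hιφ : ∀ g, ι (φ g) = cj (ι g) (pt w v d s)) :
    ∃ Θ : FPGroup w v d s ≃* AscendingHNN φ hφi,
      Θ (pt w v d s) = HNNExtension.t ∧ ∀ g, Θ (ι g) = HNNExtension.of g := by
  let F : FPGroup w v d s →* AscendingHNN φ hφi :=
    PresentedGroup.toGroup ((rels_iff hw hv hz _ _ _ _).1 hR)
  have hFa : F (pa w v d s) = HNNExtension.of (aElt w v hw hv s φ) := PresentedGroup.toGroup.of _
  have hFb : F (pb w v d s) = HNNExtension.of (genB w v 0 hw) := PresentedGroup.toGroup.of _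
  have hFt : F (pt w v d s) = HNNExtension.t := PresentedGroup.toGroup.of _
  have hof : ∀ g, (HNNExtension.of (φ g) : AscendingHNN φ hφi) =
    cj (HNNExtension.of g) HNNExtension.t := fun g => (hnn_cj_of g).symm
  have hFι : F.comp ι = HNNExtension.of := by
    refine hom_ext_genK fun x hx => ?_
    rw [MonoidHom.comp_apply, hι]
    match x, hx with
    | .b j, hj =>
      replace hj : j < w.length := hj
      change F (chain _ _ _ _ _) = HNNExtension.of (genB w v j hj)
      rw [map_chain, hFb, hFt, ← hφ.map_genB _ hof hj]
    | .a i, hi =>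
      replace hi : i < v.length := hi
      change F (aVal _ _ _ _ _ _ _) = HNNExtension.of (genA w v i hi)
      rw [hφ.map_genA_eq_aVal hs _ hof, aVal, map_chain, hFb, hFt, map_cj, map_inv, hFa,
        map_uVal, hFb, hFt, aVal]
  let E : AscendingHNN φ hφi →* FPGroup w v d s := HNNExtension.lift ι (pt w v d s) (by
    rintro ⟨_, g, rfl⟩
    have hg : (MonoidHom.ofInjective hφi).symm ⟨φ g, g, rfl⟩ = g :=
      (MonoidHom.ofInjective hφi).symm_apply_apply g
    change pt w v d s * ι (φ g) = ι ((MonoidHom.ofInjective hφi).symm ⟨φ g, g, rfl⟩) * pt w v d s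
    rw [hg, hιφ, cj]
    group)
  have hEι (g : K w v) : E (HNNExtension.of g) = ι g := HNNExtension.lift_of ..
  have hEt : E HNNExtension.t = pt w v d s := HNNExtension.lift_t ..
  refine ⟨MonoidHom.toMulEquiv F E ?_ ?_, hFt, DFunLike.congr_fun hFι⟩
  · apply PresentedGroup.ext
    rintro (_ | _ | _)
    · change E (F (pa w v d s)) = pa w v d s
      rw [hFa, hEι, map_aElt_of_shift hφ hs hι hιφ]
    · change E (F (pb w v d s)) = pb w v d s
      rw [hFb, hEι]
      exact hι (.b 0) hw
    · change E (F (pt w v d s)) = pt w v d s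
      rw [hFt, hEt]
  · apply HNNExtension.hom_ext
    · ext g
      change F (E (HNNExtension.of g)) = HNNExtension.of g
      rw [hEι]
      exact DFunLike.congr_fun hFι g
    · change F (E HNNExtension.t) = HNNExtension.t
      rw [hEt, hFt]

end Equiv

end Kneading

theorem mainTheorem9 (w v : List Bool) (hw : 0 < w.length) (hv : 0 < v.length)
    (hlast : w.getD (w.length - 1) false ≠ v.getD (v.length - 1) false)
    (hkn : ¬ (w.length = 1 ∧ v.length = 1))
    (d : ℕ) (hd : IsGreatest {e : ℕ | ∃ z : List Bool, v = (List.replicate e z).flatten} d) :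
    (∃ s : FreeGroup ℕ, Kneading.IsTwist w v s) ∧
    ∀ s : FreeGroup ℕ, Kneading.IsTwist w v s →
      Group.IsFinitelyPresented (Kneading.FPGroup w v d s) ∧
      Subgroup.closure {Kneading.pb w v d s, Kneading.pt w v d s} = ⊤ ∧
      ∃ (σ : Kneading.K w v) (φ : Kneading.K w v →* Kneading.K w v)
        (hφ : Function.Injective φ)
        (ι : Kneading.K w v ≃* Kneading.H w v d s)
        (Θ : Kneading.FPGroup w v d s ≃* Kneading.AscendingHNN φ hφ),
        (σ : Kneading.TreeAut) = Kneading.evalTree w s ∧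
        Kneading.IsShift w v hw hv σ φ ∧
        (ι (Kneading.genB w v 0 hw) : Kneading.FPGroup w v d s) = Kneading.pb w v d s ∧
        (ι (Kneading.cj (Kneading.genA w v 0 hv) (Kneading.uElt w v hw σ φ)) :
          Kneading.FPGroup w v d s) = Kneading.pa w v d s ∧
        (∀ g : Kneading.K w v, (ι (φ g) : Kneading.FPGroup w v d s) =
          Kneading.cj (ι g : Kneading.FPGroup w v d s) (Kneading.pt w v d s)) ∧
        Θ (Kneading.pt w v d s) = HNNExtension.t ∧
        ∀ g : Kneading.K w v, Θ (ι g) = HNNExtension.of g := by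
  refine ⟨Kneading.exists_isTwist hw hv hkn, fun s hs => ?_⟩
  obtain ⟨z, hz⟩ := hd.1
  have hR := Kneading.rels_presented hw hv hz s
  refine ⟨Kneading.isFinitelyPresented_FPGroup w v d s, Kneading.closure_pb_pt hw hR, ?_⟩
  obtain ⟨φ, ψ, hφ, hψ0, hψ⟩ := Kneading.exists_shift hw hv hlast hkn hs
  have hφi : Function.Injective φ := by
    rw [injective_iff_map_eq_one]
    intro g hg
    have h := hψ0 g
    rw [hg] at h
    exact Subtype.ext h.left_eq_one
  obtain ⟨ι, hι⟩ := hR.exists_hom hw hv hlast hkn hs.1 hd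
  have hιφ := hR.map_shift hs.1 hφ hι
  have hιA := Kneading.map_aElt_of_shift hφ hs.1 hι hιφ
  have hιB : ι (Kneading.genB w v 0 hw) = Kneading.pb w v d s := hι (.b 0) hw
  obtain ⟨Θ, hΘt, hΘ⟩ := Kneading.exists_mulEquiv_hnn hφi hs.1 hz hφ
    (Kneading.rels_hnn hs hz hφ hψ0 hψ) hι hιφ
  -- Composed with Θ, the map ι becomes the embedding of the base group in the HNN extension.
  have hιi : Function.Injective ι := fun g g' hgg => HNNExtension.of_injective
    (φ := (MonoidHom.ofInjective hφi).symm.trans Subgroup.topEquiv.symm)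
    (by rw [← hΘ, hgg, hΘ])
  exact ⟨_, φ, hφi, (MonoidHom.ofInjective hιi).trans
    (MulEquiv.subgroupCongr (hR.range_eq hw hs.1 hι hιφ hιA hιB)), Θ,
    Kneading.coe_lift_bK hw hs.1, hφ, hιB, hιA, hιφ, hΘt, hΘ⟩
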